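/- **Conventions.** Chain complexes are $\mathbb{Z}$-graded with differential of degree $-1$. For a chain complex $V$ of real vector spaces let $\underline{\mathrm{hom}}(\bigwedge^2V,\mathbb{R})$ be the mapping complex out of the graded exterior square, with $\mathbb{R}$ in degree $0$: its $k$-chains are families of bilinear maps $B:V_p\times V_q\to\mathbb{R}$, zero unless $p+q+k=0$, with $B(x,y)=-(-1)^{|x||y|}B(y,x)$, and $\partial B(x,y)=-(-1)^k\big(B(dx,y)+(-1)^{|x|}B(x,dy)\big)$. Let $\mathbf{PoCh}_{\mathbb{R}}$ be the category of pairs $(V,\tau)$ of such a $V$ and a chain map $\tau:V\wedge V\to\mathbb{R}$ (a $0$-chain with $\partial\tau=0$), with morphisms the chain maps $f$ satisfying $\tau'(f\wedge f)=\tau$. Let $\mathbf{dg^*Alg}_{\mathbb{C}}$ be the category of differential graded unital associative $*$-algebras over $\mathbb{C}$ (the antilinear involution preserves degrees, commutes with $d$, and satisfies $(ab)^*=(-1)^{|a||b|}b^*a^*$). Let $\mathfrak{CCR}:\mathbf{PoCh}_{\mathbb{R}}\to\mathbf{dg^*Alg}_{\mathbb{C}}$ be the functor sending $(V,\tau)$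 to the quotient of the tensor algebra of $V\otimes\mathbb{C}$, with $v^*=v$ for $v\in V$, by the two-sided ideal generated by $v_1\otimes v_2-(-1)^{|v_1||v_2|}v_2\otimes v_1-i\,\tau(v_1,v_2)\mathbb{1}$ for homogeneous $v_1,v_2\in V$. In both categories a weak equivalence is a morphism whose underlying chain map is a quasi-isomorphism; this makes them homotopical categories (the weak equivalences contain all isomorphisms and satisfy 2-of-6). In a functor category, a natural weak equivalence is a natural transformation all of whose components are weak equivalences; functor categories are homotopical categories in this way. A functor between homotopical categories is homotopical if it preserves weak equivalences. **Proposition.** Let $\mathbf{C}$ be any category; for example, the category $\mathbf{Loc}$ of oriented and time-oriented globally hyperbolic Lorentzian manifolds of a fixed dimension $m\ge 2$ with orientation and time-orientation preserving isometric embeddings whose image is open and causally convex, or a slice category $\mathbf{Loc}/\overline{M}$ with $\overline{M}\in\mathbf{Loc}$. a) Post-composition with $\mathfrak{CCR}$ is a homotopical functor $\mathfrak{CCR}\circ(-):\mathbf{Fun}(\mathbf{C},\mathbf{PoCh}_{\mathbb{R}})\to\mathbf{Fun}(\mathbf{C},\mathbf{dg^*Alg}_{\mathbb{C}})$. b) Let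 $(V,\tau):\mathbf{C}\to\mathbf{PoCh}_{\mathbb{R}}$ be a functor and let $\rho$ be a $\mathbf{C}$-natural $1$-chain, i.e. a family $\rho_M\in\underline{\mathrm{hom}}(\bigwedge^2V(M),\mathbb{R})_1$, $M\in\mathbf{C}$, with $\rho_N\,(V(f)\wedge V(f))=\rho_M$ for every morphism $f:M\to N$ of $\mathbf{C}$. Then there exist a functor $A:\mathbf{C}\to\mathbf{dg^*Alg}_{\mathbb{C}}$ and a zig-zag of natural weak equivalences $$\mathfrak{CCR}(V,\tau)\;\xleftarrow{\ \sim\ }\;A\;\xrightarrow{\ \sim\ }\;\mathfrak{CCR}(V,\tau+\partial\rho).$$ -/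

import Mathlib

open CategoryTheory
open scoped TensorProduct DirectSum

universe w v u

noncomputable section

namespace CCRQuant

/-! ### Homotopical categories -/

/-- The structure of a homotopical category on `C`: a class of weak equivalences which contains
all isomorphisms and satisfies the 2-of-6 property. -/
structure HomotopicalStructure (C : Type u) [Category.{v} C] where
  weq : MorphismProperty C
  of_isIso : ∀ {X Y : C} (f : X ⟶ Y), IsIso f → weq f
  two_of_six : ∀ {X Y Z T : C} (f : X ⟶ Y) (g : Y ⟶ Z) (h : Z ⟶ T),
    weq (f ≫ g) → weq (g ≫ h) → weq f ∧ weq g ∧ weq h ∧ weq (f ≫ g ≫ h)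

/-- A functor between homotopical categories is homotopical if it preserves weak equivalences. -/
def IsHomotopicalFunctor {C : Type*} [Category C] {D : Type*} [Category D]
    (hC : HomotopicalStructure C) (hD : HomotopicalStructure D) (F : C ⥤ D) : Prop :=
  ∀ ⦃X Y : C⦄ (f : X ⟶ Y), hC.weq f → hD.weq (F.map f)

/-- The class of all isomorphisms. -/
def HomotopicalStructure.isos (C : Type u) [Category.{v} C] : HomotopicalStructure C where
  weq := MorphismProperty.isomorphisms C
  of_isIso f hf := hf
  two_of_six {X Y Z T} f g h hfg hgh := by
    simp only [MorphismProperty.isomorphisms.iff] at *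
    have hg : IsIso g := by
      have h1 : (inv (f ≫ g) ≫ f) ≫ g = 𝟙 _ := by rw [Category.assoc, IsIso.inv_hom_id]
      have h2 : g ≫ (h ≫ inv (g ≫ h)) = 𝟙 _ := by rw [← Category.assoc, IsIso.hom_inv_id]
      have h3 : inv (f ≫ g) ≫ f = h ≫ inv (g ≫ h) := by
        calc inv (f ≫ g) ≫ f = (inv (f ≫ g) ≫ f) ≫ (g ≫ (h ≫ inv (g ≫ h))) := by
              rw [h2, Category.comp_id]
          _ = h ≫ inv (g ≫ h) := by rw [← Category.assoc, h1, Category.id_comp]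
      exact ⟨h ≫ inv (g ≫ h), h2, by rw [← h3, h1]⟩
    have hf : IsIso f := IsIso.of_isIso_comp_right f g
    have hh : IsIso h := IsIso.of_isIso_comp_left g h
    exact ⟨hf, hg, hh, inferInstance⟩

/-- The weak equivalences created by a family of functors. -/
def HomotopicalStructure.induced {C : Type*} [Category C] {D : Type*} [Category D] {ι : Type*}
    (F : ι → C ⥤ D) (hD : HomotopicalStructure D) : HomotopicalStructure C where
  weq := fun _ _ f => ∀ i, hD.weq ((F i).map f)
  of_isIso f hf i := hD.of_isIso _ inferInstance
  two_of_six f g h hfg hgh := by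
    have H := fun i => hD.two_of_six ((F i).map f) ((F i).map g) ((F i).map h)
      (by simpa using hfg i) (by simpa using hgh i)
    exact ⟨fun i => (H i).1, fun i => (H i).2.1, fun i => (H i).2.2.1,
      fun i => by simpa using (H i).2.2.2⟩

/-- Weak equivalences in a functor category: the natural weak equivalences, i.e. the natural
transformations all of whose components are weak equivalences. -/
def HomotopicalStructure.functorCategory (J : Type*) [Category J] {C : Type*} [Category C]
    (hC : HomotopicalStructure C) : HomotopicalStructure (J ⥤ C) where
  weq := hC.weq.functorCategory J
  of_isIso f hf j := hC.of_isIso _ inferInstance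
  two_of_six f g h hfg hgh := by
    have H := fun j => hC.two_of_six (f.app j) (g.app j) (h.app j) (hfg j) (hgh j)
    exact ⟨fun j => (H j).1, fun j => (H j).2.1, fun j => (H j).2.2.1, fun j => (H j).2.2.2⟩

/-- Chain complexes with the quasi-isomorphisms as weak equivalences. -/
def chHomotopical (K : Type) [Field K] :
    HomotopicalStructure (ChainComplex (ModuleCat.{w} K) ℤ) where
  weq := fun _ _ f => QuasiIso f
  of_isIso f hf := inferInstance
  two_of_six f g h hfg hgh := by
    have key := (HomotopicalStructure.induced
      (fun i : ℤ => HomologicalComplex.homologyFunctor (ModuleCat.{w} K)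
        (ComplexShape.down ℤ) i) (HomotopicalStructure.isos _)).two_of_six f g h
    have e : ∀ {X Y : ChainComplex (ModuleCat.{w} K) ℤ} (φ : X ⟶ Y),
        (HomotopicalStructure.induced (fun i : ℤ => HomologicalComplex.homologyFunctor
          (ModuleCat.{w} K) (ComplexShape.down ℤ) i) (HomotopicalStructure.isos _)).weq φ ↔
        QuasiIso φ := by
      intro X Y φ
      rw [quasiIso_iff]
      exact forall_congr' fun i => (quasiIsoAt_iff_isIso_homologyMap φ i).symm
    simp only [e] at key
    exact key hfg hgh

/-! ### The mapping complex out of the graded exterior square -/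

/-- The Koszul sign `(-1)^n`. -/
def ksign (n : ℤ) : ℤ := (n.negOnePow : ℤ)

/-- Chain complexes of real vector spaces, with differential of degree `-1`. -/
abbrev ChR := ChainComplex (ModuleCat.{w} ℝ) ℤ

/-- The degree `k` component `∏ₘ Lin((⋀²V)ₘ, ℝ_{k+m})` of the mapping complex `hom(⋀²V, ℝ)`,
where `ℝ` is concentrated in degree `0` and `⋀²V` is the graded exterior square, i.e. the
quotient of `V ⊗ V` by `v ⊗ w + (-1)^{|v||w|} w ⊗ v`. By the universal property, an element is a
family of graded antisymmetric bilinear maps `V_p × V_q → ℝ` vanishing unless `p + q + k = 0`. -/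
def ExtHom (V : ChR.{w}) (k : ℤ) :
    Submodule ℝ (∀ p q : ℤ, V.X p →ₗ[ℝ] V.X q →ₗ[ℝ] ℝ) where
  carrier := {B | (∀ p q, p + q + k ≠ 0 → B p q = 0) ∧
    ∀ p q (x : V.X p) (y : V.X q), B p q x y = -(ksign (p * q) • B q p y x)}
  zero_mem' := by simp
  add_mem' := by
    rintro a b ⟨ha, ha'⟩ ⟨hb, hb'⟩
    refine ⟨fun p q h => by simp [ha p q h, hb p q h], fun p q x y => ?_⟩
    simp only [Pi.add_apply, LinearMap.add_apply, smul_add, neg_add]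
    rw [ha' p q x y, hb' p q x y]
  smul_mem' := by
    rintro c a ⟨ha, ha'⟩
    refine ⟨fun p q h => by simp [ha p q h], fun p q x y => ?_⟩
    simp only [Pi.smul_apply, LinearMap.smul_apply]
    rw [ha' p q x y, smul_neg, smul_comm]

theorem ksign_add (m n : ℤ) : ksign (m + n) = ksign m * ksign n := by
  simp [ksign, Int.negOnePow_add]

theorem ksign_mul_self (m : ℤ) : ksign m * ksign m = 1 := by
  simp [ksign, ← Units.val_mul]

theorem ksign_zero : ksign 0 = 1 := by simp [ksign]

theorem ksign_one : ksign 1 = -1 := by simp [ksign]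

theorem ksign_neg (m : ℤ) : ksign (-m) = ksign m := by simp [ksign]

theorem ksign_sub (m n : ℤ) : ksign (m - n) = ksign m * ksign n := by
  simp [ksign, Int.negOnePow_sub]

theorem ksign_mul_self' (m : ℤ) : ksign (m * m) = ksign m := by simp [ksign]

theorem ksign_cases (m : ℤ) : ksign m = 1 ∨ ksign m = -1 := by
  rcases Int.units_eq_one_or m.negOnePow with h | h <;> simp [ksign, h]

namespace ExtHom

/-- The adjoint differential `∂B = -(-1)^k B ∘ d` of the mapping complex (the differential of `ℝ`
vanishes), where `d (x ⊗ y) = dx ⊗ y + (-1)^{|x|} x ⊗ dy`. -/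
def del {V : ChR.{w}} (k k' : ℤ) (hk : k' + 1 = k) : ExtHom V k →ₗ[ℝ] ExtHom V k' where
  toFun B := ⟨fun p q => -(ksign k • ((B.1 (p - 1) q) ∘ₗ (V.d p (p - 1)).hom
      + ksign p • (B.1 p (q - 1)).compl₂ (V.d q (q - 1)).hom)), by
    refine ⟨fun p q h => ?_, fun p q x y => ?_⟩
    · beta_reduce
      rw [B.2.1 (p - 1) q (by omega), B.2.1 p (q - 1) (by omega)]
      ext; simp
    · simp only [LinearMap.neg_apply, LinearMap.smul_apply, LinearMap.add_apply,
        LinearMap.comp_apply, LinearMap.compl₂_apply]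
      rw [B.2.2 (p - 1) q, B.2.2 p (q - 1), sub_mul, mul_sub]
      simp only [ksign_sub, one_mul, mul_one]
      generalize B.1 q (p - 1) y ((V.d p (p - 1)).hom x) = a
      generalize B.1 (q - 1) p ((V.d q (q - 1)).hom y) x = b
      rcases ksign_cases p with hp | hp <;> rcases ksign_cases q with hq | hq <;>
        rcases ksign_cases (p * q) with hpq | hpq <;>
        simp [hp, hq, hpq]⟩
  map_add' B B' := by
    apply Subtype.ext; funext p q; ext x y
    simp
    ring
  map_smul' c B := by
    apply Subtype.ext; funext p q; ext x y
    simp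
    ring

theorem del_apply {V : ChR.{w}} (k k' : ℤ) (hk : k' + 1 = k) (B : ExtHom V k) (p q : ℤ)
    (x : V.X p) (y : V.X q) :
    (del k k' hk B).1 p q x y = -(ksign k • (B.1 (p - 1) q ((V.d p (p - 1)).hom x) y
      + ksign p • B.1 p (q - 1) x ((V.d q (q - 1)).hom y))) := rfl

theorem d_d_hom {K : Type} [Field K] (V : ChainComplex (ModuleCat.{w} K) ℤ) (i j l : ℤ)
    (x : V.X i) : (V.d j l).hom ((V.d i j).hom x) = 0 := by
  rw [← LinearMap.comp_apply, ← ModuleCat.hom_comp, V.d_comp_d]; rfl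

theorem del_del {V : ChR.{w}} (k k' k'' : ℤ) (hk : k' + 1 = k) (hk' : k'' + 1 = k')
    (B : ExtHom V k) : del k' k'' hk' (del k k' hk B) = 0 := by
  apply Subtype.ext; funext p q; ext x y
  rw [del_apply]
  simp only [del_apply, d_d_hom, ksign_sub, ksign_one]
  simp
  rcases ksign_cases p with hp | hp <;> simp [hp]

/-- Precomposition with `f ∧ f`, for a chain map `f`. -/
def pullback {V W : ChR.{w}} (f : V ⟶ W) (k : ℤ) : ExtHom W k →ₗ[ℝ] ExtHom V k where
  toFun B := ⟨fun p q => (B.1 p q).compl₁₂ (f.f p).hom (f.f q).hom, by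
    refine ⟨fun p q h => ?_, fun p q x y => ?_⟩
    · beta_reduce
      rw [B.2.1 p q h]; ext; simp
    · exact B.2.2 p q _ _⟩
  map_add' B B' := by
    apply Subtype.ext; funext p q; ext x y; simp
  map_smul' c B := by
    apply Subtype.ext; funext p q; ext x y; simp

theorem pullback_apply {V W : ChR.{w}} (f : V ⟶ W) (k : ℤ) (B : ExtHom W k) (p q : ℤ)
    (x : V.X p) (y : V.X q) :
    (pullback f k B).1 p q x y = B.1 p q ((f.f p).hom x) ((f.f q).hom y) := rfl

theorem pullback_id {V : ChR.{w}} (k : ℤ) (B : ExtHom V k) : pullback (𝟙 V) k B = B := by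
  apply Subtype.ext; funext p q; ext x y; simp [pullback_apply]

theorem pullback_comp {V W U : ChR.{w}} (f : V ⟶ W) (g : W ⟶ U) (k : ℤ) (B : ExtHom U k) :
    pullback (f ≫ g) k B = pullback f k (pullback g k B) := by
  apply Subtype.ext; funext p q; ext x y; simp [pullback_apply]

theorem f_d_hom {V W : ChR.{w}} (f : V ⟶ W) (i j : ℤ) (x : V.X i) :
    (W.d i j).hom ((f.f i).hom x) = (f.f j).hom ((V.d i j).hom x) := by
  rw [← LinearMap.comp_apply, ← ModuleCat.hom_comp, f.comm]; rfl

theorem pullback_del {V W : ChR.{w}} (f : V ⟶ W) (k k' : ℤ) (hk : k' + 1 = k)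
    (B : ExtHom W k) : pullback f k' (del k k' hk B) = del k k' hk (pullback f k B) := by
  apply Subtype.ext; funext p q; ext x y
  simp only [pullback_apply, del_apply, f_d_hom]

end ExtHom

/-! ### Unshifted Poisson complexes -/

/-- An unshifted Poisson complex: a chain complex `V` of real vector spaces with a chain map
`τ : V ∧ V → ℝ`, i.e. a `0`-cycle of `hom(⋀²V, ℝ)`. -/
structure PoCh where
  V : ChR.{w}
  τ : ExtHom V 0
  closed : ExtHom.del 0 (-1) rfl τ = 0

/-- A morphism of unshifted Poisson complexes: a chain map `f` with `τ' ∘ (f ∧ f) = τ`. -/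
@[ext]
structure PoCh.Hom (X Y : PoCh.{w}) where
  f : X.V ⟶ Y.V
  comm : ExtHom.pullback f 0 Y.τ = X.τ

instance : Category PoCh.{w} where
  Hom := PoCh.Hom
  id X := ⟨𝟙 X.V, ExtHom.pullback_id _ _⟩
  comp f g := ⟨f.f ≫ g.f, by rw [ExtHom.pullback_comp, g.comm, f.comm]⟩
  id_comp f := PoCh.Hom.ext (Category.id_comp _)
  comp_id f := PoCh.Hom.ext (Category.comp_id _)
  assoc f g h := PoCh.Hom.ext (Category.assoc _ _ _)

/-- The underlying chain complex of an unshifted Poisson complex. -/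
def PoCh.forget : PoCh.{w} ⥤ ChR.{w} where
  obj X := X.V
  map f := f.f

/-- A morphism of `PoCh` is a weak equivalence if its underlying chain map is a
quasi-isomorphism. -/
def PoCh.homotopical : HomotopicalStructure PoCh.{w} :=
  HomotopicalStructure.induced (fun _ : Unit => PoCh.forget) (chHomotopical ℝ)

/-- The unshifted Poisson complex `(V, τ + ∂ρ)`. -/
def PoCh.perturb (X : PoCh.{w}) (ρ : ExtHom X.V 1) : PoCh.{w} where
  V := X.V
  τ := X.τ + ExtHom.del 1 0 rfl ρ
  closed := by rw [map_add, X.closed, ExtHom.del_del, add_zero]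

/-- A morphism `g : (V, τ) ⟶ (W, σ)` which also relates the `1`-chains `r` and `s`, regarded as a
morphism `(V, τ + ∂r) ⟶ (W, σ + ∂s)`. -/
def PoCh.perturbHom {X Y : PoCh.{w}} (g : X ⟶ Y) (r : ExtHom X.V 1) (s : ExtHom Y.V 1)
    (h : ExtHom.pullback g.f 1 s = r) : X.perturb r ⟶ Y.perturb s where
  f := g.f
  comm := by
    have key : ExtHom.pullback (V := X.V) (W := Y.V) g.f 0 (Y.τ + ExtHom.del 1 0 rfl s)
        = X.τ + ExtHom.del 1 0 rfl r := by
      rw [map_add, g.comm, ExtHom.pullback_del, h]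
    exact key

/-- The `C`-natural `k`-chains, i.e. the elements of degree `k` of the limit over `Cᵒᵖ` of the
mapping complexes `hom(⋀²V(c), ℝ)`: families `ρ_c` with `ρ_{c'} ∘ (V(f) ∧ V(f)) = ρ_c` for all
morphisms `f : c ⟶ c'`. -/
structure NatChain {C : Type u} [Category.{v} C] (V : C ⥤ ChR.{w}) (k : ℤ) where
  app : ∀ c : C, ExtHom (V.obj c) k
  naturality : ∀ {c c' : C} (f : c ⟶ c'), ExtHom.pullback (V.map f) k (app c') = app c

/-- The functor `(V, τ + ∂ρ)` for a functor `(V, τ)` and a `C`-natural `1`-chain `ρ`; it has the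
same underlying functor `V` to chain complexes. -/
def PoCh.perturbFunctor {C : Type u} [Category.{v} C] (F : C ⥤ PoCh.{w})
    (ρ : NatChain (F ⋙ PoCh.forget) 1) : C ⥤ PoCh.{w} where
  obj c := (F.obj c).perturb (ρ.app c)
  map {c c'} f := PoCh.perturbHom (F.map f) (ρ.app c) (ρ.app c') (ρ.naturality f)
  map_id c := by
    have h := congrArg PoCh.Hom.f (F.map_id c)
    exact PoCh.Hom.ext h
  map_comp f g := by
    have h := congrArg PoCh.Hom.f (F.map_comp f g)
    exact PoCh.Hom.ext h

/-! ### Differential graded `*`-algebras -/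

/-- A differential graded unital associative `*`-algebra over `ℂ`: a `ℤ`-graded algebra with a
differential of degree `-1` obeying the graded Leibniz rule, and a degree preserving antilinear
involution which commutes with the differential and satisfies `(ab)* = (-1)^{|a||b|} b* a*`. -/
structure DGStarAlg where
  carrier : Type w
  [ring : Ring carrier]
  [algebra : Algebra ℂ carrier]
  gr : ℤ → Submodule ℂ carrier
  [graded : GradedAlgebra gr]
  d : carrier →ₗ[ℂ] carrier
  d_mem : ∀ (i j : ℤ), j + 1 = i → ∀ a ∈ gr i, d a ∈ gr j
  d_d : ∀ a, d (d a) = 0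
  leibniz : ∀ (i : ℤ), ∀ a ∈ gr i, ∀ b, d (a * b) = d a * b + ksign i • (a * d b)
  star : carrier →ₗ⋆[ℂ] carrier
  star_mem : ∀ (i : ℤ), ∀ a ∈ gr i, star a ∈ gr i
  star_star : ∀ a, star (star a) = a
  star_mul : ∀ (i j : ℤ), ∀ a ∈ gr i, ∀ b ∈ gr j,
    star (a * b) = ksign (i * j) • (star b * star a)
  d_star : ∀ a, d (star a) = star (d a)

attribute [instance] DGStarAlg.ring DGStarAlg.algebra DGStarAlg.graded

/-- Morphisms of differential graded `*`-algebras. -/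
@[ext]
structure DGStarAlg.Hom (A B : DGStarAlg.{w}) where
  f : A.carrier →ₐ[ℂ] B.carrier
  map_mem : ∀ (i : ℤ), ∀ a ∈ A.gr i, f a ∈ B.gr i
  map_d : ∀ a, f (A.d a) = B.d (f a)
  map_star : ∀ a, f (A.star a) = B.star (f a)

instance : Category DGStarAlg.{w} where
  Hom := DGStarAlg.Hom
  id A := ⟨AlgHom.id ℂ _, fun _ _ h => h, fun _ => rfl, fun _ => rfl⟩
  comp f g := ⟨g.f.comp f.f, fun i a h => g.map_mem i _ (f.map_mem i a h),
    fun a => by simp [f.map_d, g.map_d], fun a => by simp [f.map_star, g.map_star]⟩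

/-- The underlying chain complex of a differential graded `*`-algebra. -/
def DGStarAlg.toCh : DGStarAlg.{w} ⥤ ChainComplex (ModuleCat.{w} ℂ) ℤ where
  obj A :=
    { X := fun n => ModuleCat.of ℂ (A.gr n)
      d := fun i j => if h : j + 1 = i then
        ModuleCat.ofHom (A.d.restrict (A.d_mem i j h)) else 0
      shape := fun i j h => dif_neg h
      d_comp_d' := fun i j k hij hjk => by
        have hij' : j + 1 = i := hij
        have hjk' : k + 1 = j := hjk
        rw [dif_pos hij', dif_pos hjk']
        ext x
        exact A.d_d _ }
  map {A B} f :=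
    { f := fun n => ModuleCat.ofHom (f.f.toLinearMap.restrict (f.map_mem n))
      comm' := fun i j hij => by
        have hij' : j + 1 = i := hij
        simp only [dif_pos hij']
        ext x
        exact (f.map_d _).symm }

/-- A morphism of `DGStarAlg` is a weak equivalence if its underlying chain map is a
quasi-isomorphism. -/
def DGStarAlg.homotopical : HomotopicalStructure DGStarAlg.{w} :=
  HomotopicalStructure.induced (fun _ : Unit => DGStarAlg.toCh) (chHomotopical ℂ)

/-! ### The CCR algebra

The CCR algebra of `(V, τ)` is the quotient of the tensor algebra `T(V_ℂ)` over `ℂ` of the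
complexification `V_ℂ = ℂ ⊗ V` by the two-sided ideal generated by the graded canonical
commutation relations. As `τ` is a chain map, this ideal is stable under `d` and `*`. -/

/-- The total space of the complexification of `V`. -/
abbrev Cplx (V : ChR.{w}) : Type w := ℂ ⊗[ℝ] (⨁ n : ℤ, V.X n)

/-- The element `1 ⊗ x` of the tensor algebra, for a homogeneous `x ∈ V_p`. -/
def tgen (V : ChR.{w}) (p : ℤ) (x : V.X p) : TensorAlgebra ℂ (Cplx V) :=
  TensorAlgebra.ι ℂ (1 ⊗ₜ[ℝ] DirectSum.lof ℝ ℤ (fun n => V.X n) p x)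

/-- The graded canonical commutation relations
`x ⊗ y - (-1)^{|x||y|} y ⊗ x = i τ(x, y) 1` for homogeneous `x`, `y`. -/
inductive CCRRel (X : PoCh.{w}) :
    TensorAlgebra ℂ (Cplx X.V) → TensorAlgebra ℂ (Cplx X.V) → Prop
  | ccr (p q : ℤ) (x : X.V.X p) (y : X.V.X q) :
      CCRRel X (tgen X.V p x * tgen X.V q y - ksign (p * q) • (tgen X.V q y * tgen X.V p x))
        (algebraMap ℂ _ (Complex.I * (X.τ.1 p q x y : ℝ)))

/-- The underlying algebra of the CCR quantization of `(V, τ)`. -/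
def CCRAlg (X : PoCh.{w}) : Type w := RingQuot (CCRRel X)

instance (X : PoCh.{w}) : Ring (CCRAlg X) := inferInstanceAs (Ring (RingQuot (CCRRel X)))

instance (X : PoCh.{w}) : Algebra ℂ (CCRAlg X) :=
  inferInstanceAs (Algebra ℂ (RingQuot (CCRRel X)))

namespace CCRAlg

variable {X : PoCh.{w}}

/-- The quotient map. -/
def mk (X : PoCh.{w}) : TensorAlgebra ℂ (Cplx X.V) →ₐ[ℂ] CCRAlg X :=
  RingQuot.mkAlgHom ℂ (CCRRel X)

/-- The generator of the CCR algebra given by a homogeneous element of `V`. -/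
def gen (X : PoCh.{w}) (p : ℤ) : X.V.X p →ₗ[ℝ] CCRAlg X where
  toFun x := mk X (tgen X.V p x)
  map_add' x y := by simp [tgen, TensorProduct.tmul_add]
  map_smul' c x := by
    have h : (1 : ℂ) ⊗ₜ[ℝ] (c • DirectSum.lof ℝ ℤ (fun n => X.V.X n) p x)
        = (c : ℂ) • ((1 : ℂ) ⊗ₜ[ℝ] DirectSum.lof ℝ ℤ (fun n => X.V.X n) p x) := by
      rw [TensorProduct.tmul_smul, TensorProduct.smul_tmul', TensorProduct.smul_tmul']
      congr 1
    simp only [tgen, map_smul, RingHom.id_apply]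
    rw [h, map_smul, map_smul]
    rfl

theorem gen_ccr (p q : ℤ) (x : X.V.X p) (y : X.V.X q) :
    gen X p x * gen X q y - ksign (p * q) • (gen X q y * gen X p x)
      = algebraMap ℂ _ (Complex.I * (X.τ.1 p q x y : ℝ)) := by
  have h : mk X _ = mk X _ := RingQuot.mkAlgHom_rel ℂ (CCRRel.ccr (X := X) p q x y)
  rw [AlgHom.commutes, map_sub, map_zsmul, map_mul, map_mul] at h
  exact h

/-- A real linear map into a complex vector space. -/
def realLin {E B : Type*} [AddCommGroup E] [Module ℝ E] [AddCommGroup B] [Module ℂ B]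
    (f : E → B) (hadd : ∀ x y, f (x + y) = f x + f y)
    (hsmul : ∀ (c : ℝ) x, f (c • x) = (c : ℂ) • f x) : E →ₗ[ℝ] B where
  toFun := f
  map_add' := hadd
  map_smul' c x := by rw [hsmul]; rfl

theorem realLin_apply {E B : Type*} [AddCommGroup E] [Module ℝ E] [AddCommGroup B] [Module ℂ B]
    (f : E → B) (hadd hsmul) (x : E) : realLin f hadd hsmul x = f x := rfl

theorem gen_smul (p : ℤ) (c : ℝ) (x : X.V.X p) :
    gen X p (c • x) = (c : ℂ) • gen X p x := by rw [map_smul]; rfl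

/-- The universal property of the CCR algebra. -/
def lift {B : Type*} [Ring B] [Algebra ℂ B] (g : ∀ p : ℤ, X.V.X p →ₗ[ℝ] B)
    (hg : ∀ (p q : ℤ) (x : X.V.X p) (y : X.V.X q),
      g p x * g q y - ksign (p * q) • (g q y * g p x)
        = algebraMap ℂ B (Complex.I * (X.τ.1 p q x y : ℝ))) : CCRAlg X →ₐ[ℂ] B :=
  RingQuot.liftAlgHom ℂ ⟨TensorAlgebra.lift ℂ
    (LinearMap.liftBaseChange ℂ (DirectSum.toModule ℝ ℤ B g)), by
      rintro _ _ ⟨p, q, x, y⟩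
      simpa [tgen] using hg p q x y⟩

theorem lift_gen {B : Type*} [Ring B] [Algebra ℂ B] (g : ∀ p : ℤ, X.V.X p →ₗ[ℝ] B)
    (hg : ∀ (p q : ℤ) (x : X.V.X p) (y : X.V.X q),
      g p x * g q y - ksign (p * q) • (g q y * g p x)
        = algebraMap ℂ B (Complex.I * (X.τ.1 p q x y : ℝ))) (p : ℤ) (x : X.V.X p) :
    lift g hg (gen X p x) = g p x := by
  refine (RingQuot.liftAlgHom_mkAlgHom_apply ℂ _ _ _).trans ?_
  simp [tgen]

theorem hom_ext {B : Type*} [Ring B] [Algebra ℂ B] {f g : CCRAlg X →ₐ[ℂ] B}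
    (h : ∀ (p : ℤ) (x : X.V.X p), f (gen X p x) = g (gen X p x)) : f = g := by
  apply RingQuot.ringQuot_ext'
  apply TensorAlgebra.hom_ext
  apply TensorProduct.AlgebraTensorModule.curry_injective
  ext p x
  exact h p x

/-- The product of a list of generators. -/
def genProd (l : List (Σ p : ℤ, X.V.X p)) : CCRAlg X := (l.map fun s => gen X s.1 s.2).prod

/-- The degree `n` part of the CCR algebra: the span of the products of homogeneous generators of
total degree `n`. -/
def gr (X : PoCh.{w}) (n : ℤ) : Submodule ℂ (CCRAlg X) :=
  Submodule.span ℂ {a | ∃ l : List (Σ p : ℤ, X.V.X p), (l.map Sigma.fst).sum = n ∧ genProd l = a}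

theorem gen_mem (p : ℤ) (x : X.V.X p) : gen X p x ∈ gr X p :=
  Submodule.subset_span ⟨[⟨p, x⟩], by simp, by simp [genProd]⟩

instance : SetLike.GradedMonoid (gr X) where
  one_mem := Submodule.subset_span ⟨[], by simp, by simp [genProd]⟩
  mul_mem := by
    intro i j a b ha hb
    have h : gr X i * gr X j ≤ gr X (i + j) := by
      rw [gr, gr, Submodule.span_mul_span]
      refine Submodule.span_mono ?_
      rintro _ ⟨_, ⟨l, hl, rfl⟩, _, ⟨m, hm, rfl⟩, rfl⟩
      exact ⟨l ++ m, by simp [hl, hm], by simp [genProd]⟩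
    exact h (Submodule.mul_mem_mul ha hb)

/-- Induction for homogeneous elements. -/
theorem gr_induction {P : ℤ → CCRAlg X → Prop} (h_one : P 0 1)
    (h_gen : ∀ (p q : ℤ) (x : X.V.X p) (b : CCRAlg X), b ∈ gr X q → P q b →
      P (p + q) (gen X p x * b))
    (h_add : ∀ n a b, P n a → P n b → P n (a + b))
    (h_smul : ∀ n (c : ℂ) a, P n a → P n (c • a)) (n : ℤ) (a : CCRAlg X) (ha : a ∈ gr X n) :
    P n a := by
  have key : ∀ l : List (Σ p : ℤ, X.V.X p), P (l.map Sigma.fst).sum (genProd l) := by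
    intro l
    induction l with
    | nil => simpa [genProd] using h_one
    | cons s l ih =>
      have := h_gen s.1 _ s.2 (genProd l) (Submodule.subset_span ⟨l, rfl, rfl⟩) ih
      simpa [genProd] using this
  refine Submodule.span_induction (p := fun a _ => P n a) ?_ ?_ ?_ ?_ ha
  · rintro _ ⟨l, rfl, rfl⟩
    exact key l
  · by_cases h : ∃ l : List (Σ p : ℤ, X.V.X p), (l.map Sigma.fst).sum = n
    · obtain ⟨l, rfl⟩ := h
      simpa using h_smul _ 0 _ (key l)
    · exfalso
      exact h ⟨[⟨n, 0⟩], by simp⟩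
  · intro a b _ _ ha hb; exact h_add n a b ha hb
  · intro c a _ ha; exact h_smul n c a ha

theorem tau_eq_zero (p q : ℤ) (h : p + q ≠ 0) (x : X.V.X p) (y : X.V.X q) :
    X.τ.1 p q x y = 0 := by
  rw [X.τ.2.1 p q (by simpa using h)]; rfl

theorem ksign_tau (p q : ℤ) (x : X.V.X p) (y : X.V.X q) :
    ksign (p + q) • algebraMap ℂ (CCRAlg X) (Complex.I * (X.τ.1 p q x y : ℝ))
      = algebraMap ℂ (CCRAlg X) (Complex.I * (X.τ.1 p q x y : ℝ)) := by
  by_cases h : p + q = 0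
  · rw [h, ksign_zero, one_smul]
  · rw [tau_eq_zero p q h]; simp

/-- The generators, in the direct sum of the homogeneous parts. -/
def grGen (X : PoCh.{w}) (p : ℤ) : X.V.X p →ₗ[ℝ] ⨁ n : ℤ, gr X n :=
  realLin (fun x => DirectSum.of (fun n => gr X n) p ⟨gen X p x, gen_mem p x⟩)
    (fun x y => by
      rw [← map_add]; congr 1; apply Subtype.ext; exact map_add _ _ _)
    (fun c x => by
      refine Eq.trans ?_ ((DirectSum.lof ℂ ℤ (fun n => gr X n) p).map_smul (c : ℂ) _)
      rw [DirectSum.lof_eq_of]; congr 1; apply Subtype.ext; exact gen_smul p c x)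

theorem grGen_apply (p : ℤ) (x : X.V.X p) :
    grGen X p x = DirectSum.of (fun n => gr X n) p ⟨gen X p x, gen_mem p x⟩ := rfl

theorem grGen_ccr (p q : ℤ) (x : X.V.X p) (y : X.V.X q) :
    grGen X p x * grGen X q y - ksign (p * q) • (grGen X q y * grGen X p x)
      = algebraMap ℂ _ (Complex.I * (X.τ.1 p q x y : ℝ)) := by
  simp only [grGen_apply]
  have e1 : ∀ (i j : ℤ) (h : i = j) (a : CCRAlg X) (ha : a ∈ gr X i),
      DirectSum.of (fun n => gr X n) i ⟨a, ha⟩ = DirectSum.of (fun n => gr X n) j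
        ⟨a, h ▸ ha⟩ := by
    rintro i _ rfl a ha; rfl
  have e2 : (DirectSum.of (fun n => gr X n) p ⟨gen X p x, gen_mem p x⟩ *
        DirectSum.of (fun n => gr X n) q ⟨gen X q y, gen_mem q y⟩ -
      ksign (p * q) • (DirectSum.of (fun n => gr X n) q ⟨gen X q y, gen_mem q y⟩ *
        DirectSum.of (fun n => gr X n) p ⟨gen X p x, gen_mem p x⟩)) =
      DirectSum.of (fun n => gr X n) (p + q)
        ⟨gen X p x * gen X q y - ksign (p * q) • (gen X q y * gen X p x),
          sub_mem (SetLike.mul_mem_graded (gen_mem p x) (gen_mem q y))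
            (zsmul_mem (add_comm q p ▸ SetLike.mul_mem_graded (gen_mem q y) (gen_mem p x)) _)⟩ := by
    rw [DirectSum.of_mul_of, DirectSum.of_mul_of]
    erw [e1 (q + p) (p + q) (add_comm q p)]
    exact (congrArg₂ _ rfl (map_zsmul (DirectSum.of (fun n => gr X n) (p + q)) _ _).symm).trans
      (map_sub (DirectSum.of (fun n => gr X n) (p + q)) _ _).symm
  rw [e2]
  by_cases h : p + q = 0
  · rw [DirectSum.algebraMap_apply, e1 (p + q) 0 h]
    congr 1
    apply Subtype.ext
    exact gen_ccr p q x y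
  · have e3 : ∀ (a : CCRAlg X) (ha : a ∈ gr X (p + q)), a = 0 →
        DirectSum.of (fun n => gr X n) (p + q) ⟨a, ha⟩ = 0 := by
      rintro a ha rfl
      exact map_zero (DirectSum.of (fun n => gr X n) (p + q))
    rw [e3 _ _ ((gen_ccr p q x y).trans (by rw [tau_eq_zero p q h]; simp)), tau_eq_zero p q h]
    rw [Complex.ofReal_zero, mul_zero, map_zero]

/-- The map to the direct sum of the homogeneous parts. -/
def decomposeHom (X : PoCh.{w}) : CCRAlg X →ₐ[ℂ] ⨁ n : ℤ, gr X n :=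
  lift (B := ⨁ n : ℤ, gr X n) (grGen X) grGen_ccr

instance gradedAlgebra (X : PoCh.{w}) : GradedAlgebra (gr X) :=
  GradedAlgebra.ofAlgHom (gr X) (decomposeHom X)
    (hom_ext fun p x => by
      simp [decomposeHom, lift_gen, grGen_apply])
    (by
      rintro n ⟨a, ha⟩
      suffices h : ∃ ha : a ∈ gr X n,
          decomposeHom X a = DirectSum.of (fun n => gr X n) n ⟨a, ha⟩ from h.2
      refine gr_induction (P := fun n a => ∃ ha : a ∈ gr X n,
          decomposeHom X a = DirectSum.of (fun n => gr X n) n ⟨a, ha⟩) ?_ ?_ ?_ ?_ n a ha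
      · exact ⟨SetLike.GradedOne.one_mem, by rw [map_one]; rfl⟩
      · rintro p q x b - ⟨hb, hb'⟩
        refine ⟨SetLike.mul_mem_graded (gen_mem p x) hb, ?_⟩
        rw [map_mul, hb', decomposeHom, lift_gen, grGen_apply, DirectSum.of_mul_of]
        rfl
      · rintro n a b ⟨ha, ha'⟩ ⟨hb, hb'⟩
        exact ⟨add_mem ha hb, by rw [map_add, ha', hb', ← map_add]; rfl⟩
      · rintro n c a ⟨ha, ha'⟩
        exact ⟨Submodule.smul_mem _ c ha, by
          rw [map_smul, ha', ← DirectSum.lof_eq_of ℂ, ← map_smul]; rfl⟩)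

/-- Induction for all elements. -/
theorem induction {P : CCRAlg X → Prop} (h_one : P 1)
    (h_gen : ∀ (p : ℤ) (x : X.V.X p) (b : CCRAlg X), P b → P (gen X p x * b))
    (h_add : ∀ a b, P a → P b → P (a + b)) (h_smul : ∀ (c : ℂ) a, P a → P (c • a))
    (a : CCRAlg X) : P a := by
  refine DirectSum.Decomposition.inductionOn (gr X) (motive := P) ?_ ?_ h_add a
  · simpa using h_smul 0 1 h_one
  · intro i m
    exact gr_induction (P := fun _ a => P a) h_one (fun _ _ _ _ _ => h_gen _ _ _)
      (fun _ => h_add) (fun _ => h_smul) i m.1 m.2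

/-! #### The differential -/

/-- The grading automorphism `a ↦ (-1)^{|a|} a`. -/
def gradeInv (X : PoCh.{w}) : CCRAlg X →ₐ[ℂ] CCRAlg X :=
  lift (fun p => ksign p • gen X p) (by
    intro p q x y
    simp only [LinearMap.smul_apply, smul_mul_smul_comm]
    rw [smul_comm, mul_comm (ksign q), ← smul_sub, gen_ccr, ← ksign_add, ksign_tau])

theorem gradeInv_gen (p : ℤ) (x : X.V.X p) : gradeInv X (gen X p x) = ksign p • gen X p x := by
  rw [gradeInv, lift_gen]; rfl

theorem gradeInv_of_mem (n : ℤ) (a : CCRAlg X) (ha : a ∈ gr X n) :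
    gradeInv X a = ksign n • a := by
  refine gr_induction (P := fun n a => gradeInv X a = ksign n • a) ?_ ?_ ?_ ?_ n a ha
  · simp [ksign_zero]
  · intro p q x b _ hb
    rw [map_mul, hb, gradeInv_gen, smul_mul_smul_comm, ksign_add]
  · intro n a b ha hb
    rw [map_add, ha, hb, smul_add]
  · intro n c a ha
    rw [map_smul, ha, smul_comm]

/-- The matrix of a generator used to extend the differential, see `diffHom`. -/
def diffGen (X : PoCh.{w}) (p : ℤ) : X.V.X p →ₗ[ℝ] Matrix (Fin 2) (Fin 2) (CCRAlg X) :=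
  realLin (fun x => !![ksign p • gen X p x, gen X (p - 1) ((X.V.d p (p - 1)).hom x);
      0, gen X p x])
    (fun x y => by ext i j; fin_cases i <;> fin_cases j <;> simp)
    (fun c x => by
      ext i j; fin_cases i <;> fin_cases j <;>
        simp only [map_smul (ModuleCat.Hom.hom _), gen_smul] <;> simp [smul_comm])

theorem diffGen_apply (p : ℤ) (x : X.V.X p) : diffGen X p x =
    !![ksign p • gen X p x, gen X (p - 1) ((X.V.d p (p - 1)).hom x); 0, gen X p x] := rfl

theorem tau_closed (p q : ℤ) (x : X.V.X p) (y : X.V.X q) :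
    X.τ.1 (p - 1) q ((X.V.d p (p - 1)).hom x) y
      + ksign p • X.τ.1 p (q - 1) x ((X.V.d q (q - 1)).hom y) = 0 := by
  have h := congrArg (fun B => B.1 p q x y) X.closed
  simp only [ExtHom.del_apply, ksign_zero, one_smul] at h
  exact neg_eq_zero.mp h

theorem diffGen_ccr (p q : ℤ) (x : X.V.X p) (y : X.V.X q) :
    diffGen X p x * diffGen X q y - ksign (p * q) • (diffGen X q y * diffGen X p x)
      = algebraMap ℂ _ (Complex.I * (X.τ.1 p q x y : ℝ)) := by
  have h00 := congrArg (gradeInv X) (gen_ccr p q x y)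
  rw [AlgHom.commutes, map_sub, map_zsmul, map_mul, map_mul, gradeInv_gen, gradeInv_gen] at h00
  have h11 := gen_ccr p q x y
  have h01 := gen_ccr (p - 1) q ((X.V.d p (p - 1)).hom x) y
  have h01' := gen_ccr p (q - 1) x ((X.V.d q (q - 1)).hom y)
  have hτ : algebraMap ℂ (CCRAlg X)
      (Complex.I * (X.τ.1 (p - 1) q ((X.V.d p (p - 1)).hom x) y : ℝ)) + ksign p •
      algebraMap ℂ (CCRAlg X)
        (Complex.I * (X.τ.1 p (q - 1) x ((X.V.d q (q - 1)).hom y) : ℝ)) = 0 := by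
    rw [← map_zsmul, ← map_add]
    have := tau_closed p q x y
    have h2 := congrArg (fun r : ℝ => algebraMap ℂ (CCRAlg X) (Complex.I * (r : ℂ))) this
    simp only [Complex.ofReal_zero, mul_zero, map_zero] at h2
    rw [← h2]
    congr 1
    simp only [zsmul_eq_mul]
    push_cast
    ring
  rw [← h01, ← h01', sub_mul, mul_sub, one_mul, mul_one, ksign_sub, ksign_sub] at hτ
  simp only [diffGen_apply, Matrix.mul_fin_two]
  ext i j
  rw [Matrix.algebraMap_matrix_apply]
  fin_cases i <;> fin_cases j
  · simpa using h00
  · simp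
    rw [← hτ]
    generalize gen X p x = a
    generalize gen X q y = b
    generalize gen X (p - 1) _ = a'
    generalize gen X (q - 1) _ = b'
    rcases ksign_cases p with hp | hp <;> rcases ksign_cases q with hq | hq <;>
      simp [hp, hq] <;> abel
  · simp
  · simpa using h11

/-- The algebra homomorphism `a ↦ ((-1)^{|a|} a, da; 0, a)` into upper triangular matrices. It
encodes the graded derivation `d`. -/
def diffHom (X : PoCh.{w}) : CCRAlg X →ₐ[ℂ] Matrix (Fin 2) (Fin 2) (CCRAlg X) :=
  lift (diffGen X) diffGen_ccr

/-- The differential of the CCR algebra: the graded derivation which extends the differential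
of `V`. -/
def diff (X : PoCh.{w}) : CCRAlg X →ₗ[ℂ] CCRAlg X where
  toFun a := diffHom X a 0 1
  map_add' a b := by simp
  map_smul' c a := by simp

theorem diffHom_entries (a : CCRAlg X) :
    diffHom X a 0 0 = gradeInv X a ∧ diffHom X a 1 0 = 0 ∧ diffHom X a 1 1 = a := by
  refine induction (P := fun a => diffHom X a 0 0 = gradeInv X a ∧ diffHom X a 1 0 = 0 ∧
    diffHom X a 1 1 = a) ?_ ?_ ?_ ?_ a
  · simp
  · rintro p x b ⟨h1, h2, h3⟩
    rw [map_mul, diffHom, lift_gen, ← diffHom, map_mul, gradeInv_gen]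
    simp [Matrix.mul_apply, diffGen_apply, h1, h2, h3]
  · rintro a b ⟨h1, h2, h3⟩ ⟨h1', h2', h3'⟩
    simp [h1, h2, h3, h1', h2', h3']
  · rintro c a ⟨h1, h2, h3⟩
    simp [h1, h2, h3]

theorem diff_gen (p : ℤ) (x : X.V.X p) :
    diff X (gen X p x) = gen X (p - 1) ((X.V.d p (p - 1)).hom x) := by
  change diffHom X (gen X p x) 0 1 = _
  rw [diffHom, lift_gen]
  simp [diffGen_apply]

theorem diff_one : diff X 1 = 0 := by
  change diffHom X 1 0 1 = _
  simp

theorem diff_mul (a b : CCRAlg X) : diff X (a * b) = diff X a * b + gradeInv X a * diff X b := by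
  change diffHom X (a * b) 0 1 = diffHom X a 0 1 * b + _ * diffHom X b 0 1
  rw [map_mul, Matrix.mul_apply]
  simp [diffHom_entries, add_comm]

theorem diff_leibniz (n : ℤ) (a : CCRAlg X) (ha : a ∈ gr X n) (b : CCRAlg X) :
    diff X (a * b) = diff X a * b + ksign n • (a * diff X b) := by
  rw [diff_mul, gradeInv_of_mem n a ha, smul_mul_assoc]

theorem diff_mem (i j : ℤ) (h : j + 1 = i) (a : CCRAlg X) (ha : a ∈ gr X i) :
    diff X a ∈ gr X j := by
  obtain rfl : j = i - 1 := by omega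
  refine gr_induction (P := fun i a => diff X a ∈ gr X (i - 1)) ?_ ?_ ?_ ?_ i a ha
  · rw [diff_one]; exact zero_mem _
  · intro p q x b hb hb'
    rw [diff_leibniz p _ (gen_mem p x), diff_gen]
    refine add_mem ?_ (zsmul_mem ?_ _)
    · have := SetLike.mul_mem_graded (gen_mem (X := X) (p - 1) ((X.V.d p (p - 1)).hom x)) hb
      rwa [show p - 1 + q = p + q - 1 by ring] at this
    · have := SetLike.mul_mem_graded (gen_mem p x) hb'
      rwa [show p + (q - 1) = p + q - 1 by ring] at this
  · intro n a b ha hb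
    rw [map_add]; exact add_mem ha hb
  · intro n c a ha
    rw [map_smul]; exact Submodule.smul_mem _ c ha

theorem diff_diff (a : CCRAlg X) : diff X (diff X a) = 0 := by
  refine induction (P := fun a => diff X (diff X a) = 0) ?_ ?_ ?_ ?_ a
  · rw [diff_one, map_zero]
  · intro p x b hb
    rw [diff_leibniz p _ (gen_mem p x), diff_gen, map_add, map_zsmul,
      diff_leibniz (p - 1) _ (gen_mem _ _), diff_leibniz p _ (gen_mem p x), diff_gen, diff_gen,
      ExtHom.d_d_hom, map_zero, hb, ksign_sub, ksign_one]
    simp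
  · intro a b ha hb
    rw [map_add, map_add, ha, hb, add_zero]
  · intro c a ha
    rw [map_smul, map_smul, ha, smul_zero]

/-! #### The involution -/

/-- The opposite algebra with complex conjugate scalar multiplication. -/
def ConjOp (A : Type*) := Aᵐᵒᵖ

instance (A : Type*) [Ring A] : Ring (ConjOp A) := inferInstanceAs (Ring Aᵐᵒᵖ)

instance (A : Type*) [Ring A] [Algebra ℂ A] : Algebra ℂ (ConjOp A) :=
  RingHom.toAlgebra' (((algebraMap ℂ Aᵐᵒᵖ : ℂ →+* Aᵐᵒᵖ).comp (starRingEnd ℂ) : ℂ →+* Aᵐᵒᵖ))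
    (fun c x => Algebra.commutes (A := Aᵐᵒᵖ) (starRingEnd ℂ c) x)

/-- The canonical map to the opposite algebra. -/
def ConjOp.op {A : Type*} [Ring A] : A ≃+ ConjOp A := MulOpposite.opAddEquiv

theorem ConjOp.op_mul {A : Type*} [Ring A] (a b : A) :
    ConjOp.op (a * b) = ConjOp.op b * ConjOp.op a := rfl

theorem ConjOp.symm_mul {A : Type*} [Ring A] (a b : ConjOp A) :
    ConjOp.op.symm (a * b) = ConjOp.op.symm b * ConjOp.op.symm a := rfl

theorem ConjOp.algebraMap_eq {A : Type*} [Ring A] [Algebra ℂ A] (c : ℂ) :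
    algebraMap ℂ (ConjOp A) c = ConjOp.op (algebraMap ℂ A (starRingEnd ℂ c)) := rfl

theorem ConjOp.symm_smul {A : Type*} [Ring A] [Algebra ℂ A] (c : ℂ) (a : ConjOp A) :
    ConjOp.op.symm (c • a) = starRingEnd ℂ c • ConjOp.op.symm a := by
  rw [Algebra.smul_def, ConjOp.algebraMap_eq, ConjOp.symm_mul, AddEquiv.symm_apply_apply,
    ← Algebra.commutes, ← Algebra.smul_def]

/-- The sign `(-1)^{n(n-1)/2}` of the order reversing permutation of `n` odd elements. -/
def revSign (n : ℤ) : ℤ := ksign (n * (n - 1) / 2)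

theorem revSign_mul_self (n : ℤ) : revSign n * revSign n = 1 := ksign_mul_self _

theorem revSign_zero : revSign 0 = 1 := by simp [revSign, ksign_zero]

theorem revSign_add (m n : ℤ) : revSign (m + n) = revSign m * revSign n * ksign (m * n) := by
  have h1 : (m + n) * (m + n - 1) / 2 = m * (m - 1) / 2 + n * (n - 1) / 2 + m * n := by
    obtain ⟨a, ha⟩ := (Int.even_mul_pred_self m).two_dvd
    obtain ⟨b, hb⟩ := (Int.even_mul_pred_self n).two_dvd
    have : (m + n) * (m + n - 1) = 2 * (a + b + m * n) := by
      rw [mul_add, mul_add, ← ha, ← hb]; ring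
    rw [this, ha, hb]
    simp
  rw [revSign, h1, ksign_add, ksign_add]; rfl

/-- The image of a generator under `revHom`. -/
def revGen (X : PoCh.{w}) (p : ℤ) : X.V.X p →ₗ[ℝ] ConjOp (CCRAlg X) :=
  realLin (fun x => ConjOp.op (revSign p • gen X p x))
    (fun x y => by rw [map_add, smul_add, map_add])
    (fun c x => by
      apply ConjOp.op.symm.injective
      rw [ConjOp.symm_smul, AddEquiv.symm_apply_apply, AddEquiv.symm_apply_apply, gen_smul,
        Complex.conj_ofReal, smul_comm])

theorem revGen_apply (p : ℤ) (x : X.V.X p) :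
    revGen X p x = ConjOp.op (revSign p • gen X p x) := rfl

theorem revGen_ccr (p q : ℤ) (x : X.V.X p) (y : X.V.X q) :
    revGen X p x * revGen X q y - ksign (p * q) • (revGen X q y * revGen X p x)
      = algebraMap ℂ _ (Complex.I * (X.τ.1 p q x y : ℝ)) := by
  have h := gen_ccr p q x y
  have h' : gen X p x * gen X q y = algebraMap ℂ (CCRAlg X)
      (Complex.I * (X.τ.1 p q x y : ℝ)) + ksign (p * q) • (gen X q y * gen X p x) := by
    rw [← h]; abel
  simp only [revGen_apply, ← ConjOp.op_mul, ConjOp.algebraMap_eq]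
  apply ConjOp.op.symm.injective
  rw [map_sub, map_zsmul, AddEquiv.symm_apply_apply, AddEquiv.symm_apply_apply,
    AddEquiv.symm_apply_apply]
  rw [map_mul, Complex.conj_I, Complex.conj_ofReal, neg_mul, map_neg]
  rw [smul_mul_smul_comm, smul_mul_smul_comm, mul_comm (revSign q), h', smul_comm (ksign (p * q)),
    ← smul_sub, smul_add, smul_smul, ksign_mul_self, one_smul, sub_add_cancel_right, smul_neg]
  congr 1
  by_cases h0 : p + q = 0
  · obtain rfl : q = -p := by omega
    have e := revSign_add p (-p)
    rw [add_neg_cancel, revSign_zero] at e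
    rw [smul_smul]
    have : revSign p * revSign (-p) * ksign (p * -p) = 1 := e.symm
    rw [this, one_smul]
  · rw [tau_eq_zero p q h0]; simp

/-- The antilinear antiautomorphism with `x ↦ (-1)^{|x|(|x|-1)/2} x` on generators. -/
def revHom (X : PoCh.{w}) : CCRAlg X →ₐ[ℂ] ConjOp (CCRAlg X) :=
  lift (revGen X) revGen_ccr

/-- The linear map `a ↦ (-1)^{|a|(|a|-1)/2} a`. -/
def signMap (X : PoCh.{w}) : CCRAlg X →ₗ[ℂ] CCRAlg X :=
  DirectSum.toModule ℂ ℤ _ (fun n => revSign n • (gr X n).subtype) ∘ₗ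
    (DirectSum.decomposeLinearEquiv (gr X)).toLinearMap

theorem signMap_of_mem (n : ℤ) (a : CCRAlg X) (ha : a ∈ gr X n) :
    signMap X a = revSign n • a := by
  change DirectSum.toModule ℂ ℤ _ (fun n => revSign n • (gr X n).subtype)
    (DirectSum.decompose (gr X) a) = _
  rw [DirectSum.decompose_of_mem _ ha, ← DirectSum.lof_eq_of ℂ, DirectSum.toModule_lof]
  rfl

/-- The involution of the CCR algebra: the antilinear map with `x* = x` for `x ∈ V` and
`(ab)* = (-1)^{|a||b|} b* a*`. -/
def conjStar (X : PoCh.{w}) : CCRAlg X →ₗ⋆[ℂ] CCRAlg X where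
  toFun a := ConjOp.op.symm (revHom X (signMap X a))
  map_add' a b := by simp
  map_smul' c a := by rw [map_smul, map_smul, ConjOp.symm_smul]

theorem conjStar_of_mem (n : ℤ) (a : CCRAlg X) (ha : a ∈ gr X n) :
    conjStar X a = revSign n • ConjOp.op.symm (revHom X a) := by
  change ConjOp.op.symm (revHom X (signMap X a)) = _
  rw [signMap_of_mem n a ha, map_zsmul, map_zsmul]

theorem conjStar_mul (i j : ℤ) (a : CCRAlg X) (ha : a ∈ gr X i) (b : CCRAlg X)
    (hb : b ∈ gr X j) : conjStar X (a * b) = ksign (i * j) • (conjStar X b * conjStar X a) := by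
  rw [conjStar_of_mem (i + j) _ (SetLike.mul_mem_graded ha hb), conjStar_of_mem i a ha,
    conjStar_of_mem j b hb, map_mul, ConjOp.symm_mul, smul_mul_smul_comm, smul_smul, revSign_add,
    mul_comm (ksign _), mul_comm (revSign j)]

theorem conjStar_gen (p : ℤ) (x : X.V.X p) : conjStar X (gen X p x) = gen X p x := by
  rw [conjStar_of_mem p _ (gen_mem p x), revHom, lift_gen, revGen_apply,
    AddEquiv.symm_apply_apply, smul_smul, revSign_mul_self, one_smul]

theorem conjStar_one : conjStar X 1 = 1 := by
  rw [conjStar_of_mem 0 1 SetLike.GradedOne.one_mem, map_one, revSign_zero, one_smul]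
  rfl

theorem conjStar_mem (n : ℤ) (a : CCRAlg X) (ha : a ∈ gr X n) : conjStar X a ∈ gr X n := by
  refine gr_induction (P := fun n a => conjStar X a ∈ gr X n) ?_ ?_ ?_ ?_ n a ha
  · rw [conjStar_one]; exact SetLike.GradedOne.one_mem
  · intro p q x b hb hb'
    rw [conjStar_mul p q _ (gen_mem p x) b hb, conjStar_gen]
    have := SetLike.mul_mem_graded hb' (gen_mem p x)
    rw [add_comm q p] at this
    exact zsmul_mem this _
  · intro n a b ha hb
    rw [map_add]; exact add_mem ha hb
  · intro n c a ha
    rw [LinearMap.map_smulₛₗ]; exact Submodule.smul_mem _ _ ha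

theorem conjStar_conjStar (a : CCRAlg X) : conjStar X (conjStar X a) = a := by
  have key : ∀ (n : ℤ) (a : CCRAlg X), a ∈ gr X n → conjStar X (conjStar X a) = a := by
    intro n a ha
    refine gr_induction (P := fun n a => conjStar X (conjStar X a) = a) ?_ ?_ ?_ ?_ n a ha
    · rw [conjStar_one, conjStar_one]
    · intro p q x b hb hb'
      rw [conjStar_mul p q _ (gen_mem p x) b hb, map_zsmul, conjStar_gen,
        conjStar_mul q p _ (conjStar_mem q b hb) _ (gen_mem p x), hb', conjStar_gen, smul_smul,
        mul_comm q p, ksign_mul_self, one_smul]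
    · intro n a b ha hb
      rw [map_add, map_add, ha, hb]
    · intro n c a ha
      rw [LinearMap.map_smulₛₗ, LinearMap.map_smulₛₗ, ha]
      simp
  refine DirectSum.Decomposition.inductionOn (gr X)
    (motive := fun a => conjStar X (conjStar X a) = a) ?_ (fun {i} m => key i m.1 m.2) ?_ a
  · simp
  · intro a b ha hb
    rw [map_add, map_add, ha, hb]

theorem diff_conjStar (a : CCRAlg X) : diff X (conjStar X a) = conjStar X (diff X a) := by
  have key : ∀ (n : ℤ) (a : CCRAlg X), a ∈ gr X n →
      diff X (conjStar X a) = conjStar X (diff X a) := by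
    intro n a ha
    refine gr_induction (P := fun n a => diff X (conjStar X a) = conjStar X (diff X a))
      ?_ ?_ ?_ ?_ n a ha
    · rw [conjStar_one, diff_one, map_zero]
    · intro p q x b hb hb'
      rw [conjStar_mul p q _ (gen_mem p x) b hb, map_zsmul, conjStar_gen,
        diff_leibniz q _ (conjStar_mem q b hb), diff_leibniz p _ (gen_mem p x), diff_gen, hb',
        map_add, map_zsmul, conjStar_mul (p - 1) q _ (gen_mem _ _) b hb, conjStar_gen,
        conjStar_mul p (q - 1) _ (gen_mem p x) _ (diff_mem q (q - 1) (by ring) b hb),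
        conjStar_gen, smul_smul, smul_add, smul_smul, sub_mul, mul_sub, one_mul, mul_one,
        ksign_sub, ksign_sub, add_comm]
      congr 2
      rw [mul_comm (ksign (p * q)), ← mul_assoc, ksign_mul_self, one_mul]
    · intro n a b ha hb
      rw [map_add, map_add, map_add, map_add, ha, hb]
    · intro n c a ha
      rw [LinearMap.map_smulₛₗ, map_smul, map_smul, LinearMap.map_smulₛₗ, ha]
  refine DirectSum.Decomposition.inductionOn (gr X)
    (motive := fun a => diff X (conjStar X a) = conjStar X (diff X a)) ?_
    (fun {i} m => key i m.1 m.2) ?_ a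
  · simp
  · intro a b ha hb
    rw [map_add, map_add, map_add, map_add, ha, hb]

/-! #### Functoriality -/

/-- The algebra homomorphism induced by a morphism of unshifted Poisson complexes. -/
def map {X Y : PoCh.{w}} (f : X ⟶ Y) : CCRAlg X →ₐ[ℂ] CCRAlg Y :=
  lift (fun p => gen Y p ∘ₗ (f.f.f p).hom) (by
    intro p q x y
    rw [← f.comm, ExtHom.pullback_apply]
    exact gen_ccr p q _ _)

theorem map_gen {X Y : PoCh.{w}} (f : X ⟶ Y) (p : ℤ) (x : X.V.X p) :
    map f (gen X p x) = gen Y p ((f.f.f p).hom x) := by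
  rw [map, lift_gen]; rfl

theorem map_mem {X Y : PoCh.{w}} (f : X ⟶ Y) (n : ℤ) (a : CCRAlg X) (ha : a ∈ gr X n) :
    map f a ∈ gr Y n := by
  refine gr_induction (P := fun n a => map f a ∈ gr Y n) ?_ ?_ ?_ ?_ n a ha
  · rw [map_one]; exact SetLike.GradedOne.one_mem
  · intro p q x b _ hb'
    rw [map_mul, map_gen]; exact SetLike.mul_mem_graded (gen_mem _ _) hb'
  · intro n a b ha hb
    rw [map_add]; exact add_mem ha hb
  · intro n c a ha
    rw [map_smul]; exact Submodule.smul_mem _ _ ha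

theorem map_diff {X Y : PoCh.{w}} (f : X ⟶ Y) (a : CCRAlg X) :
    map f (diff X a) = diff Y (map f a) := by
  refine induction (P := fun a => map f (diff X a) = diff Y (map f a)) ?_ ?_ ?_ ?_ a
  · rw [diff_one, map_one, diff_one, map_zero]
  · intro p x b hb
    rw [diff_leibniz p _ (gen_mem p x), map_mul, map_gen, diff_leibniz p _ (gen_mem _ _),
      diff_gen, diff_gen, map_add, map_mul, map_zsmul, map_mul, map_gen, map_gen, hb,
      ExtHom.f_d_hom]
  · intro a b ha hb
    rw [map_add, map_add, map_add, map_add, ha, hb]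
  · intro c a ha
    rw [map_smul, map_smul, map_smul, map_smul, ha]

theorem map_conjStar {X Y : PoCh.{w}} (f : X ⟶ Y) (a : CCRAlg X) :
    map f (conjStar X a) = conjStar Y (map f a) := by
  have key : ∀ (n : ℤ) (a : CCRAlg X), a ∈ gr X n →
      map f (conjStar X a) = conjStar Y (map f a) := by
    intro n a ha
    refine gr_induction (P := fun n a => map f (conjStar X a) = conjStar Y (map f a))
      ?_ ?_ ?_ ?_ n a ha
    · rw [conjStar_one, map_one, conjStar_one]
    · intro p q x b hb hb'
      rw [conjStar_mul p q _ (gen_mem p x) b hb, map_zsmul, map_mul, map_mul, conjStar_gen,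
        map_gen, conjStar_mul p q _ (gen_mem _ _) _ (map_mem f q b hb), conjStar_gen, hb']
    · intro n a b ha hb
      rw [map_add, map_add, map_add, map_add, ha, hb]
    · intro n c a ha
      rw [LinearMap.map_smulₛₗ, map_smul, map_smul, LinearMap.map_smulₛₗ, ha]
  refine DirectSum.Decomposition.inductionOn (gr X)
    (motive := fun a => map f (conjStar X a) = conjStar Y (map f a)) ?_
    (fun {i} m => key i m.1 m.2) ?_ a
  · simp
  · intro a b ha hb
    rw [map_add, map_add, map_add, map_add, ha, hb]

end CCRAlg

/-- The CCR quantization functor. -/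
def CCR : PoCh.{w} ⥤ DGStarAlg.{w} where
  obj X :=
    { carrier := CCRAlg X
      gr := CCRAlg.gr X
      d := CCRAlg.diff X
      d_mem := CCRAlg.diff_mem
      d_d := CCRAlg.diff_diff
      leibniz := CCRAlg.diff_leibniz
      star := CCRAlg.conjStar X
      star_mem := CCRAlg.conjStar_mem
      star_star := CCRAlg.conjStar_conjStar
      star_mul := CCRAlg.conjStar_mul
      d_star := CCRAlg.diff_conjStar }
  map f :=
    { f := CCRAlg.map f
      map_mem := CCRAlg.map_mem f
      map_d := CCRAlg.map_diff f
      map_star := CCRAlg.map_conjStar f }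
  map_id _ := DGStarAlg.Hom.ext (CCRAlg.hom_ext fun p x => CCRAlg.map_gen _ p x)
  map_comp f g := DGStarAlg.Hom.ext (CCRAlg.hom_ext fun p x =>
    (CCRAlg.map_gen _ p x).trans ((congrArg (CCRAlg.map g) (CCRAlg.map_gen f p x)).trans
      (CCRAlg.map_gen g p _)).symm)

end CCRQuant
end

noncomputable section

namespace CCRQuant

/-! ### Central extensions of graded vector spaces

A differential graded Heisenberg Lie algebra with a marked central element which is to become the
unit of the enveloping algebra. -/

/-! The CCR algebra of `(V, τ)` is the enveloping algebra of a graded Heisenberg Lie algebra `V ⊕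
ℝ1` whose central element `1` is identified with the unit. More generally, for a differential graded
space `W` with a marked cycle and a central bracket `β`, let `U_c` (`HeisAlg H c`) be the algebra on
`W` with `x y - (-1)^{|x||y|} y x = i c β(x, y)` and the marked cycle equal to `1`. Two facts carry
everything.

First, the chain complex `U_c` does not depend on `c`. Let `x ∈ W` act on `U_{c'}` by left
multiplication plus `i (c - c') / 2` times the contraction with `β(x, -)`. This represents `U_c` on
`U_{c'}`, and acting on `1` gives a chain map `quant`, natural for bracket preserving morphisms,
whose inverse is obtained by exchanging `c` and `c'` (`quant_diff`, `quant_quant`, `mapAlg_quant`).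
It makes any basis theorem of Poincaré-Birkhoff-Witt type unnecessary.

Secondly, `U_0` is graded commutative and functorial for all chain maps fixing the marked cycle,
whether or not they respect `β`, and it turns homotopies into homotopies: extend the homotopy to a
derivation along the path `f + t (g - f)` and integrate over `t` from `0` to `1`
(`derivative_pathAlg`, `homotopy_spec`). Over a field a quasi-isomorphism has homotopy inverses, so
it induces an isomorphism on the homology of `U_0`, and hence of `U_1` when it preserves the bracket
(`map_weq`). This is part a).

For part b) take `W = V ⊕ ℝ1 ⊕ ℝt ⊕ ℝdt` with bracket `τ + t ∂ρ + dt ρ`. The bracket is a chain map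
because `d t = dt` produces exactly the term `dt ∂ρ` coming from `dt ρ`. Let `A` be its `U_1`. The
evaluations at `t = 0` and `t = 1`, with `dt = 0`, preserve brackets and land in the Heisenberg
algebras of `τ` and `τ + ∂ρ`. As `t` and `dt` span an acyclic complex, both evaluations are homotopy
equivalences of the underlying complexes, hence induce weak equivalences. Naturality of `ρ` makes
`A` a functor and the evaluations natural. -/

/-- A graded real vector space `W` with a differential `d` of degree `-1` (only the components
`d p q` with `q + 1 = p` are relevant), a marked cycle `u` of degree `0`, and a central
antisymmetric bracket `β` of degree `0` which is a chain map. -/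
structure HeisData where
  W : ℤ → Type w
  [acg : ∀ p, AddCommGroup (W p)]
  [mod : ∀ p, Module ℝ (W p)]
  d : ∀ p q, W p →ₗ[ℝ] W q
  d_d : ∀ p q r, q + 1 = p → r + 1 = q → ∀ x, d q r (d p q x) = 0
  unit : W 0
  d_unit : d 0 (-1) unit = 0
  -- The target degree `r` is a free index, with `β_degree` forcing zero off `r = p + q`; this
  -- avoids transport along equalities of degrees.
  β : ∀ p q r, W p →ₗ[ℝ] W q →ₗ[ℝ] W r
  β_degree : ∀ p q r, p + q ≠ r → β p q r = 0
  β_antisymm : ∀ p q r x y, β p q r x y = -(ksign (p * q) • β q p r y x)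
  d_β : ∀ p p' q q' r r', p' + 1 = p → q' + 1 = q → r' + 1 = r → ∀ x y,
    d r r' (β p q r x y) = β p' q r' (d p p' x) y + ksign p • β p q' r' x (d q q' y)
  β_β : ∀ p q r s t x y z, β r s t (β p q r x y) z = 0
  β_unit : ∀ q r y, β 0 q r unit y = 0

attribute [instance] HeisData.acg HeisData.mod

variable {H : HeisData.{w}} {c : ℝ}

/-- The relations of the enveloping algebra of Heisenberg data with the bracket scaled by `c`: the
generators depend linearly on the elements of `W`, they satisfy the commutation relations
`x y - (-1)^{|x||y|} y x = i c β(x, y)`, and the marked element is the unit. -/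
inductive HeisRel (H : HeisData.{w}) (c : ℝ) :
    FreeAlgebra ℂ (Σ p : ℤ, H.W p) → FreeAlgebra ℂ (Σ p : ℤ, H.W p) → Prop
  | add (p : ℤ) (x y : H.W p) : HeisRel H c (FreeAlgebra.ι ℂ ⟨p, x + y⟩)
      (FreeAlgebra.ι ℂ ⟨p, x⟩ + FreeAlgebra.ι ℂ ⟨p, y⟩)
  | smul (p : ℤ) (a : ℝ) (x : H.W p) : HeisRel H c (FreeAlgebra.ι ℂ ⟨p, a • x⟩)
      ((a : ℂ) • FreeAlgebra.ι ℂ ⟨p, x⟩)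
  | comm (p q : ℤ) (x : H.W p) (y : H.W q) : HeisRel H c
      (FreeAlgebra.ι ℂ ⟨p, x⟩ * FreeAlgebra.ι ℂ ⟨q, y⟩
        - ksign (p * q) • (FreeAlgebra.ι ℂ ⟨q, y⟩ * FreeAlgebra.ι ℂ ⟨p, x⟩))
      ((Complex.I * (c : ℂ)) • FreeAlgebra.ι ℂ ⟨p + q, H.β p q (p + q) x y⟩)
  | unit : HeisRel H c (FreeAlgebra.ι ℂ ⟨0, H.unit⟩) 1

/-- The enveloping algebra of Heisenberg data with the bracket scaled by `c`. -/
def HeisAlg (H : HeisData.{w}) (c : ℝ) : Type w := RingQuot (HeisRel H c)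

instance : Ring (HeisAlg H c) := inferInstanceAs (Ring (RingQuot (HeisRel H c)))

instance : Algebra ℂ (HeisAlg H c) := inferInstanceAs (Algebra ℂ (RingQuot (HeisRel H c)))

namespace HeisAlg

/-- The quotient map. -/
def mk (H : HeisData.{w}) (c : ℝ) : FreeAlgebra ℂ (Σ p : ℤ, H.W p) →ₐ[ℂ] HeisAlg H c :=
  RingQuot.mkAlgHom ℂ (HeisRel H c)

theorem mk_rel {a b : FreeAlgebra ℂ (Σ p : ℤ, H.W p)} (h : HeisRel H c a b) :
    mk H c a = mk H c b := RingQuot.mkAlgHom_rel ℂ h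

/-- The generators. -/
def gen (H : HeisData.{w}) (c : ℝ) (p : ℤ) : H.W p →ₗ[ℝ] HeisAlg H c :=
  CCRAlg.realLin (fun x => mk H c (FreeAlgebra.ι ℂ ⟨p, x⟩))
    (fun x y => (mk_rel (.add p x y)).trans (map_add _ _ _))
    (fun a x => (mk_rel (.smul p a x)).trans (map_smul _ _ _))

theorem gen_smul (p : ℤ) (a : ℝ) (x : H.W p) :
    gen H c p (a • x) = (a : ℂ) • gen H c p x := by rw [map_smul]; rfl

theorem gen_comm (p q : ℤ) (x : H.W p) (y : H.W q) :
    gen H c p x * gen H c q y - ksign (p * q) • (gen H c q y * gen H c p x)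
      = (Complex.I * (c : ℂ)) • gen H c (p + q) (H.β p q (p + q) x y) := by
  have h := mk_rel (HeisRel.comm (c := c) p q x y)
  rw [map_sub, map_zsmul, map_mul, map_mul, map_smul] at h
  exact h

theorem gen_unit : gen H c 0 H.unit = 1 := (mk_rel .unit).trans (map_one _)

/-! ### The universal property of the enveloping algebra -/

section Lift

variable {B : Type*} [Ring B] [Algebra ℂ B]

/-- The universal property. -/
def lift (g : ∀ p : ℤ, H.W p →ₗ[ℝ] B)
    (hg : ∀ (p q : ℤ) (x : H.W p) (y : H.W q),
      g p x * g q y - ksign (p * q) • (g q y * g p x)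
        = (Complex.I * (c : ℂ)) • g (p + q) (H.β p q (p + q) x y))
    (hu : g 0 H.unit = 1) : HeisAlg H c →ₐ[ℂ] B :=
  RingQuot.liftAlgHom ℂ ⟨FreeAlgebra.lift ℂ (fun s => g s.1 s.2), by
      rintro _ _ (⟨p, x, y⟩ | ⟨p, a, x⟩ | ⟨p, q, x, y⟩ | _)
      · simp
      · rw [map_smul, FreeAlgebra.lift_ι_apply, FreeAlgebra.lift_ι_apply]
        exact (g p).map_smul a x
      · simpa using hg p q x y
      · simpa using hu⟩

theorem lift_gen (g : ∀ p : ℤ, H.W p →ₗ[ℝ] B) (hg hu) (p : ℤ) (x : H.W p) :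
    lift (c := c) g hg hu (gen H c p x) = g p x := by
  refine (RingQuot.liftAlgHom_mkAlgHom_apply ℂ _ _ _).trans ?_
  simp

theorem hom_ext {f g : HeisAlg H c →ₐ[ℂ] B}
    (h : ∀ (p : ℤ) (x : H.W p), f (gen H c p x) = g (gen H c p x)) : f = g := by
  apply RingQuot.ringQuot_ext'
  apply FreeAlgebra.hom_ext
  funext s
  exact h s.1 s.2

end Lift

/-! ### The grading of the enveloping algebra -/

/-- The degree `n` part: the span of the products of homogeneous generators of total
degree `n`. -/
def gr (H : HeisData.{w}) (c : ℝ) (n : ℤ) : Submodule ℂ (HeisAlg H c) :=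
  Submodule.span ℂ {a | ∃ l : List (Σ p : ℤ, H.W p), (l.map Sigma.fst).sum = n ∧
    (l.map fun s => gen H c s.1 s.2).prod = a}

theorem gen_mem (p : ℤ) (x : H.W p) : gen H c p x ∈ gr H c p :=
  Submodule.subset_span ⟨[⟨p, x⟩], by simp, by simp⟩

instance : SetLike.GradedMonoid (gr H c) where
  one_mem := Submodule.subset_span ⟨[], by simp, by simp⟩
  mul_mem := by
    intro i j a b ha hb
    have h : gr H c i * gr H c j ≤ gr H c (i + j) := by
      rw [gr, gr, Submodule.span_mul_span]
      refine Submodule.span_mono ?_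
      rintro _ ⟨_, ⟨l, hl, rfl⟩, _, ⟨m, hm, rfl⟩, rfl⟩
      exact ⟨l ++ m, by simp [hl, hm], by simp⟩
    exact h (Submodule.mul_mem_mul ha hb)

/-- Induction for homogeneous elements. -/
theorem gr_induction {P : ℤ → HeisAlg H c → Prop} (h_one : P 0 1)
    (h_gen : ∀ (p q : ℤ) (x : H.W p) (b : HeisAlg H c), b ∈ gr H c q → P q b →
      P (p + q) (gen H c p x * b))
    (h_add : ∀ n a b, P n a → P n b → P n (a + b))
    (h_smul : ∀ n (z : ℂ) a, P n a → P n (z • a)) (n : ℤ) (a : HeisAlg H c)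
    (ha : a ∈ gr H c n) : P n a := by
  have key : ∀ l : List (Σ p : ℤ, H.W p),
      P (l.map Sigma.fst).sum (l.map fun s => gen H c s.1 s.2).prod := by
    intro l
    induction l with
    | nil => simpa using h_one
    | cons s l ih =>
      have := h_gen s.1 _ s.2 _ (Submodule.subset_span ⟨l, rfl, rfl⟩) ih
      simpa using this
  refine Submodule.span_induction (p := fun a _ => P n a) ?_ ?_ ?_ ?_ ha
  · rintro _ ⟨l, rfl, rfl⟩
    exact key l
  -- The one-letter list with entry `0` in degree `n` shows that every degree is attained; scaling
  -- its product by `0` gives `P n 0`.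
  · have h := h_smul _ 0 _ (key [⟨n, 0⟩])
    simpa using h
  · intro a b _ _ ha hb; exact h_add n a b ha hb
  · intro z a _ ha; exact h_smul n z a ha

/-- The generators, in the direct sum of the homogeneous parts. -/
def grGen (H : HeisData.{w}) (c : ℝ) (p : ℤ) : H.W p →ₗ[ℝ] ⨁ n : ℤ, gr H c n :=
  CCRAlg.realLin (fun x => DirectSum.of (fun n => gr H c n) p ⟨gen H c p x, gen_mem p x⟩)
    (fun x y => by
      rw [← map_add]; congr 1; apply Subtype.ext; exact map_add _ _ _)
    (fun a x => by
      refine Eq.trans ?_ ((DirectSum.lof ℂ ℤ (fun n => gr H c n) p).map_smul (a : ℂ) _)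
      rw [DirectSum.lof_eq_of]; congr 1; apply Subtype.ext; exact gen_smul p a x)

theorem grGen_apply (p : ℤ) (x : H.W p) :
    grGen H c p x = DirectSum.of (fun n => gr H c n) p ⟨gen H c p x, gen_mem p x⟩ := rfl

theorem grGen_comm (p q : ℤ) (x : H.W p) (y : H.W q) :
    grGen H c p x * grGen H c q y - ksign (p * q) • (grGen H c q y * grGen H c p x)
      = (Complex.I * (c : ℂ)) • grGen H c (p + q) (H.β p q (p + q) x y) := by
  simp only [grGen_apply]
  have e1 : ∀ (i j : ℤ) (h : i = j) (a : HeisAlg H c) (ha : a ∈ gr H c i),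
      DirectSum.of (fun n => gr H c n) i ⟨a, ha⟩ = DirectSum.of (fun n => gr H c n) j
        ⟨a, h ▸ ha⟩ := by
    rintro i _ rfl a ha; rfl
  rw [DirectSum.of_mul_of, DirectSum.of_mul_of]
  -- The two products sit in degrees `p + q` and `q + p`; they must be brought to the same index
  -- before they can be subtracted inside one summand.
  erw [e1 (q + p) (p + q) (add_comm q p)]
  have e2 := (DirectSum.lof ℂ ℤ (fun n => gr H c n) (p + q)).map_smul (Complex.I * (c : ℂ))
    ⟨gen H c (p + q) (H.β p q (p + q) x y), gen_mem _ _⟩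
  rw [DirectSum.lof_eq_of] at e2
  refine Eq.trans ?_ e2
  refine ((congrArg₂ _ rfl (map_zsmul (DirectSum.of (fun n => gr H c n) (p + q)) _ _).symm).trans
      (map_sub (DirectSum.of (fun n => gr H c n) (p + q)) _ _).symm).trans ?_
  congr 1
  apply Subtype.ext
  exact gen_comm p q x y

/-- The map to the direct sum of the homogeneous parts. -/
def decomposeHom (H : HeisData.{w}) (c : ℝ) : HeisAlg H c →ₐ[ℂ] ⨁ n : ℤ, gr H c n :=
  lift (B := ⨁ n : ℤ, gr H c n) (grGen H c) grGen_comm (by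
    rw [grGen_apply]
    have e : (⟨gen H c 0 H.unit, gen_mem _ _⟩ : gr H c 0) = ⟨1, SetLike.GradedOne.one_mem⟩ :=
      Subtype.ext gen_unit
    rw [e]; rfl)

instance gradedAlgebra (H : HeisData.{w}) (c : ℝ) : GradedAlgebra (gr H c) :=
  GradedAlgebra.ofAlgHom (gr H c) (decomposeHom H c)
    (hom_ext fun p x => by
      simp [decomposeHom, lift_gen, grGen_apply])
    (by
      rintro n ⟨a, ha⟩
      -- Membership is moved into the statement, so that the induction runs over a predicate on
      -- plain elements.
      suffices h : ∃ ha : a ∈ gr H c n,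
          decomposeHom H c a = DirectSum.of (fun n => gr H c n) n ⟨a, ha⟩ from h.2
      refine gr_induction (P := fun n a => ∃ ha : a ∈ gr H c n,
          decomposeHom H c a = DirectSum.of (fun n => gr H c n) n ⟨a, ha⟩) ?_ ?_ ?_ ?_ n a ha
      · exact ⟨SetLike.GradedOne.one_mem, by rw [map_one]; rfl⟩
      · rintro p q x b - ⟨hb, hb'⟩
        refine ⟨SetLike.mul_mem_graded (gen_mem p x) hb, ?_⟩
        rw [map_mul, hb', decomposeHom, lift_gen, grGen_apply, DirectSum.of_mul_of]
        rfl
      · rintro n a b ⟨ha, ha'⟩ ⟨hb, hb'⟩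
        exact ⟨add_mem ha hb, by rw [map_add, ha', hb', ← map_add]; rfl⟩
      · rintro n z a ⟨ha, ha'⟩
        exact ⟨Submodule.smul_mem _ z ha, by
          rw [map_smul, ha', ← DirectSum.lof_eq_of ℂ, ← map_smul]; rfl⟩)

/-- Induction for all elements. -/
theorem induction {P : HeisAlg H c → Prop} (h_one : P 1)
    (h_gen : ∀ (p : ℤ) (x : H.W p) (b : HeisAlg H c), P b → P (gen H c p x * b))
    (h_add : ∀ a b, P a → P b → P (a + b)) (h_smul : ∀ (z : ℂ) a, P a → P (z • a))
    (a : HeisAlg H c) : P a := by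
  refine DirectSum.Decomposition.inductionOn (gr H c) (motive := P) ?_ ?_ h_add a
  · simpa using h_smul 0 1 h_one
  · intro i m
    exact gr_induction (P := fun _ a => P a) h_one (fun _ _ _ _ _ => h_gen _ _ _)
      (fun _ => h_add) (fun _ => h_smul) i m.1 m.2

/-- A property of all homogeneous elements which is stable under addition holds everywhere. -/
theorem of_homogeneous {P : HeisAlg H c → Prop} (h : ∀ n, ∀ a ∈ gr H c n, P a)
    (h_add : ∀ a b, P a → P b → P (a + b)) (a : HeisAlg H c) : P a :=
  DirectSum.Decomposition.inductionOn (gr H c) (motive := P) (h 0 0 (zero_mem _))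
    (fun {i} m => h i m.1 m.2) h_add a

/-! #### Graded derivations along an algebra homomorphism -/

section Der

variable {B : Type*} [Ring B] [Algebra ℂ B]

/-- The data defining a graded derivation of degree `k` along an algebra homomorphism `F`: its
values on the generators, compatible with the relations. -/
structure DerData (H : HeisData.{w}) (c : ℝ) (F : HeisAlg H c →ₐ[ℂ] B) (k : ℤ) where
  δ : ∀ p : ℤ, H.W p →ₗ[ℝ] B
  comm : ∀ (p q : ℤ) (x : H.W p) (y : H.W q),
    (δ p x * F (gen H c q y) + ksign (k * p) • (F (gen H c p x) * δ q y))
      - ksign (p * q) • (δ q y * F (gen H c p x) + ksign (k * q) • (F (gen H c q y) * δ p x))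
      = (Complex.I * (c : ℂ)) • δ (p + q) (H.β p q (p + q) x y)
  unit : δ 0 H.unit = 0

variable {F : HeisAlg H c →ₐ[ℂ] B} {k : ℤ} (D : DerData H c F k)

/-- The upper triangular matrix of a generator used to construct a derivation. -/
def derGen (p : ℤ) : H.W p →ₗ[ℝ] Matrix (Fin 2) (Fin 2) B :=
  CCRAlg.realLin (fun x => !![ksign (k * p) • F (gen H c p x), D.δ p x; 0, F (gen H c p x)])
    (fun x y => by ext i j; fin_cases i <;> fin_cases j <;> simp)
    (fun a x => by
      have h : D.δ p (a • x) = (a : ℂ) • D.δ p x := (D.δ p).map_smul a x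
      have h' : F (gen H c p (a • x)) = (a : ℂ) • F (gen H c p x) := by rw [gen_smul, map_smul]
      rw [h, h', smul_comm, Matrix.smul_of, Matrix.smul_cons, Matrix.smul_cons]
      simp)

theorem derGen_apply (p : ℤ) (x : H.W p) : derGen D p x =
    !![ksign (k * p) • F (gen H c p x), D.δ p x; 0, F (gen H c p x)] := rfl

/-- The diagonal entries satisfy the relations because `F` is a homomorphism, the first one up to
the multiplicative sign `(-1)^{k|a|}`. The corner entry is exactly `D.comm`. -/
theorem derGen_comm (p q : ℤ) (x : H.W p) (y : H.W q) :
    derGen D p x * derGen D q y - ksign (p * q) • (derGen D q y * derGen D p x)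
      = (Complex.I * (c : ℂ)) • derGen D (p + q) (H.β p q (p + q) x y) := by
  have h := congrArg F (gen_comm (c := c) p q x y)
  rw [map_sub, map_zsmul, map_mul, map_mul, map_smul] at h
  simp only [derGen_apply, Matrix.mul_fin_two]
  ext i j
  fin_cases i <;> fin_cases j
  · simp [-zsmul_eq_mul]
    rw [smul_comm (Complex.I * (c : ℂ)), ← h, mul_add, ksign_add, smul_sub]
    simp only [smul_smul]
    congr 2 <;> ring
  · have := D.comm p q x y
    simp [-zsmul_eq_mul]
    rw [← this, smul_add]
    abel
  · simp
  · simpa using h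

/-- The algebra homomorphism `a ↦ ((-1)^{k|a|} F a, D a; 0, F a)`. -/
def derHom : HeisAlg H c →ₐ[ℂ] Matrix (Fin 2) (Fin 2) B :=
  lift (derGen D) (derGen_comm D) (by
    rw [derGen_apply, gen_unit, D.unit, map_one, mul_zero, ksign_zero, one_smul]
    exact Matrix.one_fin_two.symm)

/-- The graded derivation with given values on the generators. -/
def der : HeisAlg H c →ₗ[ℂ] B where
  toFun a := derHom D a 0 1
  map_add' a b := by simp
  map_smul' z a := by simp

theorem derHom_entries (a : HeisAlg H c) : derHom D a 1 0 = 0 ∧ derHom D a 1 1 = F a := by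
  refine induction (P := fun a => derHom D a 1 0 = 0 ∧ derHom D a 1 1 = F a) ?_ ?_ ?_ ?_ a
  · simp
  · rintro p x b ⟨h1, h2⟩
    rw [map_mul, derHom, lift_gen, ← derHom, map_mul]
    simp [Matrix.mul_apply, derGen_apply, h1, h2]
  · rintro a b ⟨h1, h2⟩ ⟨h1', h2'⟩
    simp [h1, h2, h1', h2']
  · rintro z a ⟨h1, h2⟩
    simp [h1, h2]

theorem derHom_zero_zero (n : ℤ) (a : HeisAlg H c) (ha : a ∈ gr H c n) :
    derHom D a 0 0 = ksign (k * n) • F a := by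
  refine gr_induction (P := fun n a => derHom D a 0 0 = ksign (k * n) • F a) ?_ ?_ ?_ ?_ n a ha
  · simp [ksign_zero]
  · intro p q x b _ hb
    rw [map_mul, derHom, lift_gen, ← derHom, map_mul, Matrix.mul_apply]
    simp [-zsmul_eq_mul, derGen_apply, hb, (derHom_entries D b).1, mul_add, ksign_add, smul_smul,
      mul_comm]
  · intro n a b ha hb
    rw [map_add, map_add, Matrix.add_apply, ha, hb, smul_add]
  · intro n z a ha
    rw [map_smul, map_smul, Matrix.smul_apply, ha, smul_comm]

theorem der_gen (p : ℤ) (x : H.W p) : der D (gen H c p x) = D.δ p x := by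
  change derHom D (gen H c p x) 0 1 = _
  rw [derHom, lift_gen]
  simp [derGen_apply]

theorem der_one : der D 1 = 0 := by
  change derHom D 1 0 1 = _
  simp

theorem der_mul (n : ℤ) (a : HeisAlg H c) (ha : a ∈ gr H c n) (b : HeisAlg H c) :
    der D (a * b) = der D a * F b + ksign (k * n) • (F a * der D b) := by
  change derHom D (a * b) 0 1 = derHom D a 0 1 * F b + _ • (_ * derHom D b 0 1)
  rw [map_mul, Matrix.mul_apply]
  simp [-zsmul_eq_mul, derHom_entries, derHom_zero_zero D n a ha, add_comm]

theorem der_gen_mul (p : ℤ) (x : H.W p) (b : HeisAlg H c) :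
    der D (gen H c p x * b)
      = D.δ p x * F b + ksign (k * p) • (F (gen H c p x) * der D b) := by
  rw [der_mul D p _ (gen_mem p x), der_gen]

end Der

end HeisAlg

namespace HeisAlg

variable {H : HeisData.{w}} {c : ℝ}

theorem gen_comm' (p q r : ℤ) (h : p + q = r) (x : H.W p) (y : H.W q) :
    gen H c p x * gen H c q y - ksign (p * q) • (gen H c q y * gen H c p x)
      = (Complex.I * (c : ℂ)) • gen H c r (H.β p q r x y) := by
  subst h; exact gen_comm p q x y

/-! #### The differential -/

/-- The values of the differential on the generators. -/
def diffData (H : HeisData.{w}) (c : ℝ) : DerData H c (AlgHom.id ℂ (HeisAlg H c)) (-1) where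
  δ p := gen H c (p - 1) ∘ₗ H.d p (p - 1)
  comm p q x y := by
    have h1 := gen_comm' (c := c) (p - 1) q (p + q - 1) (by ring) (H.d p (p - 1) x) y
    have h2 := gen_comm' (c := c) p (q - 1) (p + q - 1) (by ring) x (H.d q (q - 1) y)
    have h3 := H.d_β p (p - 1) q (q - 1) (p + q) (p + q - 1) (by ring) (by ring) (by ring) x y
    simp only [LinearMap.comp_apply, AlgHom.id_apply]
    -- By `d_β` the differential of the bracket is a sum of two brackets, each of which is a graded
    -- commutator by `h1` and `h2`. What remains is a comparison of signs, checked parity by parity.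
    rw [h3, map_add, map_zsmul, smul_add (Complex.I * (c : ℂ)),
      smul_comm (Complex.I * (c : ℂ)) (ksign p), ← h1, ← h2, sub_mul, mul_sub,
      one_mul, mul_one, ksign_sub, ksign_sub, neg_one_mul, neg_one_mul, ksign_neg, ksign_neg]
    generalize gen H c p x = a
    generalize gen H c q y = b
    generalize gen H c (p - 1) _ = a'
    generalize gen H c (q - 1) _ = b'
    rcases ksign_cases p with hp | hp <;> rcases ksign_cases q with hq | hq <;>
      simp only [hp, hq, one_smul, neg_smul, smul_add, smul_sub, smul_neg,
        mul_neg, mul_one, neg_neg] <;> abel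
  unit := by
    change gen H c (0 - 1) (H.d 0 (-1) H.unit) = 0
    rw [H.d_unit, map_zero]

/-- The differential: the graded derivation which extends the differential of `W`. -/
def diff (H : HeisData.{w}) (c : ℝ) : HeisAlg H c →ₗ[ℂ] HeisAlg H c := der (diffData H c)

theorem diff_gen (p q : ℤ) (h : q + 1 = p) (x : H.W p) :
    diff H c (gen H c p x) = gen H c q (H.d p q x) := by
  obtain rfl : q = p - 1 := by omega
  exact der_gen _ p x

theorem diff_one : diff H c 1 = 0 := der_one _

theorem diff_leibniz (n : ℤ) (a : HeisAlg H c) (ha : a ∈ gr H c n) (b : HeisAlg H c) :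
    diff H c (a * b) = diff H c a * b + ksign n • (a * diff H c b) := by
  have h := der_mul (diffData H c) n a ha b
  rwa [neg_one_mul, ksign_neg] at h

theorem diff_gen_mul (p q : ℤ) (h : q + 1 = p) (x : H.W p) (b : HeisAlg H c) :
    diff H c (gen H c p x * b)
      = gen H c q (H.d p q x) * b + ksign p • (gen H c p x * diff H c b) := by
  rw [diff_leibniz p _ (gen_mem p x), diff_gen p q h]

theorem diff_mem (i j : ℤ) (h : j + 1 = i) (a : HeisAlg H c) (ha : a ∈ gr H c i) :
    diff H c a ∈ gr H c j := by
  obtain rfl : j = i - 1 := by omega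
  refine gr_induction (P := fun i a => diff H c a ∈ gr H c (i - 1)) ?_ ?_ ?_ ?_ i a ha
  · rw [diff_one]; exact zero_mem _
  · intro p q x b hb hb'
    rw [diff_gen_mul p (p - 1) (by ring)]
    refine add_mem ?_ (zsmul_mem ?_ _)
    · have := SetLike.mul_mem_graded (gen_mem (c := c) (p - 1) (H.d p (p - 1) x)) hb
      rwa [show p - 1 + q = p + q - 1 by ring] at this
    · have := SetLike.mul_mem_graded (gen_mem p x) hb'
      rwa [show p + (q - 1) = p + q - 1 by ring] at this
  · intro n a b ha hb
    rw [map_add]; exact add_mem ha hb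
  · intro n z a ha
    rw [map_smul]; exact Submodule.smul_mem _ z ha

theorem diff_diff (a : HeisAlg H c) : diff H c (diff H c a) = 0 := by
  refine induction (P := fun a => diff H c (diff H c a) = 0) ?_ ?_ ?_ ?_ a
  · rw [diff_one, map_zero]
  · intro p x b hb
    rw [diff_gen_mul p (p - 1) (by ring), map_add, map_zsmul,
      diff_gen_mul (p - 1) (p - 1 - 1) (by ring), diff_gen_mul p (p - 1) (by ring),
      H.d_d _ _ _ (by ring) (by ring), map_zero, hb, ksign_sub, ksign_one]
    simp
  · intro a b ha hb
    rw [map_add, map_add, ha, hb, add_zero]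
  · intro z a ha
    rw [map_smul, map_smul, ha, smul_zero]

/-! #### The involution -/

/-- The image of a generator under `revHom`. -/
def revGen (H : HeisData.{w}) (c : ℝ) (p : ℤ) : H.W p →ₗ[ℝ] CCRAlg.ConjOp (HeisAlg H c) :=
  CCRAlg.realLin (fun x => CCRAlg.ConjOp.op (CCRAlg.revSign p • gen H c p x))
    (fun x y => by rw [map_add, smul_add, map_add])
    (fun a x => by
      apply CCRAlg.ConjOp.op.symm.injective
      rw [CCRAlg.ConjOp.symm_smul, AddEquiv.symm_apply_apply, AddEquiv.symm_apply_apply, gen_smul,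
        Complex.conj_ofReal, smul_comm])

theorem revGen_apply (p : ℤ) (x : H.W p) :
    revGen H c p x = CCRAlg.ConjOp.op (CCRAlg.revSign p • gen H c p x) := rfl

/-- Reversing the factors turns the graded commutator into its multiple by `-(-1)^{pq}`. The minus
sign is absorbed by the conjugation of `i`, and `(-1)^{pq}` by the sign of the bracket, which has
degree `p + q`, through `revSign_add`. -/
theorem revGen_comm (p q : ℤ) (x : H.W p) (y : H.W q) :
    revGen H c p x * revGen H c q y - ksign (p * q) • (revGen H c q y * revGen H c p x)
      = (Complex.I * (c : ℂ)) • revGen H c (p + q) (H.β p q (p + q) x y) := by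
  have h := gen_comm (c := c) p q x y
  have h' : gen H c p x * gen H c q y = (Complex.I * (c : ℂ)) • gen H c (p + q)
      (H.β p q (p + q) x y) + ksign (p * q) • (gen H c q y * gen H c p x) := by
    rw [← h]; abel
  simp only [revGen_apply, ← CCRAlg.ConjOp.op_mul]
  apply CCRAlg.ConjOp.op.symm.injective
  rw [map_sub, map_zsmul, CCRAlg.ConjOp.symm_smul, AddEquiv.symm_apply_apply,
    AddEquiv.symm_apply_apply, AddEquiv.symm_apply_apply]
  rw [map_mul, Complex.conj_I, Complex.conj_ofReal, neg_mul]
  rw [smul_mul_smul_comm, smul_mul_smul_comm, mul_comm (CCRAlg.revSign q), h',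
    smul_comm (ksign (p * q)), ← smul_sub, smul_add, smul_smul, ksign_mul_self, one_smul,
    sub_add_cancel_right, smul_neg, CCRAlg.revSign_add, neg_smul, mul_smul _ (ksign (p * q)),
    smul_comm (Complex.I * (c : ℂ)), smul_comm (Complex.I * (c : ℂ))]

/-- The antilinear antiautomorphism with `x ↦ (-1)^{|x|(|x|-1)/2} x` on generators. -/
def revHom (H : HeisData.{w}) (c : ℝ) : HeisAlg H c →ₐ[ℂ] CCRAlg.ConjOp (HeisAlg H c) :=
  lift (revGen H c) revGen_comm (by
    rw [revGen_apply, CCRAlg.revSign_zero, one_smul, gen_unit]; rfl)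

/-- The linear map `a ↦ (-1)^{|a|(|a|-1)/2} a`. -/
def signMap (H : HeisData.{w}) (c : ℝ) : HeisAlg H c →ₗ[ℂ] HeisAlg H c :=
  DirectSum.toModule ℂ ℤ _ (fun n => CCRAlg.revSign n • (gr H c n).subtype) ∘ₗ
    (DirectSum.decomposeLinearEquiv (gr H c)).toLinearMap

theorem signMap_of_mem (n : ℤ) (a : HeisAlg H c) (ha : a ∈ gr H c n) :
    signMap H c a = CCRAlg.revSign n • a := by
  change DirectSum.toModule ℂ ℤ _ (fun n => CCRAlg.revSign n • (gr H c n).subtype)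
    (DirectSum.decompose (gr H c) a) = _
  rw [DirectSum.decompose_of_mem _ ha, ← DirectSum.lof_eq_of ℂ, DirectSum.toModule_lof]
  rfl

/-- The involution: the antilinear map with `x* = x` for `x ∈ W` and
`(ab)* = (-1)^{|a||b|} b* a*`. -/
def conjStar (H : HeisData.{w}) (c : ℝ) : HeisAlg H c →ₗ⋆[ℂ] HeisAlg H c where
  toFun a := CCRAlg.ConjOp.op.symm (revHom H c (signMap H c a))
  map_add' a b := by simp
  map_smul' z a := by rw [map_smul, map_smul, CCRAlg.ConjOp.symm_smul]

theorem conjStar_of_mem (n : ℤ) (a : HeisAlg H c) (ha : a ∈ gr H c n) :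
    conjStar H c a = CCRAlg.revSign n • CCRAlg.ConjOp.op.symm (revHom H c a) := by
  change CCRAlg.ConjOp.op.symm (revHom H c (signMap H c a)) = _
  rw [signMap_of_mem n a ha, map_zsmul, map_zsmul]

theorem conjStar_mul (i j : ℤ) (a : HeisAlg H c) (ha : a ∈ gr H c i) (b : HeisAlg H c)
    (hb : b ∈ gr H c j) :
    conjStar H c (a * b) = ksign (i * j) • (conjStar H c b * conjStar H c a) := by
  rw [conjStar_of_mem (i + j) _ (SetLike.mul_mem_graded ha hb), conjStar_of_mem i a ha,
    conjStar_of_mem j b hb, map_mul, CCRAlg.ConjOp.symm_mul, smul_mul_smul_comm, smul_smul,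
    CCRAlg.revSign_add, mul_comm (ksign _), mul_comm (CCRAlg.revSign j)]

theorem conjStar_gen (p : ℤ) (x : H.W p) : conjStar H c (gen H c p x) = gen H c p x := by
  rw [conjStar_of_mem p _ (gen_mem p x), revHom, lift_gen, revGen_apply,
    AddEquiv.symm_apply_apply, smul_smul, CCRAlg.revSign_mul_self, one_smul]

theorem conjStar_one : conjStar H c 1 = 1 := by
  rw [← gen_unit, conjStar_gen]

theorem conjStar_mem (n : ℤ) (a : HeisAlg H c) (ha : a ∈ gr H c n) :
    conjStar H c a ∈ gr H c n := by
  refine gr_induction (P := fun n a => conjStar H c a ∈ gr H c n) ?_ ?_ ?_ ?_ n a ha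
  · rw [conjStar_one]; exact SetLike.GradedOne.one_mem
  · intro p q x b hb hb'
    rw [conjStar_mul p q _ (gen_mem p x) b hb, conjStar_gen]
    have := SetLike.mul_mem_graded hb' (gen_mem p x)
    rw [add_comm q p] at this
    exact zsmul_mem this _
  · intro n a b ha hb
    rw [map_add]; exact add_mem ha hb
  · intro n z a ha
    rw [LinearMap.map_smulₛₗ]; exact Submodule.smul_mem _ _ ha

theorem conjStar_conjStar (a : HeisAlg H c) : conjStar H c (conjStar H c a) = a := by
  refine of_homogeneous (P := fun a => conjStar H c (conjStar H c a) = a) ?_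
    (fun a b ha hb => by rw [map_add, map_add, ha, hb]) a
  refine gr_induction (P := fun n a => conjStar H c (conjStar H c a) = a) ?_ ?_ ?_ ?_
  · rw [conjStar_one, conjStar_one]
  · intro p q x b hb hb'
    rw [conjStar_mul p q _ (gen_mem p x) b hb, map_zsmul, conjStar_gen,
      conjStar_mul q p _ (conjStar_mem q b hb) _ (gen_mem p x), hb', conjStar_gen, smul_smul,
      mul_comm q p, ksign_mul_self, one_smul]
  · intro n a b ha hb
    rw [map_add, map_add, ha, hb]
  · intro n z a ha
    rw [LinearMap.map_smulₛₗ, LinearMap.map_smulₛₗ, ha]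
    simp

theorem diff_conjStar (a : HeisAlg H c) :
    diff H c (conjStar H c a) = conjStar H c (diff H c a) := by
  refine of_homogeneous (P := fun a => diff H c (conjStar H c a) = conjStar H c (diff H c a)) ?_
    (fun a b ha hb => by rw [map_add, map_add, map_add, map_add, ha, hb]) a
  refine gr_induction (P := fun n a => diff H c (conjStar H c a) = conjStar H c (diff H c a))
    ?_ ?_ ?_ ?_
  · rw [conjStar_one, diff_one, map_zero]
  · intro p q x b hb hb'
    rw [conjStar_mul p q _ (gen_mem p x) b hb, map_zsmul, conjStar_gen,
      diff_leibniz q _ (conjStar_mem q b hb), diff_gen_mul p (p - 1) (by ring),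
      diff_gen p (p - 1) (by ring), hb', map_add, map_zsmul,
      conjStar_mul (p - 1) q _ (gen_mem _ _) b hb, conjStar_gen,
      conjStar_mul p (q - 1) _ (gen_mem p x) _ (diff_mem q (q - 1) (by ring) b hb),
      conjStar_gen, smul_smul, smul_add, smul_smul, sub_mul, mul_sub, one_mul, mul_one,
      ksign_sub, ksign_sub, add_comm]
    congr 2
    rw [mul_comm (ksign (p * q)), ← mul_assoc, ksign_mul_self, one_mul]
  · intro n a b ha hb
    rw [map_add, map_add, map_add, map_add, ha, hb]
  · intro n z a ha
    rw [LinearMap.map_smulₛₗ, map_smul, map_smul, LinearMap.map_smulₛₗ, ha]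

/-! ### The enveloping algebra as a differential graded `*`-algebra -/

/-- The enveloping algebra as a differential graded `*`-algebra. -/
def dgStarAlg (H : HeisData.{w}) (c : ℝ) : DGStarAlg.{w} where
  carrier := HeisAlg H c
  gr := gr H c
  d := diff H c
  d_mem := diff_mem
  d_d := diff_diff
  leibniz := diff_leibniz
  star := conjStar H c
  star_mem := conjStar_mem
  star_star := conjStar_conjStar
  star_mul := conjStar_mul
  d_star := diff_conjStar

/-- The universal property for differential graded `*`-algebras. -/
def liftHom (B : DGStarAlg.{w}) (g : ∀ p : ℤ, H.W p →ₗ[ℝ] B.carrier)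
    (hg : ∀ (p q : ℤ) (x : H.W p) (y : H.W q),
      g p x * g q y - ksign (p * q) • (g q y * g p x)
        = (Complex.I * (c : ℂ)) • g (p + q) (H.β p q (p + q) x y))
    (hu : g 0 H.unit = 1) (h_mem : ∀ p x, g p x ∈ B.gr p)
    (h_d : ∀ p q, q + 1 = p → ∀ x, B.d (g p x) = g q (H.d p q x))
    (h_star : ∀ p x, B.star (g p x) = g p x) : dgStarAlg H c ⟶ B :=
  -- No Leibniz argument is needed: `1` is the image of the marked cycle.
  have h_one : B.d 1 = 0 := by rw [← hu, h_d 0 (-1) (by ring), H.d_unit, map_zero]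
  have mem : ∀ (n : ℤ) (a : HeisAlg H c), a ∈ gr H c n → lift g hg hu a ∈ B.gr n := by
    refine gr_induction (P := fun n a => lift g hg hu a ∈ B.gr n) ?_ ?_ ?_ ?_
    · rw [map_one]; exact SetLike.GradedOne.one_mem
    · intro p q x b _ hb
      rw [map_mul, lift_gen]; exact SetLike.mul_mem_graded (h_mem p x) hb
    · intro n a b ha hb
      rw [map_add]; exact add_mem ha hb
    · intro n z a ha
      rw [map_smul]; exact Submodule.smul_mem _ _ ha
  { f := lift g hg hu
    map_mem := mem
    map_d := fun a => by
      refine induction (P := fun a => lift g hg hu (diff H c a) = B.d (lift g hg hu a))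
        ?_ ?_ ?_ ?_ a
      · rw [diff_one, map_one, h_one, map_zero]
      · intro p x b hb
        rw [diff_gen_mul p (p - 1) (by ring), map_mul, map_add, map_zsmul, map_mul, map_mul,
          lift_gen, lift_gen, B.leibniz p _ (h_mem p x), hb, h_d p (p - 1) (by ring)]
      · intro a b ha hb
        rw [map_add, map_add, map_add, map_add, ha, hb]
      · intro z a ha
        rw [map_smul, map_smul, map_smul, map_smul, ha]
    map_star := fun a => by
      refine of_homogeneous (P := fun a => lift g hg hu (conjStar H c a)
        = B.star (lift g hg hu a)) ?_
        (fun a b ha hb => by rw [map_add, map_add, map_add, map_add, ha, hb]) a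
      refine gr_induction (P := fun n a => lift g hg hu (conjStar H c a)
        = B.star (lift g hg hu a)) ?_ ?_ ?_ ?_
      · rw [conjStar_one, map_one, ← hu, h_star]
      · intro p q x b hb hb'
        rw [conjStar_mul p q _ (gen_mem p x) b hb, map_zsmul, map_mul, map_mul, conjStar_gen,
          lift_gen, B.star_mul p q _ (h_mem p x) _ (mem q b hb), h_star, hb']
      · intro n a b ha hb
        rw [map_add, map_add, map_add, map_add, ha, hb]
      · intro n z a ha
        rw [LinearMap.map_smulₛₗ, map_smul, map_smul, LinearMap.map_smulₛₗ, ha] }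

theorem liftHom_gen (B : DGStarAlg.{w}) (g : ∀ p : ℤ, H.W p →ₗ[ℝ] B.carrier)
    (hg hu h_mem h_d h_star) (p : ℤ) (x : H.W p) :
    (liftHom (c := c) B g hg hu h_mem h_d h_star).f (gen H c p x) = g p x :=
  lift_gen g hg hu p x

end HeisAlg

/-! ### Morphisms of Heisenberg data and functoriality -/

/-- A morphism of the differential graded vector spaces underlying Heisenberg data which
preserves the marked elements. -/
structure HeisHom (H H' : HeisData.{w}) where
  f : ∀ p, H.W p →ₗ[ℝ] H'.W p
  f_d : ∀ p q, q + 1 = p → ∀ x, f q (H.d p q x) = H'.d p q (f p x)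
  f_unit : f 0 H.unit = H'.unit

namespace HeisHom

variable {H H' H'' : HeisData.{w}}

/-- Composition. -/
def comp (f : HeisHom H H') (g : HeisHom H' H'') : HeisHom H H'' where
  f p := g.f p ∘ₗ f.f p
  f_d p q h x := by simp [f.f_d p q h, g.f_d p q h]
  f_unit := by simp [f.f_unit, g.f_unit]

/-- The identity. -/
def id (H : HeisData.{w}) : HeisHom H H where
  f _ := LinearMap.id
  f_d _ _ _ _ := rfl
  f_unit := rfl

/-- Compatibility with the brackets scaled by `c`. -/
def PreservesBracket (f : HeisHom H H') (c : ℝ) : Prop :=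
  ∀ p q r x y, c • f.f r (H.β p q r x y) = c • H'.β p q r (f.f p x) (f.f q y)

/-- This is why the condition is scaled by `c`: at `c = 0` homotopy inverses, which have no reason
to respect `β`, still induce algebra homomorphisms. -/
theorem preservesBracket_zero (f : HeisHom H H') : f.PreservesBracket 0 :=
  fun _ _ _ _ _ => by rw [zero_smul, zero_smul]

theorem PreservesBracket.apply {f : HeisHom H H'} (hf : f.PreservesBracket 1) (p q r : ℤ)
    (x : H.W p) (y : H.W q) : f.f r (H.β p q r x y) = H'.β p q r (f.f p x) (f.f q y) := by
  simpa using hf p q r x y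

end HeisHom

namespace HeisAlg

variable {H H' : HeisData.{w}} {c : ℝ}

theorem gen_comp_comm (f : HeisHom H H') (hf : f.PreservesBracket c) (p q : ℤ) (x : H.W p)
    (y : H.W q) : (gen H' c p ∘ₗ f.f p) x * (gen H' c q ∘ₗ f.f q) y
        - ksign (p * q) • ((gen H' c q ∘ₗ f.f q) y * (gen H' c p ∘ₗ f.f p) x)
      = (Complex.I * (c : ℂ)) • (gen H' c (p + q) ∘ₗ f.f (p + q)) (H.β p q (p + q) x y) := by
  refine (gen_comm (c := c) p q (f.f p x) (f.f q y)).trans ?_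
  have h := congrArg (gen H' c (p + q)) (hf p q (p + q) x y)
  rw [gen_smul, gen_smul] at h
  rw [mul_smul, mul_smul, ← h]
  rfl

/-- The algebra homomorphism induced by a morphism which preserves the scaled bracket. -/
def mapAlg (f : HeisHom H H') (hf : f.PreservesBracket c) : HeisAlg H c →ₐ[ℂ] HeisAlg H' c :=
  lift (fun p => gen H' c p ∘ₗ f.f p)
    (gen_comp_comm f hf)
    (by rw [LinearMap.comp_apply, f.f_unit]; exact gen_unit)

theorem mapAlg_gen (f : HeisHom H H') (hf : f.PreservesBracket c) (p : ℤ) (x : H.W p) :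
    mapAlg f hf (gen H c p x) = gen H' c p (f.f p x) :=
  lift_gen _ _ _ p x

theorem mapAlg_gen_mul (f : HeisHom H H') (hf : f.PreservesBracket c) (p : ℤ) (x : H.W p)
    (b : HeisAlg H c) : mapAlg f hf (gen H c p x * b) = gen H' c p (f.f p x) * mapAlg f hf b := by
  rw [map_mul, mapAlg_gen]

/-- The morphism of differential graded `*`-algebras induced by a morphism which preserves the
scaled bracket. -/
def map (f : HeisHom H H') (hf : f.PreservesBracket c) : dgStarAlg H c ⟶ dgStarAlg H' c :=
  liftHom (dgStarAlg H' c) (fun p => gen H' c p ∘ₗ f.f p)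
    (gen_comp_comm f hf)
    ((congrArg (gen H' c 0) f.f_unit).trans gen_unit)
    (fun p x => gen_mem p (f.f p x))
    (fun p q h x => (diff_gen p q h (f.f p x)).trans
      (congrArg (gen H' c q) (f.f_d p q h x).symm))
    (fun p x => conjStar_gen p (f.f p x))

theorem mapAlg_diff (f : HeisHom H H') (hf : f.PreservesBracket c) (a : HeisAlg H c) :
    mapAlg f hf (diff H c a) = diff H' c (mapAlg f hf a) := (map f hf).map_d a

/-! #### Contractions and the change of the commutation relations -/

theorem β_β_right (H : HeisData.{w}) (p q r s t : ℤ) (x : H.W p) (y : H.W q) (z : H.W r) :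
    H.β p s t x (H.β q r s y z) = 0 := by
  rw [H.β_antisymm, H.β_β, smul_zero, neg_zero]

theorem gen_β_central (p q r s : ℤ) (x : H.W p) (y : H.W q) (z : H.W s) :
    gen H c r (H.β p q r x y) * gen H c s z
      = ksign (r * s) • (gen H c s z * gen H c r (H.β p q r x y)) := by
  have h := gen_comm (c := c) r s (H.β p q r x y) z
  rwa [H.β_β, map_zero, smul_zero, sub_eq_zero] at h

/-- The values of the contraction with `β(x, -)` on the generators. -/
def contrData (c : ℝ) (p : ℤ) (x : H.W p) : DerData H c (AlgHom.id ℂ (HeisAlg H c)) p where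
  δ q := gen H c (p + q) ∘ₗ H.β p q (p + q) x
  comm q r y z := by
    simp only [LinearMap.comp_apply, AlgHom.id_apply]
    -- The right side vanishes because `β(y, z)` is central. On the left, `β(x, y)` and `β(x, z)`
    -- graded commute with the generators, so the four terms cancel in pairs.
    rw [β_β_right, map_zero, smul_zero, gen_β_central, gen_β_central, add_mul, add_mul, ksign_add,
      ksign_add]
    generalize gen H c q y = a
    generalize gen H c r z = b
    generalize gen H c (p + q) _ = a'
    generalize gen H c (p + r) _ = b'
    rw [mul_comm r q]
    rcases ksign_cases (p * r) with hp | hp <;> rcases ksign_cases (p * q) with hq | hq <;>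
      rcases ksign_cases (q * r) with hr | hr <;>
      simp only [hp, hq, hr, one_smul, neg_smul, mul_neg, mul_one, neg_neg] <;> abel
  unit := by
    rw [LinearMap.comp_apply, H.β_antisymm, H.β_unit, smul_zero, neg_zero, map_zero]

/-- The contraction with `β(x, -)`: the graded derivation with `y ↦ β(x, y)` on the
generators. -/
def contr (c : ℝ) (p : ℤ) (x : H.W p) : HeisAlg H c →ₗ[ℂ] HeisAlg H c := der (contrData c p x)

theorem contr_one (p : ℤ) (x : H.W p) : contr c p x 1 = 0 := der_one _

theorem contr_gen_mul (p q r : ℤ) (h : p + q = r) (x : H.W p) (y : H.W q) (b : HeisAlg H c) :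
    contr c p x (gen H c q y * b) = gen H c r (H.β p q r x y) * b
      + ksign (p * q) • (gen H c q y * contr c p x b) := by
  subst h; exact der_gen_mul _ q y b

theorem contr_β_mul (p q r s : ℤ) (x : H.W p) (y : H.W q) (z : H.W r) (b : HeisAlg H c) :
    contr c p x (gen H c s (H.β q r s y z) * b)
      = ksign (p * s) • (gen H c s (H.β q r s y z) * contr c p x b) := by
  rw [contr_gen_mul p s _ rfl, β_β_right, map_zero, zero_mul, zero_add]

theorem contr_add (p : ℤ) (x y : H.W p) : contr c p (x + y) = contr c p x + contr c p y := by
  refine LinearMap.ext (induction ?_ ?_ (fun a b ha hb => ?_) (fun z a ha => ?_))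
  · simp [contr_one]
  · intro q z b hb
    rw [LinearMap.add_apply] at hb ⊢
    rw [contr_gen_mul p q _ rfl, contr_gen_mul p q _ rfl, contr_gen_mul p q _ rfl, hb, map_add,
      LinearMap.add_apply, map_add, add_mul, mul_add, smul_add]
    abel
  · rw [map_add, map_add, ha, hb]
  · rw [map_smul, map_smul, ha]

theorem contr_smul (p : ℤ) (t : ℝ) (x : H.W p) : contr c p (t • x) = (t : ℂ) • contr c p x := by
  refine LinearMap.ext (induction ?_ ?_ (fun a b ha hb => ?_) (fun z a ha => ?_))
  · simp [contr_one]
  · intro q z b hb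
    rw [LinearMap.smul_apply] at hb ⊢
    rw [contr_gen_mul p q _ rfl, contr_gen_mul p q _ rfl, hb, map_smul, LinearMap.smul_apply,
      gen_smul, smul_mul_assoc, mul_smul_comm, smul_add, smul_comm (t : ℂ)]
  · rw [map_add, map_add, ha, hb]
  · rw [map_smul, map_smul, ha]

/-- Applied to the marked element and to values of `β`, which therefore act through `quantGen` by
plain multiplication. -/
theorem contr_eq_zero (p : ℤ) (x : H.W p) (h : ∀ q r y, H.β p q r x y = 0) :
    contr c p x = 0 := by
  refine LinearMap.ext (induction (contr_one p x) ?_ (fun a b ha hb => ?_) (fun z a ha => ?_))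
  · intro q z b hb
    rw [contr_gen_mul p q _ rfl, h, hb]
    simp
  · rw [map_add, map_add, ha, hb]
  · rw [map_smul, map_smul, ha]

/-- The graded commutator of two graded derivations is again a derivation, and it kills each
generator `z`, since a contraction of the central element `β(y, z)` vanishes. -/
theorem contr_contr (p q : ℤ) (x : H.W p) (y : H.W q) (a : HeisAlg H c) :
    contr c p x (contr c q y a) = ksign (p * q) • contr c q y (contr c p x a) := by
  refine induction (P := fun a => contr c p x (contr c q y a)
    = ksign (p * q) • contr c q y (contr c p x a)) ?_ ?_ (fun a b ha hb => ?_)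
    (fun z a ha => ?_) a
  · simp [contr_one]
  · intro r z b hb
    rw [contr_gen_mul q r _ rfl, contr_gen_mul p r _ rfl, map_add, map_add, map_zsmul, map_zsmul,
      contr_β_mul, contr_β_mul, contr_gen_mul p r _ rfl, contr_gen_mul q r _ rfl, hb, mul_add,
      mul_add, ksign_add, ksign_add, mul_comm q p]
    generalize contr c q y (contr c p x b) = e
    generalize contr c p x b = a'
    generalize contr c q y b = b'
    rcases ksign_cases (p * r) with hp | hp <;> rcases ksign_cases (p * q) with hq | hq <;>
      rcases ksign_cases (q * r) with hr | hr <;>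
      simp only [hp, hq, hr, one_smul, neg_smul, smul_add, smul_neg, mul_neg, mul_one, neg_neg]
        <;> abel
  · simp only [map_add, ha, hb, smul_add]
  · simp only [map_smul, ha]
    rw [smul_comm]

/-- The graded commutator of `d` with the contraction is a derivation; on generators its value is
the one prescribed by `d_β`. -/
theorem diff_contr (p p' : ℤ) (h : p' + 1 = p) (x : H.W p) (a : HeisAlg H c) :
    diff H c (contr c p x a)
      = contr c p' (H.d p p' x) a + ksign p • contr c p x (diff H c a) := by
  obtain rfl : p' = p - 1 := by omega
  refine induction (P := fun a => diff H c (contr c p x a)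
      = contr c (p - 1) (H.d p (p - 1) x) a + ksign p • contr c p x (diff H c a)) ?_ ?_
    (fun a b ha hb => ?_) (fun z a ha => ?_) a
  · simp [contr_one, diff_one]
  · intro q y b hb
    rw [contr_gen_mul p q _ rfl, map_add, map_zsmul, diff_gen_mul (p + q) (p + q - 1) (by ring),
      diff_gen_mul q (q - 1) (by ring), diff_gen_mul q (q - 1) (by ring), hb,
      contr_gen_mul (p - 1) q (p + q - 1) (by ring), map_add, map_zsmul,
      contr_gen_mul p (q - 1) (p + q - 1) (by ring), contr_gen_mul p q _ rfl,
      H.d_β p (p - 1) q (q - 1) (p + q) (p + q - 1) (by ring) (by ring) (by ring),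
      map_add, map_zsmul, sub_mul, mul_sub, one_mul, mul_one, ksign_sub, ksign_sub, ksign_add,
      add_mul, mul_add]
    generalize contr c p x (diff H c b) = e
    generalize contr c p x b = a'
    generalize contr c (p - 1) _ b = b'
    rcases ksign_cases p with hp | hp <;> rcases ksign_cases (p * q) with hq | hq <;>
      rcases ksign_cases q with hr | hr <;>
      simp only [hp, hq, hr, one_smul, neg_smul, smul_add, smul_neg, mul_neg, mul_one, neg_neg,
        neg_mul] <;> abel
  · simp only [map_add, ha, hb, smul_add]; abel
  · simp only [map_smul, ha, smul_add]
    rw [smul_comm]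

/-- Contractions involve the unscaled bracket, hence `hf`; the hypothesis `hf'` serves only to
define the homomorphism at parameter `c` and says nothing about `β` when `c = 0`. -/
theorem mapAlg_contr (f : HeisHom H H') (hf : f.PreservesBracket 1) (hf' : f.PreservesBracket c)
    (p : ℤ) (x : H.W p) (a : HeisAlg H c) :
    mapAlg f hf' (contr c p x a) = contr c p (f.f p x) (mapAlg f hf' a) := by
  refine induction (P := fun a => mapAlg f hf' (contr c p x a)
    = contr c p (f.f p x) (mapAlg f hf' a)) ?_ ?_ (fun a b ha hb => ?_) (fun z a ha => ?_) a
  · rw [contr_one, map_zero, map_one, contr_one]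
  · intro q y b hb
    rw [contr_gen_mul p q _ rfl, mapAlg_gen_mul, contr_gen_mul p q _ rfl, map_add, map_zsmul,
      mapAlg_gen_mul, mapAlg_gen_mul, hb, hf.apply]
  · simp only [map_add, ha, hb]
  · simp only [map_smul, ha]

/-! ### Comparison of the complexes for different brackets -/

/-- The action of the generators of the enveloping algebra with parameter `c` on the one with
parameter `c'`. -/
def quantGen (H : HeisData.{w}) (c c' : ℝ) (p : ℤ) :
    H.W p →ₗ[ℝ] Module.End ℂ (HeisAlg H c') :=
  CCRAlg.realLin (fun x => LinearMap.mulLeft ℂ (gen H c' p x)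
      + (((c - c') / 2 : ℝ) * Complex.I) • contr c' p x)
    (fun x y => by
      refine LinearMap.ext fun a => ?_
      simp only [map_add, contr_add, LinearMap.add_apply, LinearMap.smul_apply,
        LinearMap.mulLeft_apply, add_mul, smul_add]
      abel)
    (fun t x => by
      refine LinearMap.ext fun a => ?_
      simp only [gen_smul, contr_smul, LinearMap.add_apply, LinearMap.smul_apply,
        LinearMap.mulLeft_apply, smul_mul_assoc, smul_add]
      rw [smul_comm])

theorem quantGen_apply (c c' : ℝ) (p : ℤ) (x : H.W p) (a : HeisAlg H c') :
    quantGen H c c' p x a = gen H c' p x * a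
      + (((c - c') / 2 : ℝ) * Complex.I) • contr c' p x a := rfl

theorem quantGen_β (c c' : ℝ) (p q r : ℤ) (x : H.W p) (y : H.W q) (a : HeisAlg H c') :
    quantGen H c c' r (H.β p q r x y) a = gen H c' r (H.β p q r x y) * a := by
  rw [quantGen_apply, contr_eq_zero r _ fun s t z => H.β_β p q r s t x y z,
    LinearMap.zero_apply, smul_zero, add_zero]

/-- With `κ = i (c - c') / 2`, multiplications contribute `i c' β(x, y)`, each of the two mixed
commutators of a multiplication with a contraction contributes `κ β(x, y)`, and contractions graded
commute. The total is `i c' + 2 κ = i c` times `β(x, y)`. -/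
theorem quantGen_comm (c c' : ℝ) (p q : ℤ) (x : H.W p) (y : H.W q) :
    quantGen H c c' p x * quantGen H c c' q y
        - ksign (p * q) • (quantGen H c c' q y * quantGen H c c' p x)
      = (Complex.I * (c : ℂ)) • quantGen H c c' (p + q) (H.β p q (p + q) x y) := by
  refine LinearMap.ext fun b => ?_
  rw [LinearMap.smul_apply, quantGen_β]
  have h1 := congrArg (· * b) (gen_comm (c := c') p q x y)
  simp only [sub_mul, smul_mul_assoc, mul_assoc] at h1
  -- The splitting `i c = i c' + κ + κ`, one summand `κ` for each mixed commutator.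
  have h2 : (Complex.I * (c : ℂ)) • (gen H c' (p + q) (H.β p q (p + q) x y) * b)
      = (Complex.I * (c' : ℂ)) • (gen H c' (p + q) (H.β p q (p + q) x y) * b)
        + ((((c - c') / 2 : ℝ) * Complex.I) • (gen H c' (p + q) (H.β p q (p + q) x y) * b)
        + (((c - c') / 2 : ℝ) * Complex.I) • (gen H c' (p + q) (H.β p q (p + q) x y) * b)) := by
    rw [← add_smul, ← add_smul]
    congr 1
    push_cast
    ring
  rw [h2, ← h1]
  change quantGen H c c' p x (quantGen H c c' q y b)
    - ksign (p * q) • quantGen H c c' q y (quantGen H c c' p x b) = _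
  simp only [quantGen_apply, map_add, map_smul]
  rw [contr_gen_mul p q _ rfl, contr_gen_mul q p (p + q) (add_comm q p), contr_contr p q x y,
    H.β_antisymm q p, map_neg, map_zsmul, mul_comm q p]
  generalize (((c - c') / 2 : ℝ) * Complex.I) = κ
  generalize contr c' q y (contr c' p x b) = e
  generalize contr c' p x b = a'
  generalize contr c' q y b = b'
  rcases ksign_cases (p * q) with hq | hq <;>
    simp only [hq, one_smul, neg_smul, smul_add, smul_neg, neg_neg, neg_mul]
      <;> abel

/-- The representation of the enveloping algebra with parameter `c` on the one with
parameter `c'`. -/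
def quantRep (H : HeisData.{w}) (c c' : ℝ) : HeisAlg H c →ₐ[ℂ] Module.End ℂ (HeisAlg H c') :=
  lift (quantGen H c c') (quantGen_comm c c') (by
    refine LinearMap.ext fun b => ?_
    rw [quantGen_apply, gen_unit, contr_eq_zero 0 _ fun q r y => H.β_unit q r y]
    simp)

/-- The linear comparison map between enveloping algebras with different parameters. -/
def quant (H : HeisData.{w}) (c c' : ℝ) : HeisAlg H c →ₗ[ℂ] HeisAlg H c' :=
  LinearMap.applyₗ (1 : HeisAlg H c') ∘ₗ (quantRep H c c').toLinearMap

theorem quant_one (c c' : ℝ) : quant H c c' 1 = 1 := by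
  exact LinearMap.congr_fun (map_one (quantRep H c c')) 1

theorem quant_gen_mul (c c' : ℝ) (p : ℤ) (x : H.W p) (b : HeisAlg H c) :
    quant H c c' (gen H c p x * b) = gen H c' p x * quant H c c' b
      + (((c - c') / 2 : ℝ) * Complex.I) • contr c' p x (quant H c c' b) := by
  change quantRep H c c' (gen H c p x * b) 1 = _
  rw [map_mul, quantRep, lift_gen]
  rfl

/-- Multiplication by `x` and contraction with `x` have the same graded commutation rule with `d`,
namely `x` is replaced by `d x`; so any linear combination of the two does as well. -/
theorem quant_diff (c c' : ℝ) (a : HeisAlg H c) :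
    quant H c c' (diff H c a) = diff H c' (quant H c c' a) := by
  refine induction (P := fun a => quant H c c' (diff H c a) = diff H c' (quant H c c' a)) ?_ ?_
    (fun a b ha hb => ?_) (fun z a ha => ?_) a
  · rw [diff_one, map_zero, quant_one, diff_one]
  · intro p x b hb
    rw [diff_gen_mul p (p - 1) (by ring), map_add, map_zsmul, quant_gen_mul, quant_gen_mul,
      quant_gen_mul, hb, map_add, map_smul, diff_gen_mul p (p - 1) (by ring),
      diff_contr p (p - 1) (by ring), smul_add, smul_add, smul_comm (ksign p) (_ : ℂ)]
    abel
  · rw [map_add, map_add, ha, hb, map_add, map_add]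
  · rw [map_smul, map_smul, ha, map_smul, map_smul]

/-- Passing the contraction through the action of a generator `y` produces `β(x, y)`, which acts by
plain multiplication on both sides. This is what allows the induction in `quant_quant`. -/
theorem quant_contr (c c' : ℝ) (p : ℤ) (x : H.W p) (a : HeisAlg H c) :
    quant H c c' (contr c p x a) = contr c' p x (quant H c c' a) := by
  refine induction (P := fun a => quant H c c' (contr c p x a) = contr c' p x (quant H c c' a))
    ?_ ?_ (fun a b ha hb => ?_) (fun z a ha => ?_) a
  · rw [contr_one, map_zero, quant_one, contr_one]
  · intro q y b hb
    rw [contr_gen_mul p q _ rfl, map_add, map_zsmul, quant_gen_mul, quant_gen_mul,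
      quant_gen_mul, hb, map_add, map_smul, contr_gen_mul p q _ rfl, contr_contr p q x y,
      contr_eq_zero (p + q) _ fun s t z => H.β_β p q (p + q) s t x y z, LinearMap.zero_apply,
      smul_zero, add_zero, smul_add, smul_comm (ksign (p * q)) (_ : ℂ)]
    abel
  · rw [map_add, map_add, ha, hb, map_add, map_add]
  · rw [map_smul, map_smul, ha, map_smul, map_smul]

/-- Exchanging the parameters changes the sign of the coefficient of the contraction, and the two
contraction terms cancel because contractions commute with `quant`. -/
theorem quant_quant (c c' : ℝ) (a : HeisAlg H c) : quant H c' c (quant H c c' a) = a := by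
  refine induction (P := fun a => quant H c' c (quant H c c' a) = a) ?_ ?_
    (fun a b ha hb => ?_) (fun z a ha => ?_) a
  · rw [quant_one, quant_one]
  · intro p x b hb
    have h : (((c' - c) / 2 : ℝ) * Complex.I) = -(((c - c') / 2 : ℝ) * Complex.I) := by
      push_cast; ring
    rw [quant_gen_mul, map_add, map_smul, quant_gen_mul, quant_contr, hb, h, neg_smul,
      neg_add_cancel_right]
  · rw [map_add, map_add, ha, hb]
  · rw [map_smul, map_smul, ha]

/-- `quant` is built from multiplications and contractions only, both of which are natural for
bracket preserving morphisms. -/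
theorem mapAlg_quant (f : HeisHom H H') (hf : f.PreservesBracket 1) (c c' : ℝ)
    (hc : f.PreservesBracket c) (hc' : f.PreservesBracket c') (a : HeisAlg H c) :
    mapAlg f hc' (quant H c c' a) = quant H' c c' (mapAlg f hc a) := by
  refine induction (P := fun a => mapAlg f hc' (quant H c c' a)
    = quant H' c c' (mapAlg f hc a)) ?_ ?_ (fun a b ha hb => ?_) (fun z a ha => ?_) a
  · rw [quant_one, map_one, map_one, quant_one]
  · intro p x b hb
    rw [mapAlg_gen_mul, quant_gen_mul, quant_gen_mul, map_add, map_smul, mapAlg_gen_mul,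
      mapAlg_contr f hf hc', hb]
  · simp only [map_add, ha, hb]
  · simp only [map_smul, ha]

end HeisAlg

/-- A chain homotopy between two morphisms which vanishes on the marked element; only the
components `h p q` with `p + 1 = q` are relevant. -/
structure HeisHomotopy {H H' : HeisData.{w}} (f g : HeisHom H H') where
  h : ∀ p q, H.W p →ₗ[ℝ] H'.W q
  eq : ∀ p q r, p + 1 = q → r + 1 = p → ∀ x,
    g.f p x - f.f p x = H'.d q p (h p q x) + h r p (H.d p r x)
  unit : h 0 1 H.unit = 0

/-! ### Coefficientwise operations on polynomials over a noncommutative algebra -/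

section Polynomial

open Polynomial

variable {A : Type*} [Ring A] [Algebra ℂ A]

/-- The coefficientwise application of a linear map. -/
def polyMap (φ : A →ₗ[ℂ] A) : A[X] →ₗ[ℂ] A[X] :=
  Polynomial.lsum fun n => (Polynomial.monomial n).restrictScalars ℂ ∘ₗ φ

theorem polyMap_monomial (φ : A →ₗ[ℂ] A) (n : ℕ) (a : A) :
    polyMap φ (monomial n a) = monomial n (φ a) := by
  simp [polyMap, Polynomial.sum_monomial_index]

theorem polyMap_C (φ : A →ₗ[ℂ] A) (a : A) : polyMap φ (C a) = C (φ a) :=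
  polyMap_monomial φ 0 a

theorem polyMap_X_mul (φ : A →ₗ[ℂ] A) (P : A[X]) : polyMap φ (X * P) = X * polyMap φ P := by
  induction P using Polynomial.induction_on' with
  | add P Q hP hQ => rw [mul_add, map_add, hP, hQ, map_add, mul_add]
  | monomial n a => rw [X_mul_monomial, polyMap_monomial, polyMap_monomial, X_mul_monomial]

/-- Intended for a graded derivation `φ`, with `b = φ a` and `s` the Koszul sign of `a`: the Leibniz
rule passes to coefficients. -/
theorem polyMap_C_mul (φ : A →ₗ[ℂ] A) (a b : A) (s : ℤ)
    (h : ∀ e, φ (a * e) = b * e + s • (a * φ e)) (P : A[X]) :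
    polyMap φ (C a * P) = C b * P + s • (C a * polyMap φ P) := by
  induction P using Polynomial.induction_on' with
  | add P Q hP hQ => rw [mul_add, map_add, hP, hQ, map_add, mul_add, mul_add, smul_add]; abel
  | monomial n e =>
    rw [C_mul_monomial, polyMap_monomial, polyMap_monomial, C_mul_monomial, C_mul_monomial, h,
      map_add, map_zsmul]

/-- The integral of a polynomial from `0` to `1`. -/
def polyInt (A : Type*) [Ring A] [Algebra ℂ A] : A[X] →ₗ[ℂ] A :=
  Polynomial.lsum fun n => ((n + 1 : ℂ)⁻¹) • LinearMap.id

theorem polyInt_monomial (n : ℕ) (a : A) :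
    polyInt A (monomial n a) = ((n + 1 : ℂ)⁻¹) • a := by
  simp [polyInt, Polynomial.sum_monomial_index]

theorem polyInt_polyMap (φ : A →ₗ[ℂ] A) (P : A[X]) :
    polyInt A (polyMap φ P) = φ (polyInt A P) := by
  induction P using Polynomial.induction_on' with
  | add P Q hP hQ => simp only [map_add, hP, hQ]
  | monomial n e => rw [polyMap_monomial, polyInt_monomial, polyInt_monomial, map_smul]

theorem polyInt_derivative (P : A[X]) :
    polyInt A (derivative P) = eval 1 P - eval 0 P := by
  induction P using Polynomial.induction_on' with
  | add P Q hP hQ => simp only [map_add, hP, hQ, eval_add]; abel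
  | monomial n e =>
    rw [derivative_monomial, polyInt_monomial, eval_monomial, eval_monomial, one_pow, mul_one]
    -- A constant has derivative zero and equal values at both ends. In degree `n + 1` the value at
    -- `0` vanishes and the factor `n + 1` of the derivative cancels that of the integral.
    rcases n with _ | n
    · simp
    · rw [zero_pow (Nat.succ_ne_zero n), mul_zero, sub_zero, Nat.add_sub_cancel,
        ← Nat.cast_commute, ← nsmul_eq_mul, ← Nat.cast_smul_eq_nsmul ℂ, smul_smul]
      have : (n : ℂ) + 1 ≠ 0 := Nat.cast_add_one_ne_zero n
      push_cast
      rw [inv_mul_cancel₀ this, one_smul]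

end Polynomial

/-! ### Homotopy invariance for the vanishing bracket -/

namespace HeisAlg

open Polynomial

variable {H H' : HeisData.{w}}

theorem gen_comm_zero (p q : ℤ) (x : H.W p) (y : H.W q) :
    gen H 0 p x * gen H 0 q y = ksign (p * q) • (gen H 0 q y * gen H 0 p x) := by
  have h := gen_comm (c := 0) p q x y
  rwa [Complex.ofReal_zero, mul_zero, zero_smul, sub_eq_zero] at h

/-- The linear path between the images of a generator under two morphisms. -/
def pathGen (f g : HeisHom H H') (p : ℤ) (x : H.W p) : (HeisAlg H' 0)[X] :=
  C (gen H' 0 p (f.f p x)) + C (gen H' 0 p (g.f p x - f.f p x)) * X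

theorem C_gen_mul_pathGen (f g : HeisHom H H') (p q : ℤ) (z : H'.W p) (y : H.W q) :
    C (gen H' 0 p z) * pathGen f g q y = ksign (p * q) • (pathGen f g q y * C (gen H' 0 p z)) := by
  rw [pathGen, mul_add, add_mul, ← mul_assoc, mul_assoc _ X, X_mul, ← mul_assoc, ← C_mul, ← C_mul,
    ← C_mul, ← C_mul, gen_comm_zero p q, gen_comm_zero p q, smul_add, map_zsmul, map_zsmul,
    smul_mul_assoc]

/-- For `c = 0` all coefficients graded commute and `X` is central, so the path satisfies the
defining relations although `f` and `g` need not respect `β`. -/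
theorem pathGen_comm (f g : HeisHom H H') (p q : ℤ) (x : H.W p) (y : H.W q) :
    pathGen f g p x * pathGen f g q y
      = ksign (p * q) • (pathGen f g q y * pathGen f g p x) := by
  conv_lhs => rw [pathGen, add_mul, mul_assoc, X_mul, ← mul_assoc, C_gen_mul_pathGen,
    C_gen_mul_pathGen]
  conv_rhs => rw [pathGen.eq_1 f g p, mul_add, smul_add]
  rw [smul_mul_assoc, mul_assoc]

/-- The linear path between the algebra homomorphisms induced by two morphisms. -/
def pathAlg (f g : HeisHom H H') : HeisAlg H 0 →ₐ[ℂ] (HeisAlg H' 0)[X] :=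
  lift (fun p => CCRAlg.realLin (pathGen f g p)
      (fun x y => by
        simp only [pathGen, map_add, map_sub, sub_mul, add_mul]; abel)
      (fun t x => by
        rw [pathGen, pathGen, (f.f p).map_smul, (g.f p).map_smul, ← smul_sub, gen_smul, gen_smul, smul_add,
          ← smul_C, ← smul_C, smul_mul_assoc]))
    (fun p q x y => by
      rw [Complex.ofReal_zero, mul_zero, zero_smul, sub_eq_zero]
      exact pathGen_comm f g p q x y)
    (by
      rw [CCRAlg.realLin_apply, pathGen, f.f_unit, g.f_unit, sub_self, map_zero, map_zero,
        zero_mul, add_zero, gen_unit, C_1])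

theorem pathAlg_gen (f g : HeisHom H H') (p : ℤ) (x : H.W p) :
    pathAlg f g (gen H 0 p x) = pathGen f g p x := lift_gen _ _ _ p x

theorem eval_pathAlg (f g : HeisHom H H') (a : HeisAlg H 0) :
    eval 0 (pathAlg f g a) = mapAlg f f.preservesBracket_zero a ∧
      eval 1 (pathAlg f g a) = mapAlg g g.preservesBracket_zero a := by
  refine induction (P := fun a => eval 0 (pathAlg f g a) = mapAlg f f.preservesBracket_zero a ∧
      eval 1 (pathAlg f g a) = mapAlg g g.preservesBracket_zero a) ?_ ?_
      (fun a b ha hb => ?_) (fun z a ha => ?_) a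
  · simp
  · rintro p x b ⟨h0, h1⟩
    -- Over noncommutative coefficients the evaluation is computed through left multiplication by
    -- constants and right multiplication by `X`, so `X` is moved to the far right.
    rw [map_mul, pathAlg_gen, pathGen, mapAlg_gen_mul, mapAlg_gen_mul, ← h0, ← h1, add_mul,
      mul_assoc, X_mul]
    simp only [eval_add, eval_C_mul, map_sub]
    simp [sub_mul]
  · simp only [map_add, eval_add, ha, hb, and_self]
  · simp only [map_smul, eval_smul, ha, and_self]

theorem polyMap_diff_pathGen_mul (f g : HeisHom H H') (p q : ℤ) (h : q + 1 = p) (x : H.W p)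
    (P : (HeisAlg H' 0)[X]) :
    polyMap (diff H' 0) (pathGen f g p x * P) = pathGen f g q (H.d p q x) * P
      + ksign p • (pathGen f g p x * polyMap (diff H' 0) P) := by
  have key : ∀ (y : H'.W p) (Q : (HeisAlg H' 0)[X]), polyMap (diff H' 0) (C (gen H' 0 p y) * Q)
      = C (gen H' 0 q (H'.d p q y)) * Q
        + ksign p • (C (gen H' 0 p y) * polyMap (diff H' 0) Q) :=
    fun y Q => polyMap_C_mul _ _ _ _ (fun e => diff_gen_mul p q h y e) Q
  rw [pathGen, pathGen, add_mul, map_add, mul_assoc, key, key, polyMap_X_mul, map_sub, f.f_d p q h,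
    g.f_d p q h, add_mul, add_mul, mul_assoc, mul_assoc, smul_add]
  abel

theorem polyMap_diff_pathAlg (f g : HeisHom H H') (a : HeisAlg H 0) :
    polyMap (diff H' 0) (pathAlg f g a) = pathAlg f g (diff H 0 a) := by
  refine induction (P := fun a => polyMap (diff H' 0) (pathAlg f g a)
    = pathAlg f g (diff H 0 a)) ?_ ?_ (fun a b ha hb => ?_) (fun z a ha => ?_) a
  · rw [map_one, diff_one, map_zero, ← C_1, polyMap_C, diff_one, map_zero]
  · intro p x b hb
    rw [map_mul, pathAlg_gen, polyMap_diff_pathGen_mul f g p (p - 1) (by ring), hb,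
      diff_gen_mul p (p - 1) (by ring), map_add, map_zsmul, map_mul, map_mul, pathAlg_gen,
      pathAlg_gen]
  · simp only [map_add, ha, hb]
  · simp only [map_smul, ha]

variable {f g : HeisHom H H'}

/-- The values of the derivation integrating to the homotopy induced by a homotopy. -/
def homotopyData (k : HeisHomotopy f g) : DerData H 0 (pathAlg f g) 1 where
  δ p := CCRAlg.realLin (fun x => C (gen H' 0 (p + 1) (k.h p (p + 1) x)))
    (fun x y => by simp only [map_add])
    (fun t x => by rw [map_smul, gen_smul, smul_C])
  comm p q x y := by
    simp only [CCRAlg.realLin_apply, pathAlg_gen]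
    rw [Complex.ofReal_zero, mul_zero, zero_smul, C_gen_mul_pathGen, C_gen_mul_pathGen, add_mul,
      add_mul, one_mul, one_mul, ksign_add, ksign_add, mul_comm q p]
    generalize C (gen H' 0 (p + 1) _) = a
    generalize C (gen H' 0 (q + 1) _) = b
    rcases ksign_cases p with hp | hp <;> rcases ksign_cases q with hq | hq <;>
      rcases ksign_cases (p * q) with hr | hr <;>
      simp only [hp, hq, hr, one_smul, neg_smul, smul_add, smul_neg, mul_neg, mul_one, neg_neg]
        <;> abel
  unit := by
    rw [CCRAlg.realLin_apply]
    change C (gen H' 0 1 (k.h 0 1 H.unit)) = 0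
    rw [k.unit, map_zero, map_zero]

theorem der_homotopyData_gen_mul (k : HeisHomotopy f g) (p q : ℤ) (h : p + 1 = q) (x : H.W p)
    (b : HeisAlg H 0) : der (homotopyData k) (gen H 0 p x * b)
      = C (gen H' 0 q (k.h p q x)) * pathAlg f g b
        + ksign p • (pathGen f g p x * der (homotopyData k) b) := by
  subst h
  rw [der_gen_mul, one_mul, pathAlg_gen]
  rfl

/-- Both sides are derivations along `pathAlg f g`, so it suffices to compare generators. There the
derivative of the path is `g - f`, and the left side is `d h + h d`. -/
theorem derivative_pathAlg (k : HeisHomotopy f g) (a : HeisAlg H 0) :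
    polyMap (diff H' 0) (der (homotopyData k) a) + der (homotopyData k) (diff H 0 a)
      = derivative (pathAlg f g a) := by
  refine induction (P := fun a => polyMap (diff H' 0) (der (homotopyData k) a)
    + der (homotopyData k) (diff H 0 a) = derivative (pathAlg f g a)) ?_ ?_
    (fun a b ha hb => ?_) (fun z a ha => ?_) a
  · rw [der_one, diff_one, map_zero, map_zero, map_one, derivative_one, add_zero]
  · intro p x b hb
    have hd : derivative (pathGen f g p x)
        = C (gen H' 0 p (H'.d (p + 1) p (k.h p (p + 1) x)))
          + C (gen H' 0 p (k.h (p - 1) p (H.d p (p - 1) x))) := by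
      rw [← map_add, ← map_add, ← k.eq p (p + 1) (p - 1) rfl (by ring)]
      simp [pathGen]
    rw [map_mul (pathAlg f g), pathAlg_gen, derivative_mul, ← hb, hd, der_homotopyData_gen_mul k p (p + 1) rfl,
      map_add, map_zsmul, polyMap_C_mul _ _ _ _ (diff_gen_mul (p + 1) p rfl _),
      polyMap_diff_pathGen_mul f g p (p - 1) (by ring), diff_gen_mul p (p - 1) (by ring), map_add,
      map_zsmul, der_homotopyData_gen_mul k (p - 1) p (by ring),
      der_homotopyData_gen_mul k p (p + 1) rfl, polyMap_diff_pathAlg, ksign_add, ksign_sub,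
      ksign_one, add_mul, mul_add]
    rcases ksign_cases p with hp | hp <;>
      simp only [hp, one_smul, neg_smul, smul_add, smul_neg, mul_neg, mul_one, neg_neg] <;> abel
  · simp only [map_add, ← ha, ← hb]; abel
  · simp only [map_smul, derivative_smul, ← ha, smul_add]

/-- A homotopy of morphisms induces a chain homotopy between the induced homomorphisms of the
enveloping algebras with vanishing bracket. -/
def homotopy (k : HeisHomotopy f g) : HeisAlg H 0 →ₗ[ℂ] HeisAlg H' 0 :=
  polyInt (HeisAlg H' 0) ∘ₗ der (homotopyData k)

/-- Integrate `derivative_pathAlg` from `0` to `1`: the integral commutes with the coefficientwise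
differential, and the derivative of the path integrates to the difference of its ends. -/
theorem homotopy_spec (k : HeisHomotopy f g) (a : HeisAlg H 0) :
    diff H' 0 (homotopy k a) + homotopy k (diff H 0 a)
      = mapAlg g g.preservesBracket_zero a - mapAlg f f.preservesBracket_zero a := by
  rw [homotopy, LinearMap.comp_apply, LinearMap.comp_apply, ← polyInt_polyMap, ← map_add,
    derivative_pathAlg, polyInt_derivative, (eval_pathAlg f g a).1, (eval_pathAlg f g a).2]

end HeisAlg

/-! ### Quasi-isomorphisms in terms of elements -/

/-- A linear map can be lifted through another one with larger range. -/
theorem exists_comp_eq {K : Type*} [Field K] {E F G : Type*} [AddCommGroup E] [Module K E]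
    [AddCommGroup F] [Module K F] [AddCommGroup G] [Module K G] (φ : E →ₗ[K] F) (ψ : G →ₗ[K] F)
    (h : ∀ x, ∃ y, ψ y = φ x) : ∃ k : E →ₗ[K] G, ∀ x, ψ (k x) = φ x := by
  obtain ⟨k, hk⟩ := Module.projective_lifting_property ψ.rangeRestrict
    (φ.codRestrict (LinearMap.range ψ) h) ψ.surjective_rangeRestrict
  exact ⟨k, fun x => congrArg Subtype.val (LinearMap.congr_fun hk x)⟩

section Elements

variable {K : Type} [Field K] {V W : ChainComplex (ModuleCat.{w} K) ℤ}

/-- The morphism from the free module of rank one with a given value. -/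
def elementHom {M : ModuleCat.{w} K} (x : M) : ModuleCat.of K (ULift.{w} K) ⟶ M :=
  ModuleCat.ofHom (LinearMap.toSpanSingleton K M x ∘ₗ ULift.moduleEquiv.toLinearMap)

theorem elementHom_one {M : ModuleCat.{w} K} (x : M) : (elementHom x).hom ⟨1⟩ = x :=
  one_smul K x

theorem elementHom_comp {M N : ModuleCat.{w} K} (x : M) (f : M ⟶ N) :
    elementHom x ≫ f = elementHom (f.hom x) := by
  ext t
  exact f.hom.map_smul _ _

/-- The criterion with refinements is tested on the free module of rank one to obtain statements
about elements. Conversely, over a field elementwise choices can be made linearly, so no refinement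
is needed. -/
theorem quasiIso_iff_elements (φ : V ⟶ W) : QuasiIso φ ↔ ∀ i j k : ℤ, j + 1 = i → k + 1 = j →
    (∀ x, (V.d j k).hom x = 0 → ∀ y, (φ.f j).hom x = (W.d i j).hom y →
      ∃ x', (V.d i j).hom x' = x) ∧
    (∀ y, (W.d j k).hom y = 0 → ∃ x, (V.d j k).hom x = 0 ∧
      ∃ y', y = (φ.f j).hom x + (W.d i j).hom y') := by
  have h : ∀ i j k : ℤ, j + 1 = i → k + 1 = j → (QuasiIsoAt φ j ↔
      (∀ x, (V.d j k).hom x = 0 → ∀ y, (φ.f j).hom x = (W.d i j).hom y →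
        ∃ x', (V.d i j).hom x' = x) ∧
      (∀ y, (W.d j k).hom y = 0 → ∃ x, (V.d j k).hom x = 0 ∧
        ∃ y', y = (φ.f j).hom x + (W.d i j).hom y')) := by
    intro i j k hij hjk
    have hi : (ComplexShape.down ℤ).prev j = i := by rw [ChainComplex.prev, hij]
    have hk : (ComplexShape.down ℤ).next j = k := by rw [ChainComplex.next, ← hjk]; ring
    rw [quasiIsoAt_iff_isIso_homologyMap, isIso_iff_mono_and_epi,
      HomologicalComplex.mono_homologyMap_iff_up_to_refinements φ i j k hi hk,
      HomologicalComplex.epi_homologyMap_iff_up_to_refinements φ i j k hi hk]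
    refine and_congr ⟨fun H x hx y hxy => ?_, fun H A x hx y hxy => ?_⟩
      ⟨fun H y hy => ?_, fun H A y hy => ?_⟩
    -- The element `x` becomes a morphism out of `K`; a preimage of the generator under the
    -- epimorphism `π` turns the refined solution back into an element.
    · obtain ⟨A, π, hπ, x', hx'⟩ := H (elementHom x)
        (by rw [elementHom_comp, hx]; ext; exact smul_zero _) (elementHom y)
        (by rw [elementHom_comp, elementHom_comp, hxy])
      obtain ⟨a, ha⟩ := (ModuleCat.epi_iff_surjective π).1 hπ ⟨1⟩
      refine ⟨x'.hom a, ?_⟩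
      have := congrArg (fun m => m.hom a) hx'
      simp only [ModuleCat.hom_comp, LinearMap.comp_apply] at this
      rw [← this]
      exact (congrArg _ ha).trans (elementHom_one x)
    · obtain ⟨x', hx'⟩ := exists_comp_eq x.hom (V.d i j).hom (fun a =>
        H (x.hom a) (congrArg (fun m => m.hom a) hx) (y.hom a) (congrArg (fun m => m.hom a) hxy))
      exact ⟨A, 𝟙 A, inferInstance, ModuleCat.ofHom x', by ext a; exact (hx' a).symm⟩
    · obtain ⟨A, π, hπ, x, hx, y', hy'⟩ := H (elementHom y)
        (by rw [elementHom_comp, hy]; ext; exact smul_zero _)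
      obtain ⟨a, ha⟩ := (ModuleCat.epi_iff_surjective π).1 hπ ⟨1⟩
      refine ⟨x.hom a, congrArg (fun m => m.hom a) hx, y'.hom a, ?_⟩
      have := congrArg (fun m => m.hom a) hy'
      simp only [ModuleCat.hom_comp, LinearMap.comp_apply, ModuleCat.hom_add,
        LinearMap.add_apply] at this
      rw [← this]
      exact ((congrArg _ ha).trans (elementHom_one y)).symm
    -- A cycle and a primitive are chosen simultaneously, by lifting `y` through the sum map from
    -- cycles of `V` and chains of `W`.
    · obtain ⟨k', hk'⟩ := exists_comp_eq y.hom
        (LinearMap.coprod ((φ.f j).hom ∘ₗ (LinearMap.ker (V.d j k).hom).subtype) (W.d i j).hom)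
        (fun a => by
          obtain ⟨x, hx, y', hy'⟩ := H (y.hom a) (congrArg (fun m => m.hom a) hy)
          exact ⟨(⟨x, hx⟩, y'), hy'.symm⟩)
      refine ⟨A, 𝟙 A, inferInstance, ModuleCat.ofHom ((LinearMap.ker (V.d j k).hom).subtype ∘ₗ
        LinearMap.fst K _ _ ∘ₗ k'), by ext a; exact (k' a).1.2,
        ModuleCat.ofHom (LinearMap.snd K _ _ ∘ₗ k'), ?_⟩
      ext a
      exact (hk' a).symm
  rw [quasiIso_iff]
  refine ⟨fun H i j k hij hjk => (h i j k hij hjk).1 (H j), fun H j => ?_⟩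
  exact (h (j + 1) j (j - 1) rfl (by ring)).2 (H _ _ _ rfl (by ring))

end Elements

/-! ### Homology of differential graded algebras in terms of elements -/

/-- Injectivity on homology, for a map of vector spaces with differential. -/
def HInjective {A B : Type*} [AddCommGroup A] [AddCommGroup B] (dA : A → A) (dB : B → B)
    (f : A → B) : Prop := ∀ a, dA a = 0 → ∀ b, f a = dB b → ∃ a', dA a' = a

/-- Surjectivity on homology, for a map of vector spaces with differential. -/
def HSurjective {A B : Type*} [AddCommGroup A] [AddCommGroup B] (dA : A → A) (dB : B → B)
    (f : A → B) : Prop := ∀ b, dB b = 0 → ∃ a, dA a = 0 ∧ ∃ b', b = f a + dB b'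

namespace DGStarAlg

/-- Together with `Hom.proj_f` this reduces homology in each degree to that of the total space: the
homogeneous component of a solution is a solution. -/
theorem proj_d (A : DGStarAlg.{w}) (i j : ℤ) (h : j + 1 = i) (a : A.carrier) :
    GradedAlgebra.proj A.gr j (A.d a) = A.d (GradedAlgebra.proj A.gr i a) := by
  refine DirectSum.Decomposition.inductionOn A.gr
    (motive := fun a => GradedAlgebra.proj A.gr j (A.d a) = A.d (GradedAlgebra.proj A.gr i a))
    (by simp) (fun {n} m => ?_) (fun a b ha hb => by simp only [map_add, ha, hb]) a
  have hm := A.d_mem n (n - 1) (by ring) m.1 m.2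
  rw [GradedAlgebra.proj_apply, GradedAlgebra.proj_apply]
  by_cases hn : n = i
  · subst hn
    obtain rfl : j = n - 1 := by omega
    rw [DirectSum.decompose_of_mem_same _ hm, DirectSum.decompose_of_mem_same _ m.2]
  · rw [DirectSum.decompose_of_mem_ne _ hm (by omega), DirectSum.decompose_of_mem_ne _ m.2 hn,
      map_zero]

theorem proj_mem (A : DGStarAlg.{w}) (i : ℤ) (a : A.carrier) :
    GradedAlgebra.proj A.gr i a ∈ A.gr i := SetLike.coe_mem _

theorem proj_of_mem (A : DGStarAlg.{w}) (i : ℤ) (a : A.carrier) (ha : a ∈ A.gr i) :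
    GradedAlgebra.proj A.gr i a = a := DirectSum.decompose_of_mem_same _ ha

theorem Hom.proj_f {A B : DGStarAlg.{w}} (f : A ⟶ B) (i : ℤ) (a : A.carrier) :
    GradedAlgebra.proj B.gr i (f.f a) = f.f (GradedAlgebra.proj A.gr i a) := by
  refine DirectSum.Decomposition.inductionOn A.gr
    (motive := fun a => GradedAlgebra.proj B.gr i (f.f a) = f.f (GradedAlgebra.proj A.gr i a))
    (by simp) (fun {n} m => ?_) (fun a b ha hb => by simp only [map_add, ha, hb]) a
  have hm := f.map_mem n m.1 m.2
  rw [GradedAlgebra.proj_apply, GradedAlgebra.proj_apply]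
  by_cases hn : n = i
  · subst hn
    rw [DirectSum.decompose_of_mem_same _ hm, DirectSum.decompose_of_mem_same _ m.2]
  · rw [DirectSum.decompose_of_mem_ne _ hm hn, DirectSum.decompose_of_mem_ne _ m.2 hn, map_zero]

theorem toCh_d_apply (A : DGStarAlg.{w}) (i j : ℤ) (h : j + 1 = i) (a : A.gr i) :
    (((toCh.obj A).d i j).hom a : A.gr j).1 = A.d a.1 := by
  have e : (toCh.obj A).d i j = ModuleCat.ofHom (A.d.restrict (A.d_mem i j h)) := dif_pos h
  rw [e]; rfl

/-- A morphism of differential graded `*`-algebras is a weak equivalence if it is bijective on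
the homology of the underlying ungraded vector spaces with differential. -/
theorem weq_of_hBijective {A B : DGStarAlg.{w}} (f : A ⟶ B) (h_inj : HInjective A.d B.d f.f)
    (h_surj : HSurjective A.d B.d f.f) : DGStarAlg.homotopical.weq f := by
  rintro ⟨⟩
  refine (quasiIso_iff_elements (toCh.map f)).2 fun i j k hij hjk => ⟨?_, ?_⟩
  · intro x hx y hxy
    have hx' := (toCh_d_apply A j k hjk x).symm.trans (congrArg Subtype.val hx)
    have hxy' : f.f x.1 = B.d y.1 :=
      (congrArg Subtype.val hxy).trans (toCh_d_apply B i j hij y)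
    obtain ⟨a, ha⟩ := h_inj x.1 hx' y.1 hxy'
    refine ⟨⟨_, A.proj_mem i a⟩, Subtype.ext ?_⟩
    rw [toCh_d_apply A i j hij, ← proj_d A i j hij, ha]
    exact A.proj_of_mem j _ x.2
  · intro y hy
    have hy' := (toCh_d_apply B j k hjk y).symm.trans (congrArg Subtype.val hy)
    obtain ⟨a, ha, b, hb⟩ := h_surj y.1 hy'
    refine ⟨⟨_, A.proj_mem j a⟩, Subtype.ext ?_, ⟨_, B.proj_mem i b⟩, Subtype.ext ?_⟩
    · rw [toCh_d_apply A j k hjk, ← proj_d A j k hjk, ha]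
      exact map_zero _
    · have h1 := congrArg (GradedAlgebra.proj B.gr j) hb
      rw [B.proj_of_mem j _ y.2, map_add, Hom.proj_f, proj_d B i j hij] at h1
      refine h1.trans ?_
      exact congrArg₂ (· + ·) rfl (toCh_d_apply B i j hij _).symm

end DGStarAlg

/-! ### Invariance of enveloping algebras under quasi-isomorphisms -/

namespace HeisAlg

variable {H H' H'' : HeisData.{w}}

theorem mapAlg_comp (f : HeisHom H H') (g : HeisHom H' H'') (a : HeisAlg H 0) :
    mapAlg (f.comp g) (f.comp g).preservesBracket_zero a
      = mapAlg g g.preservesBracket_zero (mapAlg f f.preservesBracket_zero a) := by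
  refine AlgHom.congr_fun (φ₂ := (mapAlg g g.preservesBracket_zero).comp
    (mapAlg f f.preservesBracket_zero)) (hom_ext fun p x => ?_) a
  rw [AlgHom.comp_apply, mapAlg_gen, mapAlg_gen, mapAlg_gen]
  rfl

theorem mapAlg_id (a : HeisAlg H 0) :
    mapAlg (HeisHom.id H) (HeisHom.id H).preservesBracket_zero a = a := by
  refine AlgHom.congr_fun (φ₂ := AlgHom.id ℂ _) (hom_ext fun p x => ?_) a
  rw [mapAlg_gen]
  rfl

theorem homotopy_right_inverse {f : HeisHom H H'} {g : HeisHom H' H}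
    (k : HeisHomotopy (g.comp f) (HeisHom.id H')) {b : HeisAlg H' 0} (hb : diff H' 0 b = 0) :
    b = mapAlg f f.preservesBracket_zero (mapAlg g g.preservesBracket_zero b)
      + diff H' 0 (homotopy k b) := by
  have h := homotopy_spec k b
  rw [hb, map_zero, add_zero, mapAlg_comp, mapAlg_id] at h
  rw [h, add_sub_cancel]

theorem hSurjective_of_homotopy {f : HeisHom H H'} {g : HeisHom H' H}
    (k : HeisHomotopy (g.comp f) (HeisHom.id H')) :
    HSurjective (diff H 0) (diff H' 0) (mapAlg f f.preservesBracket_zero) := fun b hb =>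
  ⟨mapAlg g g.preservesBracket_zero b, by rw [← mapAlg_diff, hb, map_zero], homotopy k b,
    homotopy_right_inverse k hb⟩

theorem hInjective_of_homotopy {f : HeisHom H H'} {g : HeisHom H' H} {f' : HeisHom H H'}
    (k : HeisHomotopy (g.comp f) (HeisHom.id H')) (k' : HeisHomotopy (f'.comp g) (HeisHom.id H)) :
    HInjective (diff H 0) (diff H' 0) (mapAlg f f.preservesBracket_zero) := by
  intro a ha b hab
  -- Modulo the boundary of `a'`, the cycle `a` is `g z`. If `f a` is the boundary of `b`, then `f g
  -- z` bounds `b - f a'`, and `z` differs from `f g z` by the boundary of its homotopy. Thus `z` is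
  -- a boundary, and so is `a`.
  obtain ⟨z, hz, a', rfl⟩ := hSurjective_of_homotopy k' a ha
  have h := homotopy_right_inverse k hz
  refine ⟨mapAlg g g.preservesBracket_zero
    (b - mapAlg f f.preservesBracket_zero a' + homotopy k z) + a', ?_⟩
  rw [map_add, mapAlg_diff, ← eq_sub_iff_add_eq, ← map_sub] at hab
  rw [map_add, ← mapAlg_diff, map_add, ← hab, ← h]

/-- Cycles and primitives are transported between the parameters `1` and `0` by the chain
isomorphism `quant`, which commutes with `f`. -/
theorem hInjective_one (f : HeisHom H H') (hf : f.PreservesBracket 1)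
    (h : HInjective (diff H 0) (diff H' 0) (mapAlg f f.preservesBracket_zero)) :
    HInjective (diff H 1) (diff H' 1) (mapAlg f hf) := by
  intro a ha b hab
  obtain ⟨a', ha'⟩ := h (quant H 1 0 a) (by rw [← quant_diff, ha, map_zero]) (quant H' 1 0 b)
    (by rw [mapAlg_quant f hf 1 0 hf, hab, quant_diff])
  exact ⟨quant H 0 1 a', by rw [← quant_diff, ha', quant_quant]⟩

theorem hSurjective_one (f : HeisHom H H') (hf : f.PreservesBracket 1)
    (h : HSurjective (diff H 0) (diff H' 0) (mapAlg f f.preservesBracket_zero)) :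
    HSurjective (diff H 1) (diff H' 1) (mapAlg f hf) := by
  intro b hb
  obtain ⟨a, ha, b', hb'⟩ := h (quant H' 1 0 b) (by rw [← quant_diff, hb, map_zero])
  refine ⟨quant H 0 1 a, by rw [← quant_diff, ha, map_zero], quant H' 0 1 b', ?_⟩
  rw [mapAlg_quant f hf 0 1 f.preservesBracket_zero, ← quant_diff, ← map_add, ← hb', quant_quant]

/-- A bracket preserving morphism `f` with a right homotopy inverse `g`, which in turn has a right
homotopy inverse, induces a weak equivalence of enveloping algebras. -/
theorem map_weq {f : HeisHom H H'} {g : HeisHom H' H} {f' : HeisHom H H'}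
    (hf : f.PreservesBracket 1) (k : HeisHomotopy (g.comp f) (HeisHom.id H'))
    (k' : HeisHomotopy (f'.comp g) (HeisHom.id H)) : DGStarAlg.homotopical.weq (map f hf) :=
  DGStarAlg.weq_of_hBijective _ (hInjective_one f hf (hInjective_of_homotopy k k'))
    (hSurjective_one f hf (hSurjective_of_homotopy k))

end HeisAlg

/-! ### Quasi-isomorphisms of complexes of vector spaces -/

section Field

variable {K : Type} [Field K]

/-- Invert `φ` linearly on its range and extend to all of `F`. -/
theorem exists_generalized_inverse {E F : Type*} [AddCommGroup E] [Module K E] [AddCommGroup F]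
    [Module K F] (φ : E →ₗ[K] F) : ∃ s : F →ₗ[K] E, ∀ x, φ (s (φ x)) = φ x := by
  obtain ⟨s, hs⟩ := φ.rangeRestrict.exists_rightInverse_of_surjective φ.range_rangeRestrict
  obtain ⟨t, ht⟩ := s.exists_extend
  refine ⟨t, fun x => ?_⟩
  have h1 : t (φ x) = s (φ.rangeRestrict x) := LinearMap.congr_fun ht (φ.rangeRestrict x)
  rw [h1]
  exact congrArg Subtype.val (LinearMap.congr_fun hs (φ.rangeRestrict x))

/-- A complex of vector spaces is homotopy equivalent to one with vanishing differential: there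
is an idempotent up to homotopy with values in the cycles which vanishes on the boundaries. -/
theorem exists_harmonic (W : ChainComplex (ModuleCat.{w} K) ℤ) :
    ∃ (e : ∀ p, W.X p →ₗ[K] W.X p) (s : ∀ p q, W.X p →ₗ[K] W.X q),
      ∀ p q r, p + 1 = q → r + 1 = p →
        (∀ x, (W.d p r).hom (e p x) = 0) ∧ (∀ x, e r ((W.d p r).hom x) = 0) ∧
        ∀ x, x = e p x + (W.d q p).hom (s p q x) + s r p ((W.d p r).hom x) := by
  choose s hs using fun p q : ℤ => exists_generalized_inverse (W.d q p).hom
  -- With `d s d = d`, the map `e = 1 - d s - s d` satisfies `d e = 0` and `e d = 0`.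
  refine ⟨fun p => LinearMap.id - (W.d (p + 1) p).hom ∘ₗ s p (p + 1)
    - s (p - 1) p ∘ₗ (W.d p (p - 1)).hom, s, ?_⟩
  rintro p q r rfl hr
  obtain rfl : r = p - 1 := by omega
  refine ⟨fun x => ?_, fun x => ?_, fun x => ?_⟩
  · simp [ExtHom.d_d_hom, hs]
  · have h : (W.d (p - 1 + 1) (p - 1)).hom (s (p - 1) (p - 1 + 1) ((W.d p (p - 1)).hom x))
        = (W.d p (p - 1)).hom x := by
      -- The degree `p - 1 + 1` equals `p` only propositionally, so the identity is proved for a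
      -- variable degree.
      have : ∀ q, q = p → (W.d q (p - 1)).hom (s (p - 1) q ((W.d p (p - 1)).hom x))
          = (W.d p (p - 1)).hom x := by
        rintro _ rfl
        exact hs _ _ x
      exact this _ (by ring)
    simp [ExtHom.d_d_hom, h]
  · simp only [LinearMap.sub_apply, LinearMap.id_apply, LinearMap.comp_apply]
    abel

end Field

/-- A quasi-isomorphism of complexes of real vector spaces has a right homotopy inverse, which is
again a quasi-isomorphism. -/
theorem exists_right_homotopy_inverse {V W : ChR.{w}} (f : V ⟶ W)
    (hf : QuasiIso f) : ∃ (g : W ⟶ V) (h : ∀ p q, W.X p →ₗ[ℝ] W.X q), QuasiIso g ∧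
      ∀ p q r, p + 1 = q → r + 1 = p → ∀ x, x - (f.f p).hom ((g.f p).hom x)
        = (W.d q p).hom (h p q x) + h r p ((W.d p r).hom x) := by
  rw [quasiIso_iff_elements] at hf
  obtain ⟨e, s, hes⟩ := exists_harmonic W
  -- Surjectivity of `f` on homology, made linear: `m` selects a cycle in `V` representing the class
  -- of `e x`, and `n` a chain bounding the difference.
  have h1 : ∀ p, ∃ (m : W.X p →ₗ[ℝ] V.X p) (n : ∀ q, W.X p →ₗ[ℝ] W.X q),
      ∀ q r, p + 1 = q → r + 1 = p → (∀ x, (V.d p r).hom (m (e p x)) = 0) ∧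
        ∀ x, e p x = (f.f p).hom (m (e p x)) + (W.d q p).hom (n q (e p x)) := by
    intro p
    obtain ⟨k, hk⟩ := exists_comp_eq (e p)
      (LinearMap.coprod ((f.f p).hom ∘ₗ (LinearMap.ker (V.d p (p - 1)).hom).subtype)
        (W.d (p + 1) p).hom)
      (fun x => by
        obtain ⟨v, hv, y', hy'⟩ := (hf (p + 1) p (p - 1) rfl (by ring)).2 (e p x)
          ((hes p (p + 1) (p - 1) rfl (by ring)).1 x)
        exact ⟨(⟨v, hv⟩, y'), hy'.symm⟩)
    -- `k` takes the argument of `e` and not its value. Precomposing with `t` makes `m` and `n`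
    -- functions of `e x`, at the cost of nothing since `e t e = e`.
    obtain ⟨t, ht⟩ := exists_generalized_inverse (e p)
    refine ⟨(LinearMap.ker (V.d p (p - 1)).hom).subtype ∘ₗ LinearMap.fst ℝ _ _ ∘ₗ k ∘ₗ t,
      fun q => if hq : p + 1 = q then hq ▸ (LinearMap.snd ℝ _ _ ∘ₗ k ∘ₗ t) else 0, ?_⟩
    rintro q r rfl hr
    obtain rfl : r = p - 1 := by omega
    refine ⟨fun x => (k (t (e p x))).1.2, fun x => ?_⟩
    beta_reduce
    rw [dif_pos rfl]
    exact (ht x).symm.trans (hk (t (e p x))).symm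
  choose m n hmn using h1
  have h2 : ∀ p r, r + 1 = p → ∀ x, e r ((W.d p r).hom x) = 0 := fun p r hr =>
    (hes p (p + 1) r rfl hr).2.1
  -- `g = m e` commutes with the differentials because both composites vanish: `m e` has values in
  -- cycles and `e` kills boundaries.
  let g : W ⟶ V :=
    { f := fun p => ModuleCat.ofHom (m p ∘ₗ e p)
      comm' := fun p r hr => by
        ext x
        exact ((hmn p (p + 1) r rfl hr).1 x).trans
          ((congrArg (m r) (h2 p r hr x)).trans (map_zero _)).symm }
  have hg : ∀ p q r, p + 1 = q → r + 1 = p → ∀ x, x - (f.f p).hom ((g.f p).hom x)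
      = (W.d q p).hom ((s p q + n p q ∘ₗ e p) x)
        + (s r p + n r p ∘ₗ e r) ((W.d p r).hom x) := by
    intro p q r hq hr x
    have hx := (hes p q r hq hr).2.2 x
    have hx' := (hmn p q r hq hr).2 x
    rw [LinearMap.add_apply, LinearMap.add_apply, LinearMap.comp_apply, LinearMap.comp_apply,
      h2 p r hr, map_zero, add_zero, map_add]
    change x - (f.f p).hom (m p (e p x)) = _
    rw [sub_eq_iff_eq_add]
    nth_rewrite 1 [hx]
    nth_rewrite 1 [hx']
    abel
  refine ⟨g, fun p q => s p q + n p q ∘ₗ e p, ?_, hg⟩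
  have hfg : ∀ p q r, p + 1 = q → r + 1 = p → ∀ x, (W.d p r).hom x = 0 →
      ∃ y, x = (f.f p).hom ((g.f p).hom x) + (W.d q p).hom y := by
    intro p q r hq hr x hx
    have := hg p q r hq hr x
    rw [hx, map_zero, add_zero, sub_eq_iff_eq_add'] at this
    exact ⟨_, this⟩
  rw [quasiIso_iff_elements]
  refine fun i j k hij hjk => ⟨fun x hx y hxy => ?_, fun v hv => ?_⟩
  -- Injectivity: if `g x` bounds `y`, then `x` is homologous to `f g x`, which bounds `f y`.
  · obtain ⟨z, hz⟩ := hfg j i k hij hjk x hx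
    refine ⟨(f.f i).hom y + z, ?_⟩
    rw [map_add, ExtHom.f_d_hom, ← hxy, ← hz]
  -- Surjectivity: `f v` maps to the class of `v`, because `v - g f v` becomes a boundary under `f`
  -- and `f` is injective on homology.
  · have hfv : (W.d j k).hom ((f.f j).hom v) = 0 := by
      rw [ExtHom.f_d_hom, hv, map_zero]
    have hgfv : (V.d j k).hom ((g.f j).hom ((f.f j).hom v)) = 0 := by
      rw [ExtHom.f_d_hom, hfv, map_zero]
    obtain ⟨z, hz⟩ := hfg j i k hij hjk _ hfv
    obtain ⟨v', hv'⟩ := (hf i j k hij hjk).1 (v - (g.f j).hom ((f.f j).hom v))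
      (by rw [map_sub, hv, hgfv, sub_zero]) z
      (by rw [map_sub, sub_eq_iff_eq_add', ← hz])
    exact ⟨(f.f j).hom v, hfv, v', by rw [hv', add_sub_cancel]⟩

/-! ### The Heisenberg data of a Poisson complex -/

/-- The space of real functions on the proofs of `P`, which is one-dimensional if `P` holds and
zero otherwise. -/
abbrev Line (P : Prop) : Type := PLift P → ℝ

/-- The value of an element of `Line P`, which is zero if `P` does not hold. -/
def propEval (P : Prop) [Decidable P] : Line P →ₗ[ℝ] ℝ where
  toFun a := if h : P then a ⟨h⟩ else 0
  map_add' a b := by by_cases h : P <;> simp [h]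
  map_smul' c a := by by_cases h : P <;> simp [h]

theorem propEval_pos {P : Prop} [Decidable P] (a : Line P) (h : P) : propEval P a = a ⟨h⟩ :=
  dif_pos h

theorem propEval_neg {P : Prop} [Decidable P] (a : Line P) (h : ¬P) : propEval P a = 0 :=
  dif_neg h

theorem ExtHom.apply_eq_zero {V : ChR.{w}} {k : ℤ} (B : ExtHom V k) (p q : ℤ)
    (h : p + q + k ≠ 0) (x : V.X p) (y : V.X q) : B.1 p q x y = 0 := by
  rw [B.2.1 p q h]; rfl

theorem ExtHom.antisymm {V : ChR.{w}} {k : ℤ} (B : ExtHom V k) (p q : ℤ) (x : V.X p)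
    (y : V.X q) : B.1 p q x y = -((ksign (p * q) : ℝ) * B.1 q p y x) := by
  rw [B.2.2 p q x y, zsmul_eq_mul]

theorem ExtHom.closed_apply {V : ChR.{w}} {τ : ExtHom V 0} (h : ExtHom.del 0 (-1) rfl τ = 0)
    (p p' q q' : ℤ) (hp : p' + 1 = p) (hq : q' + 1 = q) (x : V.X p) (y : V.X q) :
    τ.1 p' q ((V.d p p').hom x) y + (ksign p : ℝ) * τ.1 p q' x ((V.d q q').hom y) = 0 := by
  obtain rfl : p' = p - 1 := by omega
  obtain rfl : q' = q - 1 := by omega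
  rw [← zsmul_eq_mul]
  exact CCRAlg.tau_closed (X := ⟨V, τ, h⟩) p q x y

theorem ExtHom.del_one_apply {V : ChR.{w}} (ρ : ExtHom V 1) (p p' q q' : ℤ) (hp : p' + 1 = p)
    (hq : q' + 1 = q) (x : V.X p) (y : V.X q) : (ExtHom.del 1 0 rfl ρ).1 p q x y
      = ρ.1 p' q ((V.d p p').hom x) y + (ksign p : ℝ) * ρ.1 p q' x ((V.d q q').hom y) := by
  obtain rfl : p' = p - 1 := by omega
  obtain rfl : q' = q - 1 := by omega
  rw [ExtHom.del_apply, ksign_one, neg_one_smul, neg_neg, zsmul_eq_mul]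

/-- The central extension of the complex `V` of a Poisson complex by the unit, with bracket
`τ`. -/
def PoCh.heis (X : PoCh.{w}) : HeisData.{w} where
  W p := X.V.X p × Line (p = 0)
  d p q := LinearMap.prodMap (X.V.d p q).hom 0
  d_d p q r _ _ x := by
    ext
    · exact ExtHom.d_d_hom X.V p q r x.1
    · rfl
  unit := (0, fun _ => 1)
  d_unit := by ext <;> simp
  β p q r := LinearMap.mk₂ ℝ (fun x y => (0, fun _ => X.τ.1 p q x.1 y.1))
    (fun x x' y => by ext <;> simp) (fun c x y => by ext <;> simp)
    (fun x y y' => by ext <;> simp) (fun c x y => by ext <;> simp)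
  β_degree p q r h := by
    refine LinearMap.ext fun x => LinearMap.ext fun y => Prod.ext rfl (funext fun hr => ?_)
    exact ExtHom.apply_eq_zero X.τ p q (by have := hr.down; omega) _ _
  β_antisymm p q r x y := by
    refine Prod.ext (by simp) (funext fun hr => ?_)
    simpa using ExtHom.antisymm X.τ p q x.1 y.1
  -- The differential vanishes on the unit, so the left side is zero and the identity says that `τ`
  -- is a cycle.
  d_β p p' q q' r r' hp hq hr x y := by
    refine Prod.ext (by simp) (funext fun hr => ?_)
    simpa using (ExtHom.closed_apply X.closed p p' q q' hp hq x.1 y.1).symm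
  β_β p q r s t x y z := by ext <;> simp
  β_unit q r y := by ext <;> simp

/-- The morphism of central extensions induced by a chain map. -/
def PoCh.heisHom {X Y : PoCh.{w}} (f : X.V ⟶ Y.V) : HeisHom X.heis Y.heis where
  f p := LinearMap.prodMap (f.f p).hom LinearMap.id
  f_d p q _ x := Prod.ext (ExtHom.f_d_hom f p q x.1).symm rfl
  f_unit := Prod.ext (map_zero (f.f 0).hom) rfl

theorem PoCh.heisHom_preservesBracket {X Y : PoCh.{w}} (f : X ⟶ Y) :
    (heisHom f.f).PreservesBracket 1 := by
  intro p q r x y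
  rw [one_smul, one_smul]
  refine Prod.ext (map_zero (f.f.f r).hom) (funext fun _ => ?_)
  exact congrArg (fun B : ExtHom X.V 0 => B.1 p q x.1 y.1) f.comm.symm

/-- The homotopy of morphisms of central extensions induced by a homotopy. -/
def PoCh.heisHomotopy {X Y : PoCh.{w}} (f : X.V ⟶ Y.V) (g : Y.V ⟶ X.V)
    (h : ∀ p q, Y.V.X p →ₗ[ℝ] Y.V.X q)
    (H : ∀ p q r, p + 1 = q → r + 1 = p → ∀ x, x - (f.f p).hom ((g.f p).hom x)
      = (Y.V.d q p).hom (h p q x) + h r p ((Y.V.d p r).hom x)) :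
    HeisHomotopy ((heisHom g).comp (heisHom f)) (HeisHom.id Y.heis) where
  h p q := LinearMap.prodMap (h p q) (0 : Line (p = 0) →ₗ[ℝ] Line (q = 0))
  eq p q r hq hr x := by
    refine Prod.ext (H p q r hq hr x.1) ?_
    change x.2 - x.2 = (0 : Line (p = 0)) + 0
    rw [sub_self, add_zero]
  unit := Prod.ext (map_zero (h 0 1)) rfl

/-! #### Comparison with the CCR algebra -/

namespace CCRAlg

variable {X : PoCh.{w}}

theorem heis_gen_unit (c : ℝ) (p : ℤ) (a : Line (p = 0)) :
    HeisAlg.gen X.heis c p (0, a) = algebraMap ℂ _ (propEval (p = 0) a : ℂ) := by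
  by_cases h : p = 0
  · subst h
    have e : ((0, a) : X.V.X 0 × Line ((0 : ℤ) = 0)) = a ⟨rfl⟩ • X.heis.unit := by
      refine Prod.ext (smul_zero _).symm (funext fun _ => (mul_one _).symm)
    rw [propEval_pos a rfl, Algebra.algebraMap_eq_smul_one, ← HeisAlg.gen_unit (H := X.heis),
      ← HeisAlg.gen_smul]
    exact congrArg (HeisAlg.gen X.heis c 0) e
  · have e : ((0, a) : X.V.X p × Line (p = 0)) = 0 := Prod.ext rfl (funext fun h' => (h h'.down).elim)
    rw [propEval_neg a h, Complex.ofReal_zero, map_zero]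
    exact (congrArg (HeisAlg.gen X.heis c p) e).trans (map_zero _)

/-- The images of the generators under `ofHeis`. -/
def ofHeisGen (X : PoCh.{w}) (p : ℤ) : X.V.X p × Line (p = 0) →ₗ[ℝ] CCRAlg X :=
  realLin (fun x => gen X p x.1 + algebraMap ℂ _ (propEval (p = 0) x.2 : ℂ))
    (fun x y => by
      rw [Prod.fst_add, Prod.snd_add, map_add, map_add, Complex.ofReal_add, map_add]; abel)
    (fun c x => by
      rw [Prod.smul_fst, Prod.smul_snd, gen_smul, map_smul, smul_eq_mul, Complex.ofReal_mul,
        map_mul, smul_add, Algebra.smul_def (c : ℂ) (algebraMap ℂ (CCRAlg X) _)])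

theorem ofHeisGen_apply (p : ℤ) (x : X.V.X p × Line (p = 0)) :
    ofHeisGen X p x = gen X p x.1 + algebraMap ℂ _ (propEval (p = 0) x.2 : ℂ) := rfl

/-- A nonzero scalar occurs only for `p = 0`, where the sign is trivial. -/
theorem ksign_mul_propEval (p q : ℤ) (a : Line (p = 0)) :
    ksign (p * q) • algebraMap ℂ (CCRAlg X) (propEval (p = 0) a : ℂ)
      = algebraMap ℂ (CCRAlg X) (propEval (p = 0) a : ℂ) := by
  by_cases h : p = 0
  · subst h
    rw [zero_mul, ksign_zero, one_smul]
  · rw [propEval_neg a h, Complex.ofReal_zero, map_zero, smul_zero]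

theorem ofHeisGen_comm (p q : ℤ) (x : X.V.X p × Line (p = 0)) (y : X.V.X q × Line (q = 0)) :
    ofHeisGen X p x * ofHeisGen X q y - ksign (p * q) • (ofHeisGen X q y * ofHeisGen X p x)
      = (Complex.I * ((1 : ℝ) : ℂ)) • ofHeisGen X (p + q) (X.heis.β p q (p + q) x y) := by
  have h1 := gen_ccr p q x.1 y.1
  have h2 : ofHeisGen X (p + q) (X.heis.β p q (p + q) x y)
      = algebraMap ℂ _ (X.τ.1 p q x.1 y.1 : ℂ) := by
    have h3 : propEval (p + q = 0) (fun _ => X.τ.1 p q x.1 y.1) = X.τ.1 p q x.1 y.1 := by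
      by_cases h : p + q = 0
      · exact propEval_pos _ h
      · rw [propEval_neg _ h, tau_eq_zero p q h]
    refine (ofHeisGen_apply _ _).trans ?_
    change gen X (p + q) 0 + algebraMap ℂ _ (propEval (p + q = 0)
      (fun _ => X.τ.1 p q x.1 y.1) : ℂ) = _
    rw [map_zero, zero_add, h3]
  rw [h2, Complex.ofReal_one, mul_one, Algebra.smul_def Complex.I, ← map_mul, ← h1, ofHeisGen_apply,
    ofHeisGen_apply]
  have ha := ksign_mul_propEval (X := X) p q x.2
  have hb := ksign_mul_propEval (X := X) q p y.2
  rw [mul_comm q p] at hb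
  have ca := Algebra.commutes (A := CCRAlg X) (propEval (p = 0) x.2 : ℂ)
  have cb := Algebra.commutes (A := CCRAlg X) (propEval (q = 0) y.2 : ℂ)
  generalize algebraMap ℂ (CCRAlg X) (propEval (p = 0) x.2 : ℂ) = a at *
  generalize algebraMap ℂ (CCRAlg X) (propEval (q = 0) y.2 : ℂ) = b at *
  generalize gen X p x.1 = x'
  generalize gen X q y.1 = y'
  -- The scalar parts are central and carry no signs, so they drop out of the graded commutator.
  have e1 : ksign (p * q) • (y' * a) = a * y' := by rw [← mul_smul_comm, ha, ca]
  have e2 : ksign (p * q) • (b * x') = x' * b := by rw [← smul_mul_assoc, hb, cb]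
  have e3 : ksign (p * q) • (b * a) = a * b := by rw [← smul_mul_assoc, hb, ca]
  rw [add_mul, add_mul, mul_add, mul_add, mul_add, mul_add, smul_add, smul_add, smul_add, e1, e2,
    e3]
  abel

/-- The isomorphism from the enveloping algebra of the central extension to the CCR algebra. -/
def ofHeis (X : PoCh.{w}) : HeisAlg.dgStarAlg X.heis 1 ⟶ CCR.obj X :=
  HeisAlg.liftHom (CCR.obj X) (ofHeisGen X) ofHeisGen_comm
    (by
      refine (ofHeisGen_apply 0 _).trans ?_
      change gen X 0 0 + algebraMap ℂ _ (propEval ((0 : ℤ) = 0) (fun _ => 1) : ℂ) = 1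
      rw [propEval_pos _ rfl, map_zero, zero_add, Complex.ofReal_one, map_one])
    (fun p x => by
      refine add_mem (gen_mem p x.1) ?_
      by_cases h : p = 0
      · subst h
        rw [Algebra.algebraMap_eq_smul_one]
        have h1 : (1 : CCRAlg X) ∈ gr X 0 := SetLike.GradedOne.one_mem
        exact Submodule.smul_mem _ _ h1
      · rw [propEval_neg _ h, Complex.ofReal_zero, map_zero]
        exact zero_mem _)
    (fun p q h x => by
      change diff X (gen X p x.1 + algebraMap ℂ _ (propEval (p = 0) x.2 : ℂ))
        = gen X q _ + algebraMap ℂ _ (propEval (q = 0) 0 : ℂ)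
      obtain rfl : q = p - 1 := by omega
      rw [map_add, diff_gen, Algebra.algebraMap_eq_smul_one, map_smul, diff_one, smul_zero,
        map_zero, Complex.ofReal_zero, map_zero]
      rfl)
    (fun p x => by
      change conjStar X (gen X p x.1 + algebraMap ℂ _ (propEval (p = 0) x.2 : ℂ))
        = gen X p x.1 + algebraMap ℂ _ (propEval (p = 0) x.2 : ℂ)
      rw [map_add, conjStar_gen, Algebra.algebraMap_eq_smul_one, LinearMap.map_smulₛₗ,
        conjStar_one, Complex.conj_ofReal])

theorem ofHeis_gen (p : ℤ) (x : X.V.X p × Line (p = 0)) :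
    (ofHeis X).f (HeisAlg.gen X.heis 1 p x)
      = (gen X p x.1 + algebraMap ℂ _ (propEval (p = 0) x.2 : ℂ) : CCRAlg X) :=
  HeisAlg.liftHom_gen (H := X.heis) (CCR.obj X) (ofHeisGen X) _ _ _ _ _ p x

/-- The inverse of `ofHeis`. -/
def toHeis (X : PoCh.{w}) : CCRAlg X →ₐ[ℂ] HeisAlg X.heis 1 :=
  lift (fun p => HeisAlg.gen X.heis 1 p ∘ₗ LinearMap.inl ℝ (X.V.X p) (Line (p = 0)))
    (fun p q x y => by
      refine (HeisAlg.gen_comm (H := X.heis) (c := 1) p q (LinearMap.inl ℝ (X.V.X p) (Line (p = 0)) x)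
        (LinearMap.inl ℝ (X.V.X q) (Line (q = 0)) y)).trans ?_
      refine (congrArg _ (heis_gen_unit 1 (p + q) fun _ => X.τ.1 p q x y)).trans ?_
      rw [Complex.ofReal_one, mul_one, Algebra.smul_def, ← map_mul]
      by_cases h : p + q = 0
      · rw [propEval_pos _ h]
      · rw [propEval_neg _ h, tau_eq_zero p q h])

theorem toHeis_gen (p : ℤ) (x : X.V.X p) :
    toHeis X (gen X p x) = HeisAlg.gen X.heis 1 p (x, 0) := lift_gen _ _ p x

theorem ofHeis_toHeis (a : CCRAlg X) : (ofHeis X).f (toHeis X a) = a := by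
  refine AlgHom.congr_fun (φ₁ := (ofHeis X).f.comp (toHeis X)) (φ₂ := AlgHom.id ℂ _)
    (hom_ext fun p x => ?_) a
  refine (congrArg (ofHeis X).f (toHeis_gen p x)).trans ((ofHeis_gen p (x, 0)).trans ?_)
  rw [map_zero, Complex.ofReal_zero, map_zero, add_zero]
  rfl

theorem toHeis_ofHeis (a : HeisAlg X.heis 1) : toHeis X ((ofHeis X).f a) = a := by
  refine AlgHom.congr_fun (φ₁ := (toHeis X).comp (ofHeis X).f) (φ₂ := AlgHom.id ℂ _)
    (HeisAlg.hom_ext fun p x => ?_) a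
  refine (congrArg (toHeis X) (ofHeis_gen p x)).trans ?_
  rw [map_add, toHeis_gen, AlgHom.commutes, ← heis_gen_unit 1 p]
  refine (map_add (HeisAlg.gen X.heis 1 p) _ _).symm.trans ?_
  refine congrArg (HeisAlg.gen X.heis 1 p) (Prod.ext (add_zero _) (zero_add _))

theorem diff_toHeis (a : CCRAlg X) :
    HeisAlg.diff X.heis 1 (toHeis X a) = toHeis X (diff X a) := by
  have h := congrArg (toHeis X) ((ofHeis X).map_d (toHeis X a))
  rw [ofHeis_toHeis] at h
  exact (toHeis_ofHeis _).symm.trans h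

/-- A bijection compatible with the differentials is bijective on homology. -/
theorem ofHeis_weq (X : PoCh.{w}) : DGStarAlg.homotopical.weq (ofHeis X) := by
  refine DGStarAlg.weq_of_hBijective _ (fun a _ b hab => ⟨toHeis X b, ?_⟩) fun b hb =>
    ⟨toHeis X b, (diff_toHeis b).trans ((congrArg _ hb).trans (map_zero _)), 0, ?_⟩
  · refine (diff_toHeis b).trans ?_
    refine (congrArg (toHeis X) hab).symm.trans (toHeis_ofHeis a)
  · rw [map_zero, add_zero]
    exact (ofHeis_toHeis b).symm

theorem ofHeis_naturality {X Y : PoCh.{w}} (f : X ⟶ Y) :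
    HeisAlg.map (PoCh.heisHom f.f) (PoCh.heisHom_preservesBracket f) ≫ ofHeis Y
      = ofHeis X ≫ CCR.map f := by
  refine DGStarAlg.Hom.ext (HeisAlg.hom_ext fun p x => ?_)
  refine (congrArg (ofHeis Y).f (HeisAlg.mapAlg_gen _
    (PoCh.heisHom_preservesBracket f) p x)).trans ((ofHeis_gen p _).trans ?_)
  refine Eq.trans ?_ (congrArg (CCRAlg.map f) (ofHeis_gen p x)).symm
  rw [map_add, map_gen, AlgHom.commutes]
  rfl

end CCRAlg

/-! ### Quantization preserves weak equivalences -/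

theorem HomotopicalStructure.weq_comp {C : Type u} [Category.{v} C] (h : HomotopicalStructure C)
    {X Y Z : C} (f : X ⟶ Y) (g : Y ⟶ Z) (hf : h.weq f) (hg : h.weq g) : h.weq (f ≫ g) := by
  have := (h.two_of_six f (𝟙 Y) g (by rwa [Category.comp_id]) (by rwa [Category.id_comp])).2.2.2
  rwa [Category.id_comp] at this

/-- The 2-of-6 property for the identity, `f` and `g`. -/
theorem HomotopicalStructure.weq_of_comp_left {C : Type u} [Category.{v} C]
    (h : HomotopicalStructure C) {X Y Z : C} (f : X ⟶ Y) (g : Y ⟶ Z) (hf : h.weq f)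
    (hfg : h.weq (f ≫ g)) : h.weq g :=
  (h.two_of_six (𝟙 X) f g (by rwa [Category.id_comp]) hfg).2.2.1

/-- CCR quantization preserves weak equivalences. -/
theorem CCR_map_weq {X Y : PoCh.{w}} (f : X ⟶ Y) (hf : PoCh.homotopical.weq f) :
    DGStarAlg.homotopical.weq (CCR.map f) := by
  -- The right homotopy inverse `g` is itself a quasi-isomorphism and so has a right homotopy
  -- inverse `f'`. Neither need respect the Poisson structures.
  obtain ⟨g, h, hg, hh⟩ := exists_right_homotopy_inverse f.f (hf ())
  obtain ⟨f', h', -, hh'⟩ := exists_right_homotopy_inverse g hg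
  refine DGStarAlg.homotopical.weq_of_comp_left (CCRAlg.ofHeis X) _ (CCRAlg.ofHeis_weq X) ?_
  rw [← CCRAlg.ofHeis_naturality]
  exact DGStarAlg.homotopical.weq_comp _ _ (HeisAlg.map_weq _ (PoCh.heisHomotopy f.f g h hh)
    (PoCh.heisHomotopy g f' h' hh')) (CCRAlg.ofHeis_weq Y)

/-! ### The path between two Poisson structures

The graded vector space `V ⊕ ℝ 1 ⊕ ℝ t ⊕ ℝ dt` with `|t| = 0`, `|dt| = -1` and with bracket
`τ + t ∂ρ + dt ρ`. -/

/-- The differential `t ↦ dt`. -/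
def lineD (p q : ℤ) : Line (p = 0) →ₗ[ℝ] Line (q = -1) where
  toFun a _ := propEval (p = 0) a
  map_add' a b := by ext; simp
  map_smul' c a := by ext; simp

/-- The map `dt ↦ t`. -/
def lineH (p q : ℤ) : Line (p = -1) →ₗ[ℝ] Line (q = 0) where
  toFun a _ := propEval (p = -1) a
  map_add' a b := by ext; simp
  map_smul' c a := by ext; simp

theorem lineD_lineH (p q : ℤ) (h : p + 1 = q) (a : Line (p = -1)) : lineD q p (lineH p q a) = a := by
  refine funext fun hp => ?_
  have hp' := hp.down
  change propEval (q = 0) (fun _ => propEval (p = -1) a) = a hp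
  rw [propEval_pos _ (by omega), propEval_pos _ hp']

theorem lineH_lineD (p r : ℤ) (h : r + 1 = p) (a : Line (p = 0)) : lineH r p (lineD p r a) = a := by
  refine funext fun hp => ?_
  have hp' := hp.down
  change propEval (r = -1) (fun _ => propEval (p = 0) a) = a hp
  rw [propEval_pos _ (by omega), propEval_pos _ hp']

namespace PoCh

/-- The central extension `V ⊕ ℝ 1 ⊕ ℝ t ⊕ ℝ dt` with bracket `τ + t ∂ρ + dt ρ`. -/
def pathHeis (X : PoCh.{w}) (ρ : ExtHom X.V 1) : HeisData.{w} where
  W p := X.V.X p × Line (p = 0) × Line (p = 0) × Line (p = -1)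
  d p q := LinearMap.prod ((X.V.d p q).hom ∘ₗ LinearMap.fst ℝ _ _) (LinearMap.prod 0
    (LinearMap.prod 0 (lineD p q ∘ₗ LinearMap.fst ℝ _ _ ∘ₗ LinearMap.snd ℝ _ _ ∘ₗ
      LinearMap.snd ℝ _ _)))
  d_d p q r _ _ x := Prod.ext (ExtHom.d_d_hom X.V p q r x.1)
    (Prod.ext rfl (Prod.ext rfl (map_zero (lineD q r))))
  unit := (0, fun _ => 1, 0, 0)
  d_unit := Prod.ext (map_zero (X.V.d 0 (-1)).hom)
    (Prod.ext rfl (Prod.ext rfl (map_zero (lineD 0 (-1)))))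
  β p q r := LinearMap.mk₂ ℝ (fun x y => (0, fun _ => X.τ.1 p q x.1 y.1,
      fun _ => (ExtHom.del 1 0 rfl ρ).1 p q x.1 y.1, fun _ => ρ.1 p q x.1 y.1))
    (fun x x' y => by ext <;> simp) (fun c x y => by ext <;> simp)
    (fun x y y' => by ext <;> simp) (fun c x y => by ext <;> simp)
  β_degree p q r h := by
    refine LinearMap.ext fun x => LinearMap.ext fun y => Prod.ext rfl (Prod.ext
      (funext fun hr => ?_) (Prod.ext (funext fun hr => ?_) (funext fun hr => ?_)))
    · exact ExtHom.apply_eq_zero X.τ p q (by have := hr.down; omega) _ _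
    · exact ExtHom.apply_eq_zero (ExtHom.del 1 0 rfl ρ) p q (by have := hr.down; omega) _ _
    · exact ExtHom.apply_eq_zero ρ p q (by have := hr.down; omega) _ _
  β_antisymm p q r x y := by
    refine Prod.ext (by simp) (Prod.ext (funext fun _ => ?_)
      (Prod.ext (funext fun _ => ?_) (funext fun _ => ?_)))
    · simpa using ExtHom.antisymm X.τ p q x.1 y.1
    · simpa using ExtHom.antisymm (ExtHom.del 1 0 rfl ρ) p q x.1 y.1
    · simpa using ExtHom.antisymm ρ p q x.1 y.1
  d_β p p' q q' r r' hp hq hr x y := by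
    refine Prod.ext (by simp) (Prod.ext (funext fun _ => ?_)
      (Prod.ext (funext fun _ => ?_) (funext fun hr' => ?_)))
    · simpa using (ExtHom.closed_apply X.closed p p' q q' hp hq x.1 y.1).symm
    · simpa using (ExtHom.closed_apply (ExtHom.del_del 1 0 (-1) rfl rfl ρ) p p' q q' hp hq
        x.1 y.1).symm
    -- The `dt` component: the differential of `t ∂ρ(x, y)` is `dt ∂ρ(x, y)`, which is the formula
    -- for `∂ρ` in terms of `ρ`. The degree `r' = -1` forces `r = 0`, so the `t` component is
    -- present.
    · have h := ExtHom.del_one_apply ρ p p' q q' hp hq x.1 y.1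
      have hr0 : r = 0 := by have := hr'.down; omega
      rw [← zsmul_eq_mul] at h
      exact (propEval_pos (fun _ => (ExtHom.del 1 0 rfl ρ).1 p q x.1 y.1) hr0).trans h
  β_β p q r s t x y z := by ext <;> simp
  β_unit q r y := by ext <;> simp

variable {X Y : PoCh.{w}}

/-- The morphism of path extensions induced by a chain map. -/
def pathHeisHom (f : X ⟶ Y) (ρ : ExtHom X.V 1) (σ : ExtHom Y.V 1) :
    HeisHom (X.pathHeis ρ) (Y.pathHeis σ) where
  f p := LinearMap.prodMap (f.f.f p).hom LinearMap.id
  f_d p q _ x := Prod.ext (ExtHom.f_d_hom f.f p q x.1).symm rfl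
  f_unit := Prod.ext (map_zero (f.f.f 0).hom) rfl

theorem pathHeisHom_preservesBracket (f : X ⟶ Y) (ρ : ExtHom X.V 1) (σ : ExtHom Y.V 1)
    (h : ExtHom.pullback f.f 1 σ = ρ) : (pathHeisHom f ρ σ).PreservesBracket 1 := by
  intro p q r x y
  rw [one_smul, one_smul]
  refine Prod.ext (map_zero (f.f.f r).hom) (Prod.ext (funext fun _ => ?_)
      (Prod.ext (funext fun _ => ?_) (funext fun _ => ?_)))
  · exact congrArg (fun B : ExtHom X.V 0 => B.1 p q x.1 y.1) f.comm.symm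
  · exact congrArg (fun B : ExtHom X.V 0 => B.1 p q x.1 y.1)
      ((congrArg (ExtHom.del 1 0 rfl) h).symm.trans (ExtHom.pullback_del f.f 1 0 rfl σ).symm)
  · exact congrArg (fun B : ExtHom X.V 1 => B.1 p q x.1 y.1) h.symm

/-! ### Evaluation of the path at a parameter -/

section Evaluation

variable (X) (ρ : ExtHom X.V 1) (e : ℝ) (σ : ExtHom X.V 0)
  (hσ : ExtHom.del 0 (-1) rfl σ = 0)

/-- The evaluation `t ↦ e`, with values in the central extension for a bracket `σ`. -/
def pathEval : HeisHom (X.pathHeis ρ) (PoCh.heis ⟨X.V, σ, hσ⟩) where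
  f p := LinearMap.prod (LinearMap.fst ℝ _ _)
    ((LinearMap.fst ℝ _ _ + e • (LinearMap.fst ℝ _ _ ∘ₗ LinearMap.snd ℝ _ _)) ∘ₗ
      LinearMap.snd ℝ _ _)
  f_d p q _ x := Prod.ext rfl (by
    change (0 : Line (q = 0)) + e • 0 = 0
    rw [smul_zero, add_zero])
  f_unit := Prod.ext rfl (by
    change (fun _ => 1 : Line ((0 : ℤ) = 0)) + e • 0 = fun _ => 1
    rw [smul_zero, add_zero])

/-- Under `t ↦ e`, `dt ↦ 0` the bracket `τ + t ∂ρ + dt ρ` becomes `τ + e ∂ρ`. Keeping `σ` a variable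
subject to an equation lets the targets at `e = 0` and `e = 1` be `(V, τ)` and `(V, τ + ∂ρ)` on the
nose. -/
theorem pathEval_preservesBracket (h : σ = X.τ + e • ExtHom.del 1 0 rfl ρ) :
    (pathEval X ρ e σ hσ).PreservesBracket 1 := by
  intro p q r x y
  rw [one_smul, one_smul]
  refine Prod.ext rfl (funext fun _ => ?_)
  exact congrArg (fun B : ExtHom X.V 0 => B.1 p q x.1 y.1) h.symm

/-- The inclusion of the central extension by the unit, a section of `pathEval`. -/
def pathIncl : HeisHom (PoCh.heis ⟨X.V, σ, hσ⟩) (X.pathHeis ρ) where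
  f _ := LinearMap.prodMap LinearMap.id (LinearMap.inl ℝ _ _)
  f_d p q _ _ := Prod.ext rfl (Prod.ext rfl (Prod.ext rfl (map_zero (lineD p q)).symm))
  f_unit := rfl

/-- `pathEval` is left inverse to `pathIncl`. -/
def pathHomotopyLeft :
    HeisHomotopy ((pathIncl X ρ σ hσ).comp (pathEval X ρ e σ hσ)) (HeisHom.id _) where
  h _ _ := 0
  eq p q r _ _ x := by
    refine Prod.ext ?_ ?_
    · change x.1 - x.1 = (X.V.d q p).hom 0 + 0
      rw [sub_self, map_zero, add_zero]
    · change x.2 - (x.2 + e • (0 : Line (p = 0))) = (0 : Line (p = 0)) + 0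
      rw [smul_zero, add_zero, sub_self, add_zero]
  unit := rfl

/-- `pathEval` is right homotopy inverse to `pathIncl`. -/
def pathHomotopyRight :
    HeisHomotopy ((pathEval X ρ e σ hσ).comp (pathIncl X ρ σ hσ)) (HeisHom.id _) where
  -- The homotopy is `dt ↦ t - e 1`: its commutator with `d` sends `t` to `t - e 1` and `dt` to
  -- `dt`, which is the identity minus evaluation followed by inclusion.
  h p q := LinearMap.prod 0 ((LinearMap.prod (-e • lineH p q)
    (LinearMap.prod (lineH p q) 0)) ∘ₗ LinearMap.snd ℝ _ _ ∘ₗ LinearMap.snd ℝ _ _ ∘ₗ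
      LinearMap.snd ℝ _ _)
  eq p q r hq hr x := by
    refine Prod.ext ?_ (Prod.ext ?_ (Prod.ext ?_ ?_))
    · change x.1 - x.1 = (X.V.d q p).hom 0 + 0
      rw [sub_self, map_zero, add_zero]
    · change x.2.1 - (x.2.1 + e • x.2.2.1) = 0 + -e • lineH r p (lineD p r x.2.2.1)
      rw [lineH_lineD p r hr, zero_add, neg_smul, sub_add_cancel_left]
    · change x.2.2.1 - 0 = 0 + lineH r p (lineD p r x.2.2.1)
      rw [lineH_lineD p r hr, sub_zero, zero_add]
    · change x.2.2.2 - 0 = lineD q p (lineH p q x.2.2.2) + 0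
      rw [lineD_lineH p q hq, sub_zero, add_zero]
  unit := Prod.ext rfl (Prod.ext (map_zero (-e • lineH 0 1))
    (Prod.ext (map_zero (lineH 0 1)) rfl))

/-- The evaluation at `t = e` of the quantized path. -/
def quantEval (h : σ = X.τ + e • ExtHom.del 1 0 rfl ρ) :
    HeisAlg.dgStarAlg (X.pathHeis ρ) 1 ⟶ CCR.obj ⟨X.V, σ, hσ⟩ :=
  HeisAlg.map (pathEval X ρ e σ hσ) (pathEval_preservesBracket X ρ e σ hσ h) ≫ CCRAlg.ofHeis _

/-- The section `pathIncl` ignores the `t` and `dt` parts of the bracket; `HeisAlg.map_weq` asks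
only the evaluation itself to preserve brackets. -/
theorem quantEval_weq (h : σ = X.τ + e • ExtHom.del 1 0 rfl ρ) :
    DGStarAlg.homotopical.weq (quantEval X ρ e σ hσ h) :=
  DGStarAlg.homotopical.weq_comp _ _ (HeisAlg.map_weq _ (pathHomotopyLeft X ρ e σ hσ)
    (pathHomotopyRight X ρ e σ hσ)) (CCRAlg.ofHeis_weq _)

theorem quantEval_gen (h : σ = X.τ + e • ExtHom.del 1 0 rfl ρ) (p : ℤ)
    (x : X.V.X p × Line (p = 0) × Line (p = 0) × Line (p = -1)) :
    (quantEval X ρ e σ hσ h).f (HeisAlg.gen (X.pathHeis ρ) 1 p x)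
      = (CCRAlg.gen ⟨X.V, σ, hσ⟩ p x.1
        + algebraMap ℂ _ (propEval (p = 0) (x.2.1 + e • x.2.2.1) : ℂ) : CCRAlg ⟨X.V, σ, hσ⟩) :=
  (congrArg (CCRAlg.ofHeis _).f (HeisAlg.mapAlg_gen _
    (pathEval_preservesBracket X ρ e σ hσ h) p x)).trans (CCRAlg.ofHeis_gen p _)

end Evaluation

/-- One statement for both ends of the path: `g` is `f` regarded as a morphism for the brackets `σ`
and `σ'`, so only its underlying chain map is compared with that of `f`. -/
theorem quantEval_naturality (f : X ⟶ Y) (ρ : ExtHom X.V 1) (ρ' : ExtHom Y.V 1)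
    (hρ : ExtHom.pullback f.f 1 ρ' = ρ) (e : ℝ) (σ : ExtHom X.V 0) (σ' : ExtHom Y.V 0) (hσ hσ')
    (h : σ = X.τ + e • ExtHom.del 1 0 rfl ρ) (h' : σ' = Y.τ + e • ExtHom.del 1 0 rfl ρ')
    (g : (⟨X.V, σ, hσ⟩ : PoCh.{w}) ⟶ ⟨Y.V, σ', hσ'⟩) (hg : g.f = f.f) :
    HeisAlg.map (pathHeisHom f ρ ρ') (pathHeisHom_preservesBracket f ρ ρ' hρ)
      ≫ quantEval Y ρ' e σ' hσ' h' = quantEval X ρ e σ hσ h ≫ CCR.map g := by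
  refine DGStarAlg.Hom.ext (HeisAlg.hom_ext fun p x => ?_)
  refine (congrArg (quantEval Y ρ' e σ' hσ' h').f (HeisAlg.mapAlg_gen _
    (pathHeisHom_preservesBracket f ρ ρ' hρ) p x)).trans ((quantEval_gen Y ρ' e σ' hσ' h' p
      _).trans ?_)
  refine Eq.trans ?_ (congrArg (CCRAlg.map g) (quantEval_gen X ρ e σ hσ h p x)).symm
  rw [map_add (CCRAlg.map g), CCRAlg.map_gen, AlgHom.commutes, hg]
  rfl

/-! ### The zig-zag of natural weak equivalences -/

section Functor

variable {C : Type u} [Category.{v} C] (F : C ⥤ PoCh.{w}) (ρ : NatChain (F ⋙ PoCh.forget) 1)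

/-- The quantized path between `(V, τ)` and `(V, τ + ∂ρ)`. -/
def pathFunctor : C ⥤ DGStarAlg.{w} where
  obj c := HeisAlg.dgStarAlg ((F.obj c).pathHeis (ρ.app c)) 1
  map f := HeisAlg.map (pathHeisHom (F.map f) _ _)
    (pathHeisHom_preservesBracket _ _ _ (ρ.naturality f))
  map_id c := by
    refine DGStarAlg.Hom.ext (HeisAlg.hom_ext fun p x => (HeisAlg.mapAlg_gen _
      (pathHeisHom_preservesBracket _ _ _ (ρ.naturality (𝟙 c))) p x).trans ?_)
    refine congrArg (HeisAlg.gen _ 1 p) (Prod.ext ?_ rfl)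
    exact congrArg (fun g : F.obj c ⟶ F.obj c => (g.f.f p).hom x.1) (F.map_id c)
  map_comp {c c' c''} f g := by
    refine DGStarAlg.Hom.ext (HeisAlg.hom_ext fun p x => (HeisAlg.mapAlg_gen _
      (pathHeisHom_preservesBracket _ _ _ (ρ.naturality (f ≫ g))) p x).trans (Eq.trans ?_ ((congrArg (HeisAlg.mapAlg (pathHeisHom (F.map g) _ _)
        (pathHeisHom_preservesBracket _ _ _ (ρ.naturality g))) (HeisAlg.mapAlg_gen
          (pathHeisHom (F.map f) _ _) (pathHeisHom_preservesBracket _ _ _ (ρ.naturality f))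
          p x)).trans (HeisAlg.mapAlg_gen _
            (pathHeisHom_preservesBracket _ _ _ (ρ.naturality g)) p _)).symm))
    refine congrArg (HeisAlg.gen _ 1 p) (Prod.ext ?_ rfl)
    exact congrArg (fun g : F.obj c ⟶ F.obj c'' => (g.f.f p).hom x.1) (F.map_comp f g)

/-- The evaluation at `t = 0`. -/
def pathSource : pathFunctor F ρ ⟶ F ⋙ CCR where
  app c := quantEval (F.obj c) (ρ.app c) 0 (F.obj c).τ (F.obj c).closed
    (by rw [zero_smul, add_zero])
  naturality _ _ f := quantEval_naturality (F.map f) _ _ (ρ.naturality f) 0 _ _ _ _ _ _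
    (F.map f) rfl

/-- The evaluation at `t = 1`. -/
def pathTarget : pathFunctor F ρ ⟶ perturbFunctor F ρ ⋙ CCR where
  app c := quantEval (F.obj c) (ρ.app c) 1 _ ((F.obj c).perturb (ρ.app c)).closed
    (by rw [one_smul]; rfl)
  naturality _ _ f := quantEval_naturality (F.map f) _ _ (ρ.naturality f) 1 _ _ _ _ _ _
    ((perturbFunctor F ρ).map f) rfl

theorem pathSource_weq (c : C) : DGStarAlg.homotopical.weq ((pathSource F ρ).app c) :=
  quantEval_weq (F.obj c) (ρ.app c) 0 _ _ (by rw [zero_smul, add_zero])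

theorem pathTarget_weq (c : C) : DGStarAlg.homotopical.weq ((pathTarget F ρ).app c) :=
  quantEval_weq (F.obj c) (ρ.app c) 1 _ ((F.obj c).perturb (ρ.app c)).closed
    (by rw [one_smul]; rfl)

end Functor

end PoCh

end CCRQuant
end

/-! ### The proposition -/

theorem mainTheorem10 {C : Type u} [Category.{v} C] :
    CCRQuant.IsHomotopicalFunctor
        (CCRQuant.PoCh.homotopical.{w}.functorCategory C)
        (CCRQuant.DGStarAlg.homotopical.{w}.functorCategory C)
        ((Functor.whiskeringRight C CCRQuant.PoCh.{w} CCRQuant.DGStarAlg.{w}).obj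
          CCRQuant.CCR.{w}) ∧
    ∀ (F : C ⥤ CCRQuant.PoCh.{w}) (ρ : CCRQuant.NatChain (F ⋙ CCRQuant.PoCh.forget) 1),
      ∃ (A : C ⥤ CCRQuant.DGStarAlg.{w})
        (l : A ⟶ F ⋙ CCRQuant.CCR)
        (r : A ⟶ CCRQuant.PoCh.perturbFunctor F ρ ⋙ CCRQuant.CCR),
        (CCRQuant.DGStarAlg.homotopical.{w}.functorCategory C).weq l ∧
        (CCRQuant.DGStarAlg.homotopical.{w}.functorCategory C).weq r := by
  exact ⟨fun X Y f hf c => CCRQuant.CCR_map_weq (f.app c) (hf c), fun F ρ =>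
    ⟨CCRQuant.PoCh.pathFunctor F ρ, CCRQuant.PoCh.pathSource F ρ, CCRQuant.PoCh.pathTarget F ρ,
      CCRQuant.PoCh.pathSource_weq F ρ, CCRQuant.PoCh.pathTarget_weq F ρ⟩⟩
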